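/- **Setting.** Let $C\subset\mathbb{R}^2$ be the closure of the set of $(x,y)$ for which $\lfloor x-1/2\rfloor$ and $\lfloor y-1/2\rfloor$ have opposite parity, and let the Mucube be $$M=\{(x,y,z)\in\mathbb{R}^3 : (x,y),(x,z),(y,z)\in C\}.$$ It is a surface tiled by unit squares, flat except at the vertices of the squares (its cone points, of angle $3\pi$). The group $\mathbb{Z}^3$ acts on $M$ by the translations $p\mapsto p+2t$; let $X=M/\mathbb{Z}^3$, and let $Y=X/(\mathbb{Z}/3)$ be the quotient of $X$ by the group of order three generated by the rotation $(x,y,z)\mapsto(z,x,y)$. The centre of each square face of $M$ has one odd, one even and one half-integral coordinate. Call *horizontal* the direction of the axis of the even coordinate, and *vertical* that of the odd one. Orienting $M$ by the outward normal (away from the component of $\mathbb{R}^3\setminus M$ that contains the origin), one gets a half-translation structure on the complement of the cone points of $M$, in which directions are given by nonzero vectors $v\in\mathbb{R}^2$ up to scaling; it descends to the complement of the images of the cone points in $Y$. The *horizontal core curve* $\gamma_0\subset Y$ is the image of the set of points of $M$ that have an odd integer coordinate, and the upward direction across it is the one in which this coordinate increases. The *algebraic intersection number* of a closed straight-line trajectory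 in $Y$ with $\gamma_0$ is the number of its upward crossings of $\gamma_0$ minus the number of its downward crossings, over one period (it is $0$ if the trajectory runs along $\gamma_0$). The direction of $v$ is *periodic* on $M$ if every straight-line trajectory on $M$ in this direction that never meets a cone point is closed. The surface $Y$ *decomposes into a single cylinder* in the direction of $v$ if there is an open flat cylinder, embedded in $Y$ away from the cone points and foliated by closed straight-line trajectories in the direction of $v$, whose closure is $Y$; its *core curve* is its middle closed trajectory. **Theorem.** For every nonzero $v\in\mathbb{R}^2$, the direction of $v$ is periodic on $M$ if and only if $Y$ decomposes into a single cylinder in the direction of $v$ and the core curve of this cylinder has algebraic intersection number $0$ with the horizontal core curve $\gamma_0$. -/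

import Mathlib

open Set Filter Topology

noncomputable section

namespace Mucube

/-! ### The Mucube and its quotients -/

/-- Ambient space; only its topology and its linear structure are used. -/
abbrev R3 : Type := Fin 3 → ℝ

/-- The plane in which the square faces are developed. -/
abbrev Plane : Type := ℝ × ℝ

/-- The closed checkerboard pattern in the plane. -/
def checkerboard : Set (ℝ × ℝ) :=
  closure {w | ¬ (Even ⌊w.1 - 1 / 2⌋ ↔ Even ⌊w.2 - 1 / 2⌋)}

/-- The Mucube as a subset of three-space: all three coordinate shadows are checkerboards. -/
def mucube : Set R3 :=
  {p | (p 0, p 1) ∈ checkerboard ∧ (p 0, p 2) ∈ checkerboard ∧ (p 1, p 2) ∈ checkerboard}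

/-- The Mucube as a topological space. -/
abbrev M : Type := mucube

lemma even_floor_add_two_mul (a : ℝ) (t : ℤ) :
    Even ⌊a + 2 * (t : ℝ) - 1 / 2⌋ ↔ Even ⌊a - 1 / 2⌋ := by
  have h : a + 2 * (t : ℝ) - 1 / 2 = (a - 1 / 2) + ((2 * t : ℤ) : ℝ) := by push_cast; ring
  rw [h, Int.floor_add_intCast, Int.even_add]
  simp

lemma checkerboard_translate {a b : ℝ} (s t : ℤ) (h : (a, b) ∈ checkerboard) :
    (a + 2 * (s : ℝ), b + 2 * (t : ℝ)) ∈ checkerboard := by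
  have hc : Continuous (fun w : ℝ × ℝ => (w.1 + 2 * (s : ℝ), w.2 + 2 * (t : ℝ))) := by fun_prop
  refine map_mem_closure (f := fun w : ℝ × ℝ => (w.1 + 2 * (s : ℝ), w.2 + 2 * (t : ℝ))) hc h ?_
  intro w hw
  simpa only [mem_ofPred_eq, even_floor_add_two_mul] using hw

lemma checkerboard_swap {a b : ℝ} (h : (a, b) ∈ checkerboard) : (b, a) ∈ checkerboard := by
  refine map_mem_closure (f := Prod.swap) (x := (a, b)) continuous_swap h ?_
  intro w hw h'
  exact hw h'.symm

/-- The vector `t` of integers acts on the Mucube by translation by `2 t`. -/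
instance : AddAction (Fin 3 → ℤ) M where
  vadd t p := ⟨fun i => p.1 i + 2 * (t i : ℝ),
    checkerboard_translate _ _ p.2.1, checkerboard_translate _ _ p.2.2.1,
    checkerboard_translate _ _ p.2.2.2⟩
  zero_vadd p := by
    apply Subtype.ext
    funext i
    change p.1 i + 2 * (((0 : Fin 3 → ℤ) i : ℤ) : ℝ) = p.1 i
    simp
  add_vadd s t p := by
    apply Subtype.ext
    funext i
    change p.1 i + 2 * (((s + t) i : ℤ) : ℝ) = p.1 i + 2 * (t i : ℝ) + 2 * (s i : ℝ)
    rw [Pi.add_apply]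
    push_cast
    ring

lemma coe_vadd_apply (t : Fin 3 → ℤ) (p : M) (i : Fin 3) :
    (t +ᵥ p).1 i = p.1 i + 2 * (t i : ℝ) := rfl

/-- The quotient of the Mucube by its translation group. -/
abbrev X : Type := AddAction.orbitRel.Quotient (Fin 3 → ℤ) M

/-- The projection of the Mucube to `X`. -/
def toX (p : M) : X := Quotient.mk _ p

/-- The rotation by `2π/3` about the main diagonal, `(x, y, z) ↦ (z, x, y)`. -/
def rotM (p : M) : M :=
  ⟨![p.1 2, p.1 0, p.1 1], checkerboard_swap p.2.2.1, checkerboard_swap p.2.2.2, p.2.1⟩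

lemma rotM_vadd (t : Fin 3 → ℤ) (p : M) : rotM (t +ᵥ p) = ![t 2, t 0, t 1] +ᵥ rotM p := by
  apply Subtype.ext
  funext i
  rw [coe_vadd_apply]
  fin_cases i <;> rfl

lemma rotM_rotM_rotM (p : M) : rotM (rotM (rotM p)) = p := by
  apply Subtype.ext
  funext i
  fin_cases i <;> rfl

/-- The map of `X` induced by the rotation. -/
def rotXFun : X → X :=
  Quotient.map' rotM (by
    rintro _ p ⟨t, rfl⟩
    exact ⟨![t 2, t 0, t 1], (rotM_vadd t p).symm⟩)

lemma rotXFun_rotXFun_rotXFun (x : X) : rotXFun (rotXFun (rotXFun x)) = x := by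
  induction x using Quotient.inductionOn' with
  | h p => exact congrArg toX (rotM_rotM_rotM p)

/-- The rotation of order three, as a permutation of `X`. -/
def rotX : Equiv.Perm X where
  toFun := rotXFun
  invFun x := rotXFun (rotXFun x)
  left_inv := rotXFun_rotXFun_rotXFun
  right_inv := rotXFun_rotXFun_rotXFun

/-- The quotient of `X` by the group of order three generated by the rotation. -/
abbrev Y : Type := MulAction.orbitRel.Quotient (Subgroup.zpowers rotX) X

/-- The projection of the Mucube to `Y`. -/
def toY (p : M) : Y := Quotient.mk _ (toX p)

/-! ### Flat structures -/

/-- `(c, a, b)` frames a square face of the Mucube: `c` is the centre of the face,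
which has one odd, one even and one half-integral coordinate.
The *horizontal* unit vector `a` points along the axis of the even coordinate, the *vertical*
unit vector `b` along the axis of the odd one, and `a × b` is the outward unit normal `ν e_k`.
(The unit cubes centred at the integral points with at most one odd coordinate make up the inside
of the Mucube, so the inward neighbour of the face is the one for which `c k - ν / 2` is even.)
Every face has exactly two frames, `(c, a, b)` and `(c, -a, -b)`, and the face itself consists of
the points `c + x a + y b` with `|x|, |y| ≤ 1 / 2`. -/
def IsFaceFrame (c a b : R3) : Prop :=
  ∃ (i j k : Fin 3) (δ ε ν : ℝ), i ≠ j ∧ i ≠ k ∧ j ≠ k ∧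
    (δ = 1 ∨ δ = -1) ∧ (ε = 1 ∨ ε = -1) ∧ (ν = 1 ∨ ν = -1) ∧
    (∃ l : ℤ, c i = 2 * l + 1) ∧ (∃ m : ℤ, c j = 2 * m) ∧ (∃ n : ℤ, c k - ν / 2 = 2 * n) ∧
    a = ε • Pi.single j 1 ∧ b = δ • Pi.single i 1 ∧
    crossProduct a b = ν • Pi.single k 1

/-- A chart of a flat structure on `S`: a map to `S` of which only the restriction to the domain
matters. -/
structure FlatChart (S : Type) where
  domain : Set Plane
  map : Plane → S

/-- The chart develops two faces that share a vertical edge, side by side. -/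
def IsHorizontalDomino (φ : FlatChart M) : Prop :=
  ∃ c a c' a' b : R3, IsFaceFrame c a b ∧ IsFaceFrame c' a' b ∧
    c + (1 / 2 : ℝ) • a = c' - (1 / 2 : ℝ) • a' ∧
    φ.domain = Ioo (-1 / 2) (3 / 2) ×ˢ Ioo (-1 / 2) (1 / 2) ∧
    ∀ z ∈ φ.domain, (φ.map z : R3) =
      if z.1 ≤ 1 / 2 then c + z.1 • a + z.2 • b else c' + (z.1 - 1) • a' + z.2 • b

/-- The chart develops two faces that share a horizontal edge, one above the other. -/
def IsVerticalDomino (φ : FlatChart M) : Prop :=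
  ∃ c b c' b' a : R3, IsFaceFrame c a b ∧ IsFaceFrame c' a b' ∧
    c + (1 / 2 : ℝ) • b = c' - (1 / 2 : ℝ) • b' ∧
    φ.domain = Ioo (-1 / 2) (1 / 2) ×ˢ Ioo (-1 / 2) (3 / 2) ∧
    ∀ z ∈ φ.domain, (φ.map z : R3) =
      if z.2 ≤ 1 / 2 then c + z.1 • a + z.2 • b else c' + z.1 • a + (z.2 - 1) • b'

/-- The half-translation structure of the Mucube (minus its cone points, which are the vertices of
the faces). The charts are isometric for the path metric, they cover everything but the cone
points, and their changes of coordinates are translations or rotations by `π` composed with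
translations. -/
def atlasM : Set (FlatChart M) := {φ | IsHorizontalDomino φ ∨ IsVerticalDomino φ}

/-- The half-translation structure that `Y` (minus its cone points) inherits from the Mucube. -/
def atlasY : Set (FlatChart Y) := (fun φ => ⟨φ.domain, toY ∘ φ.map⟩) '' atlasM

/-- A complete straight-line trajectory with velocity `± v` in the charts; it avoids the cone
points. -/
def IsTrajectory {S : Type} (A : Set (FlatChart S)) (v : Plane) (c : ℝ → S) : Prop :=
  ∀ t, ∃ φ ∈ A, ∃ z : Plane, ∀ᶠ s in 𝓝 t, z + s • v ∈ φ.domain ∧ c s = φ.map (z + s • v)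

/-- The direction of `v` is periodic on the Mucube: every straight-line trajectory in this direction
that never runs into a cone point closes up. -/
def IsPeriodicDirection (v : Plane) : Prop :=
  ∀ c : ℝ → M, IsTrajectory atlasM v c → ∃ T > 0, Function.Periodic c T

/-! ### Cylinders and intersection numbers -/

/-- The strip `ℝ × (0, h)`, rolled up by the translation by `ℓ` in the first coordinate,
is embedded in `S` as an open flat cylinder foliated by closed trajectories in the direction of
`v`; in the charts, the first coordinate runs along `v` and the second one along `v` rotated by
`π / 2`, both measured in units of the length of `v`. -/
def IsCylinder {S : Type} (A : Set (FlatChart S)) (v : Plane) (ℓ h : ℝ) (Φ : ℝ → ℝ → S) : Prop :=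
  0 < ℓ ∧ 0 < h ∧
  (∀ s, ∀ y ∈ Ioo 0 h, ∃ φ ∈ A, ∃ z : Plane, ∀ᶠ w : ℝ × ℝ in 𝓝 (s, y),
    z + w.1 • v + w.2 • (-v.2, v.1) ∈ φ.domain ∧
      Φ w.1 w.2 = φ.map (z + w.1 • v + w.2 • (-v.2, v.1))) ∧
  ∀ s s', ∀ y ∈ Ioo 0 h, ∀ y' ∈ Ioo 0 h,
    Φ s y = Φ s' y' ↔ y = y' ∧ ∃ n : ℤ, s' = s + n * ℓ

/-- The space consists of this single cylinder and its boundary. -/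
def IsSingleCylinder {S : Type} [TopologicalSpace S] (A : Set (FlatChart S)) (v : Plane)
    (ℓ h : ℝ) (Φ : ℝ → ℝ → S) : Prop :=
  IsCylinder A v ℓ h Φ ∧ Dense {x | ∃ s, ∃ y ∈ Ioo 0 h, Φ s y = x}

/-- The path `c` in `Y` crosses the horizontal core curve upwards (`σ = 1`) or downwards (`σ = -1`)
at time `t`. The horizontal core curve of `Y` is the image of the set of those points of the Mucube
that have a coordinate equal to an odd integer. These points form the core curves of the
horizontal cylinders of the Mucube, and upwards is the direction in which that coordinate
increases, a convention that is invariant under the deck transformations. -/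
def CrossesAt (σ : ℝ) (c : ℝ → Y) (t : ℝ) : Prop :=
  ∃ p : ℝ → M, (∀ᶠ s in 𝓝 t, ContinuousAt p s ∧ toY (p s) = c s) ∧
    ∃ (i : Fin 3) (k : ℤ), (p t).1 i = 2 * k + 1 ∧
      (∀ᶠ s in 𝓝[<] t, σ * (p s).1 i < σ * (2 * k + 1)) ∧
      (∀ᶠ s in 𝓝[>] t, σ * (2 * k + 1) < σ * (p s).1 i)

/-- Algebraic intersection number of the closed path `c : [0, ℓ] → Y` with the horizontal core
curve: the number of upward crossings minus the number of downward crossings. -/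
def intersectionNumber (ℓ : ℝ) (c : ℝ → Y) : ℤ :=
  ({t ∈ Ico 0 ℓ | CrossesAt 1 c t}.ncard : ℤ) - ({t ∈ Ico 0 ℓ | CrossesAt (-1) c t}.ncard : ℤ)

end Mucube

end

/-! Let the motions be the signed coordinate permutations composed with even translations
(`CubeIsom`). Those of determinant one act simply transitively on the frames of the faces. Passing
to the right or upper neighbour of a face is multiplication on the right by `r` or `u`, and turning
a frame by π is multiplication by `j`. Straight lines on the Mucube are therefore lines in the plane
whose unit squares are labelled by motions. In a coprime direction `(p, q)`, every line avoiding the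
vertices lies, up to an integral translation, in one strip between consecutive lines through
vertices. The direction thus has a single holonomy `w`, up to conjugation: the word in `r` and `u`
spelled by the cutting sequence. A periodic direction is rational, and a rational direction is
periodic exactly when `w` has finite order.

The algebraic core is that a `w` of finite order has a quarter-turn as linear part, so that `w ^ 4 =
1`. The Euclidean algorithm writes `w`, up to conjugation, as `b` or `a * b`, where `(a, b)` arises
from `(r, u)` by swaps, inversions and `b ↦ a ^ 2 * b` (`holonomy_nielsen`). These moves preserve
`OddPair`. In an odd pair, `b` is either of infinite order or a quarter-turn up to translation
(`OddPair.quarter_turn`). The product `a * b` always has infinite order: its linear part has order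
three, while the parity character `chi` takes the value `-1` on it (`OddPair.mul_pow_ne_one`).

The covering of `Y` by `M` has the deck group of even translations and cyclic coordinate
permutations, whose linear parts form a group of order 3 in the rotation group of order 24. If `w`
is a quarter-turn up to translation, then its powers and the half-turns of the strip give a dihedral
group of order 8, a complement of that group. So the strip is embedded in `Y` up to powers of `w ^
4` (`StripLabelling.eq_of_toY_eq`) and is dense (`StripLabelling.dense`). If moreover `w ^ 4 = 1`,
it closes up to a cylinder with intersection number zero.

Conversely, if a strip is dense in `Y`, then 24 is at most 3 · 2 times the order of the linear part
of `w`, which leaves only order four (`StripLabelling.quarter_turn_of_dense`). Then `w ^ 4` is a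
translation along one axis. The intersection number is, up to sign, the coordinate sum of the deck
motion that closes the core curve (`IsRationalDirection.intersectionNumber_eq`), so its vanishing
gives `w ^ 4 = 1`, and every trajectory closes. -/

noncomputable section

namespace Mucube

/-! ### The group of rigid motions -/

/-- The affine map `p ↦ (ε i * p (σ i) + 2 * t i)_i`. -/
@[ext] structure CubeIsom where
  perm : Equiv.Perm (Fin 3)
  sgn : Fin 3 → ℤˣ
  trans : Fin 3 → ℤ

namespace CubeIsom

instance : DecidableEq CubeIsom := fun a b =>
  decidable_of_iff (a.perm = b.perm ∧ a.sgn = b.sgn ∧ a.trans = b.trans) CubeIsom.ext_iff.symm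

/-- The permutations multiply in reverse because `perm` acts on indices; with this convention `act`
is a left action. -/
instance : Mul CubeIsom :=
  ⟨fun a b => ⟨b.perm * a.perm, fun i => a.sgn i * b.sgn (a.perm i),
    fun i => a.sgn i * b.trans (a.perm i) + a.trans i⟩⟩

instance : One CubeIsom := ⟨⟨1, 1, 0⟩⟩

instance : Inv CubeIsom :=
  ⟨fun a => ⟨a.perm⁻¹, fun i => a.sgn (a.perm⁻¹ i),
    fun i => -(a.sgn (a.perm⁻¹ i) * a.trans (a.perm⁻¹ i))⟩⟩

@[simp] lemma mul_perm (a b : CubeIsom) : (a * b).perm = b.perm * a.perm := rfl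
@[simp] lemma mul_sgn (a b : CubeIsom) (i : Fin 3) :
    (a * b).sgn i = a.sgn i * b.sgn (a.perm i) := rfl
@[simp] lemma mul_trans (a b : CubeIsom) (i : Fin 3) :
    (a * b).trans i = a.sgn i * b.trans (a.perm i) + a.trans i := rfl
@[simp] lemma one_perm : (1 : CubeIsom).perm = 1 := rfl
@[simp] lemma one_sgn (i : Fin 3) : (1 : CubeIsom).sgn i = 1 := rfl
@[simp] lemma one_trans (i : Fin 3) : (1 : CubeIsom).trans i = 0 := rfl
@[simp] lemma inv_perm (a : CubeIsom) : a⁻¹.perm = a.perm⁻¹ := rfl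
@[simp] lemma inv_sgn (a : CubeIsom) (i : Fin 3) : a⁻¹.sgn i = a.sgn (a.perm⁻¹ i) := rfl
@[simp] lemma inv_trans (a : CubeIsom) (i : Fin 3) :
    a⁻¹.trans i = -(a.sgn (a.perm⁻¹ i) * a.trans (a.perm⁻¹ i)) := rfl

instance : Group CubeIsom :=
  Group.ofLeftAxioms
    (fun a b c => by
      ext i <;> simp [mul_assoc] ; ring)
    (fun a => by ext i <;> simp)
    (fun a => by
      ext i
      · simp
      · simp
      · simp only [mul_trans, inv_sgn, inv_trans, inv_perm, one_trans]
        ring)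

/-- The determinant of the linear part. -/
def det : CubeIsom →* ℤˣ where
  toFun a := Equiv.Perm.sign a.perm * ∏ i, a.sgn i
  map_one' := by simp
  map_mul' a b := by
    have : ∏ i, b.sgn (a.perm i) = ∏ i, b.sgn i := Equiv.prod_comp a.perm b.sgn
    simp only [mul_perm, mul_sgn, Finset.prod_mul_distrib, this, Equiv.Perm.sign_mul]
    exact mul_mul_mul_comm' _ _ _ _
where
  mul_mul_mul_comm' (a b c d : ℤˣ) : a * b * (c * d) = b * c * (a * d) := by
    rw [mul_comm a b]; exact mul_mul_mul_comm b a c d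

lemma det_apply (a : CubeIsom) : det a = Equiv.Perm.sign a.perm * ∏ i, a.sgn i := rfl

/-- The linear part. -/
def lin : CubeIsom →* CubeIsom where
  toFun a := ⟨a.perm, a.sgn, 0⟩
  map_one' := rfl
  map_mul' a b := by ext i <;> simp

/-- The parity of the translation part. -/
def chi : CubeIsom →* ℤˣ where
  toFun a := ∏ i, (a.trans i).negOnePow
  map_one' := by simp
  map_mul' a b := by
    have h : ∀ (e : ℤˣ) (n : ℤ), ((e : ℤ) * n).negOnePow = n.negOnePow := by
      intro e n
      rcases Int.units_eq_one_or e with h | h <;> simp [h]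
    have : ∏ i, (b.trans (a.perm i)).negOnePow = ∏ i, (b.trans i).negOnePow :=
      Equiv.prod_comp a.perm (fun i => (b.trans i).negOnePow)
    simp only [mul_trans, Int.negOnePow_add, h, Finset.prod_mul_distrib, this]
    exact mul_comm _ _

/-- The rotation taking a face to its right neighbour. -/
def r : CubeIsom := ⟨Equiv.swap 1 2, ![1, -1, 1], 0⟩

/-- The motion taking a face to its upper neighbour. -/
def u : CubeIsom := ⟨Equiv.swap 0 1, ![-1, 1, 1], ![1, 0, 0]⟩

/-- The half-turn about the centre of a face. -/
def j : CubeIsom := ⟨1, ![-1, 1, -1], ![1, 0, 0]⟩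

/-- Turning a square by π exchanges right with left and up with down. This is what makes a rotated
labelling compatible again. -/
lemma j_mul_r : j * r = r⁻¹ * j := by decide
lemma j_mul_u : j * u = u⁻¹ * j := by decide
lemma det_r : det r = 1 := by decide
lemma det_u : det u = 1 := by decide
lemma det_j : det j = 1 := by decide
lemma r_pow_four : r ^ 4 = 1 := by decide

/-- The motions that induce deck transformations over `Y`. -/
def deck : Subgroup CubeIsom where
  carrier := {a | a.sgn = 1 ∧ Equiv.Perm.sign a.perm = 1}
  one_mem' := ⟨rfl, by simp⟩
  mul_mem' := by
    rintro a b ⟨h1, h2⟩ ⟨h3, h4⟩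
    exact ⟨by ext i; simp [h1, h3], by simp [h2, h4]⟩
  inv_mem' := by
    rintro a ⟨h1, h2⟩
    exact ⟨by ext i; simp [h1], by simp [h2]⟩

lemma det_of_mem_deck {a : CubeIsom} (h : a ∈ deck) : det a = 1 := by
  rw [det_apply, h.1, h.2]; simp

lemma mem_deck_iff_lin {a : CubeIsom} : a ∈ deck ↔ lin a ∈ deck := Iff.rfl

/-- Motions with trivial linear part are translations. -/
lemma trans_pow {a : CubeIsom} (h : lin a = 1) (n : ℕ) (i : Fin 3) :
    (a ^ n).trans i = n * a.trans i := by
  have hp : a.perm = 1 := congrArg perm h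
  have hs : a.sgn = 1 := congrArg sgn h
  induction n with
  | zero => simp
  | succ n ih =>
    rw [pow_succ', mul_trans, hs, hp, Pi.one_apply, Equiv.Perm.one_apply, ih]
    push_cast
    ring

lemma eq_one_of_pow_eq_one {a : CubeIsom} (h : lin a = 1) {n : ℕ} (hn : 0 < n) (ha : a ^ n = 1) :
    a = 1 := by
  have hp : a.perm = 1 := congrArg perm h
  have hs : a.sgn = 1 := congrArg sgn h
  ext i
  · rw [hp]; rfl
  · rw [hs]; rfl
  · have := trans_pow h n i
    rw [ha, one_trans] at this
    have : a.trans i = 0 := by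
      rcases mul_eq_zero.1 this.symm with h | h
      · exact absurd (by exact_mod_cast h) hn.ne'
      · exact h
    simp [this]

/-! ### Finite checks in the point group -/

/-- The rotation group of the cube is the symmetric group on four letters, with elements of order 1,
2, 3 and 4 only. -/
lemma lin_pow_cases (a : CubeIsom) (h : det a = 1) :
    lin a ^ 2 = 1 ∨ lin a ^ 3 = 1 ∨ (lin a ^ 4 = 1 ∧ lin a ^ 2 ≠ 1) := by
  have key : ∀ (σ : Equiv.Perm (Fin 3)) (ε : Fin 3 → ℤˣ), det ⟨σ, ε, 0⟩ = 1 →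
      ((⟨σ, ε, 0⟩ : CubeIsom) ^ 2 = 1 ∨ (⟨σ, ε, 0⟩ : CubeIsom) ^ 3 = 1 ∨
        ((⟨σ, ε, 0⟩ : CubeIsom) ^ 4 = 1 ∧ (⟨σ, ε, 0⟩ : CubeIsom) ^ 2 ≠ 1)) := by
    decide +kernel
  exact key a.perm a.sgn h

/-- The square of a quarter-turn is a half-turn about a coordinate axis. -/
lemma exists_axis {a : CubeIsom} (h4 : lin a ^ 4 = 1) (h2 : lin a ^ 2 ≠ 1) :
    ∃ i, (a ^ 2).perm = 1 ∧ ∀ k, k ≠ i → (a ^ 2).sgn k = -1 := by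
  have key : ∀ (σ : Equiv.Perm (Fin 3)) (ε : Fin 3 → ℤˣ),
      (⟨σ, ε, 0⟩ : CubeIsom) ^ 4 = 1 → (⟨σ, ε, 0⟩ : CubeIsom) ^ 2 ≠ 1 →
      ∃ i, ((⟨σ, ε, 0⟩ : CubeIsom) ^ 2).perm = 1 ∧
        ∀ k, k ≠ i → ((⟨σ, ε, 0⟩ : CubeIsom) ^ 2).sgn k = -1 := by
    decide +kernel
  have := key a.perm a.sgn h4 h2
  have e : lin (a ^ 2) = (⟨a.perm, a.sgn, 0⟩ : CubeIsom) ^ 2 := map_pow lin a 2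
  rw [← e] at this
  exact this

/-- Linear parts of deck motions have order 1 or 3, whereas those of `a`, `a ^ 2`, `a ^ 3` have
order 4, 2, 4. -/
lemma not_mem_deck_of_quarter_turn {a : CubeIsom} (h4 : lin a ^ 4 = 1) (h2 : lin a ^ 2 ≠ 1) :
    a ∉ deck ∧ a ^ 2 ∉ deck ∧ a ^ 3 ∉ deck := by
  have key : ∀ (σ : Equiv.Perm (Fin 3)) (ε : Fin 3 → ℤˣ),
      (⟨σ, ε, 0⟩ : CubeIsom) ^ 4 = 1 → (⟨σ, ε, 0⟩ : CubeIsom) ^ 2 ≠ 1 →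
      (∀ k ∈ ({1, 2, 3} : Finset ℕ), ¬ (((⟨σ, ε, 0⟩ : CubeIsom) ^ k).sgn = 1 ∧
        Equiv.Perm.sign ((⟨σ, ε, 0⟩ : CubeIsom) ^ k).perm = 1)) := by
    decide +kernel
  have key := key a.perm a.sgn h4 h2
  have e : ∀ k, k ∈ ({1, 2, 3} : Finset ℕ) → a ^ k ∉ deck := by
    intro k hk h
    rw [mem_deck_iff_lin, map_pow] at h
    exact key k hk h
  refine ⟨?_, e 2 (by decide), e 3 (by decide)⟩
  simpa using e 1 (by decide)

lemma zpow_mem_deck {a : CubeIsom} (h4 : lin a ^ 4 = 1) (h2 : lin a ^ 2 ≠ 1) {k : ℤ}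
    (hk : a ^ k ∈ deck) : 4 ∣ k := by
  obtain ⟨m1, m2, m3⟩ := not_mem_deck_of_quarter_turn h4 h2
  have h4' : a ^ (4 : ℤ) ∈ deck := by
    rw [mem_deck_iff_lin, map_zpow]
    have : lin a ^ (4 : ℤ) = 1 := by exact_mod_cast h4
    rw [this]; exact deck.one_mem
  have hm : a ^ (k % 4) ∈ deck := by
    have : a ^ (k % 4) = a ^ k * ((a ^ (4 : ℤ)) ^ (k / 4))⁻¹ := by
      rw [← zpow_mul, ← zpow_neg, ← zpow_add]
      congr 1
      omega
    rw [this]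
    exact deck.mul_mem hk (deck.inv_mem (deck.zpow_mem h4' _))
  have : k % 4 = 0 ∨ k % 4 = 1 ∨ k % 4 = 2 ∨ k % 4 = 3 := by omega
  rcases this with h | h | h | h
  · exact Int.dvd_of_emod_eq_zero h
  · rw [h, zpow_one] at hm; exact absurd hm m1
  · rw [h] at hm; exact absurd (by exact_mod_cast hm) m2
  · rw [h] at hm; exact absurd (by exact_mod_cast hm) m3

/-- A quarter-turn and the half-turns that invert it meet every coset of the deck group. -/
lemma mem_deck_mul {a b c : CubeIsom} (h4 : lin a ^ 4 = 1) (h2 : lin a ^ 2 ≠ 1)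
    (ha : det a = 1) (hb : b * a = a⁻¹ * b) (hbd : det b = 1) (hc : det c = 1) :
    ∃ k : ℕ, c * a ^ k ∈ deck ∨ c * b⁻¹ * a ^ k ∈ deck := by
  -- The linear parts of `a` and `b` generate a dihedral group of order 8. It meets the order-three
  -- group of linear deck motions trivially, so the products of the two exhaust all 24 rotations.
  have key : ∀ (σ : Equiv.Perm (Fin 3)) (ε : Fin 3 → ℤˣ), det ⟨σ, ε, 0⟩ = 1 →
      (⟨σ, ε, 0⟩ : CubeIsom) ^ 2 ≠ 1 → (⟨σ, ε, 0⟩ : CubeIsom) ^ 4 = 1 →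
      ∀ (σ' : Equiv.Perm (Fin 3)) (ε' : Fin 3 → ℤˣ),
      (⟨σ', ε', 0⟩ : CubeIsom) * ⟨σ, ε, 0⟩ = ⟨σ, ε, 0⟩⁻¹ * ⟨σ', ε', 0⟩ →
      det ⟨σ', ε', 0⟩ = 1 →
      ∀ (σ'' : Equiv.Perm (Fin 3)) (ε'' : Fin 3 → ℤˣ),
      det ⟨σ'', ε'', 0⟩ = 1 →
      ∃ k ∈ Finset.range 4,
        ((((⟨σ'', ε'', 0⟩ : CubeIsom) * ⟨σ, ε, 0⟩ ^ k).sgn = 1 ∧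
        Equiv.Perm.sign ((⟨σ'', ε'', 0⟩ : CubeIsom) * ⟨σ, ε, 0⟩ ^ k).perm = 1) ∨
        (((⟨σ'', ε'', 0⟩ : CubeIsom) * (⟨σ', ε', 0⟩ : CubeIsom)⁻¹ * ⟨σ, ε, 0⟩ ^ k).sgn = 1 ∧
        Equiv.Perm.sign ((⟨σ'', ε'', 0⟩ : CubeIsom) * (⟨σ', ε', 0⟩ : CubeIsom)⁻¹ *
          ⟨σ, ε, 0⟩ ^ k).perm = 1)) := by
    decide +kernel
  have hb' : lin b * lin a = (lin a)⁻¹ * lin b := by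
    rw [← map_inv, ← map_mul, ← map_mul, hb]
  obtain ⟨k, -, hk⟩ := key a.perm a.sgn ha h2 h4 b.perm b.sgn
    hb' hbd c.perm c.sgn hc
  refine ⟨k, ?_⟩
  rw [mem_deck_iff_lin, mem_deck_iff_lin (a := c * b⁻¹ * a ^ k)]
  simp only [map_mul, map_pow, map_inv]
  exact hk

end CubeIsom

end Mucube

namespace Mucube

/-! ### Cutting sequences of lines of rational slope -/

section Nielsen

variable {H : Type*} [Group H]

/-- Cutting sequences may be read off by columns instead of rows. -/
lemma cutting_swap {A B : ℤ → ℤ} (hAB : ∀ i x, A i ≤ x ↔ i ≤ B x) {a b : H} {h : ℤ → H}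
    (hh : ∀ i, h (i + 1) = h i * a ^ (A (i + 1) - A i) * b) (x : ℤ) :
    h (B (x + 1)) * a ^ (x + 1 - A (B (x + 1))) =
      h (B x) * a ^ (x - A (B x)) * a * b ^ (B (x + 1) - B x) := by
  have hB : B x ≤ B (x + 1) := (hAB _ _).1 (((hAB (B x) x).2 le_rfl).trans (by omega))
  -- For `B x < i ≤ B (x + 1)` the Galois connection forces `A i = x + 1`, so the rows in this range
  -- contribute a pure power of `b`.
  have key : ∀ n : ℕ, B x + n ≤ B (x + 1) →
      h (B x + n) * a ^ (x + 1 - A (B x + n)) = h (B x) * a ^ (x + 1 - A (B x)) * b ^ n := by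
    intro n
    induction n with
    | zero => intro _; simp
    | succ n ih =>
      intro hn
      have ih := ih (by push_cast at hn; omega)
      have h1 : A (B x + n + 1) ≤ x + 1 := (hAB _ _).2 (by push_cast at hn; omega)
      have h2 : ¬ A (B x + n + 1) ≤ x := fun hc => by have := (hAB _ _).1 hc; omega
      have h3 : A (B x + n + 1) = x + 1 := by omega
      have e : B x + ((n + 1 : ℕ) : ℤ) = B x + n + 1 := by push_cast; ring
      rw [e, hh, h3, sub_self, zpow_zero, mul_one, ih, pow_succ, mul_assoc]
  obtain ⟨n, hn⟩ := Int.eq_ofNat_of_zero_le (sub_nonneg.2 hB)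
  have e : B (x + 1) = B x + n := by omega
  have := key n (by omega)
  rw [hn, e, this, zpow_natCast]
  congr 1
  rw [mul_assoc, ← zpow_add_one]
  congr 2
  ring

/-- The holonomy along a line of slope `q / p` is conjugate to a member of a pair that is
obtained from the generating pair by Nielsen moves of even type, or to the product of such a
pair. -/
theorem holonomy_nielsen {P : H → H → Prop} (hswap : ∀ a b, P a b → P b a)
    (hinv : ∀ a b, P a b → P a⁻¹ b) (hsq : ∀ a b, P a b → P a (a ^ 2 * b)) (w : H) :
    ∀ (q : ℕ), 0 < q → ∀ (p c : ℤ), IsCoprime p (q : ℤ) → ∀ (a b : H), P a b → ∀ h : ℤ → H,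
      (∀ i, h (i + 1) = h i * a ^ ((p * (i + 1) + c) / q - (p * i + c) / q) * b) →
      (∀ i, h (i + q) = w * h i) →
      ∃ a' b' g, P a' b' ∧ (w = g * b' * g⁻¹ ∨ w = g * (a' * b') * g⁻¹) := by
  -- Negative powers are reached by inverting `a` before and after.
  have hpow : ∀ (n : ℤ) (a b : H), P a b → P a (a ^ (2 * n) * b) := by
    have hnat : ∀ (n : ℕ) (a b : H), P a b → P a (a ^ (2 * (n : ℤ)) * b) := by
      intro n a b hab
      induction n with
      | zero => simpa using hab
      | succ n ih =>
        have := hsq _ _ ih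
        rw [← mul_assoc] at this
        convert this using 2
        rw [← zpow_natCast, ← zpow_add]
        congr 1
        push_cast
        ring
    intro n a b hab
    obtain ⟨m, rfl | rfl⟩ := Int.eq_nat_or_neg n
    · exact hnat m a b hab
    · have := hinv _ _ (hnat m a⁻¹ b (hinv _ _ hab))
      rw [inv_inv, inv_zpow', ← mul_neg] at this
      exact this
  intro q
  induction q using Nat.strong_induction_on with
  | _ q ih =>
  intro hq
  -- the reduced case
  have main : ∀ (p c : ℤ), 0 < p → p < q → IsCoprime p (q : ℤ) → ∀ (a b : H), P a b →
      ∀ h : ℤ → H,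
      (∀ i, h (i + 1) = h i * a ^ ((p * (i + 1) + c) / q - (p * i + c) / q) * b) →
      (∀ i, h (i + q) = w * h i) →
      ∃ a' b' g, P a' b' ∧ (w = g * b' * g⁻¹ ∨ w = g * (a' * b') * g⁻¹) := by
    intro p c hp hpq hcop a b hab h hh hw
    obtain ⟨p, rfl⟩ := Int.eq_ofNat_of_zero_le hp.le
    have hp' : (0 : ℤ) < p := hp
    have hq' : (0 : ℤ) < q := by exact_mod_cast hq
    set A : ℤ → ℤ := fun i => (p * i + c) / q with hA
    -- The upper adjoint of `A`: the condition `A i ≤ x` reads `p * i ≤ q * x + (q - c - 1)`. It is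
    -- the staircase of the same line with the axes exchanged.
    set B : ℤ → ℤ := fun x => (q * x + (q - c - 1)) / p with hB
    have hAB : ∀ i x, A i ≤ x ↔ i ≤ B x := by
      intro i x
      have e1 : A i ≤ x ↔ p * i + c < (x + 1) * q := by
        rw [← Int.lt_add_one_iff]; exact Int.ediv_lt_iff_lt_mul hq'
      have e2 : i ≤ B x ↔ i * p ≤ q * x + (q - c - 1) := Int.le_ediv_iff_mul_le hp'
      rw [e1, e2, ← Int.lt_add_one_iff]
      constructor <;> intro h <;> linarith
    have hsw := cutting_swap hAB hh
    have hper : ∀ x, B (x + p) = B x + q := by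
      intro x
      have : (q * (x + p) + (q - c - 1) : ℤ) = (q * x + (q - c - 1)) + q * p := by ring
      simp only [hB, this]
      exact Int.add_mul_ediv_right _ _ hp'.ne'
    have hperA : ∀ i, A (i + q) = A i + p := by
      intro i
      have : (p * (i + q) + c : ℤ) = (p * i + c) + p * q := by ring
      simp only [hA, this]
      exact Int.add_mul_ediv_right _ _ hq'.ne'
    -- The Euclidean step: reading the line by columns exchanges `a` with `b` and `p` with `q`, and
    -- lowers the denominator from `q` to `p`.
    refine ih p (by omega) (by omega) q (q - c - 1) hcop.symm b a (hswap _ _ hab)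
      (fun x => h (B x) * a ^ (x - A (B x)) * a) ?_ ?_
    · intro x
      have := hsw x
      simp only [hB] at this ⊢
      rw [this]
    · intro x
      simp only [hper, hperA, hw]
      rw [add_sub_add_right_eq_sub]
      simp only [mul_assoc]
  intro p c hcop a b hab h hh hw
  have hq' : (0 : ℤ) < q := by exact_mod_cast hq
  -- reduction modulo `2 q`
  obtain ⟨n, p', hp', hlo, hhi⟩ : ∃ n p' : ℤ, p = p' + 2 * n * q ∧ -q < p' ∧ p' ≤ q := by
    refine ⟨(p + q - 1) / (2 * q), (p + q - 1) % (2 * q) - q + 1, ?_, ?_, ?_⟩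
    · have := Int.emod_add_mul_ediv (p + q - 1) (2 * q)
      linarith
    · have := Int.emod_nonneg (p + q - 1) (show (2 * q : ℤ) ≠ 0 by omega)
      omega
    · have := Int.emod_lt_of_pos (p + q - 1) (show (0 : ℤ) < 2 * q by omega)
      omega
  have hcop' : IsCoprime p' (q : ℤ) := by
    rw [hp'] at hcop
    exact IsCoprime.add_mul_right_left_iff.1 hcop
  -- The even integral part `2 * n` of the slope is absorbed by replacing `b` with `a ^ (2 * n) *
  -- b`.
  have hab' := hpow n a b hab
  have hdiv : ∀ i, (p * i + c) / (q : ℤ) = (p' * i + c) / q + 2 * n * i := by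
    intro i
    have : p * i + c = (p' * i + c) + (2 * n * i) * q := by rw [hp']; ring
    rw [this, Int.add_mul_ediv_right _ _ hq'.ne']
  have hh' : ∀ i, h (i + 1) =
      h i * a ^ ((p' * (i + 1) + c) / q - (p' * i + c) / q) * (a ^ (2 * n) * b) := by
    intro i
    rw [hh, hdiv, hdiv, ← mul_assoc, mul_assoc (h i) _ (a ^ (2 * n)), ← zpow_add]
    congr 3
    ring
  rcases lt_trichotomy p' 0 with hneg | h0 | hpos
  -- A floor is a negated ceiling, so a negative slope in `a` is a positive slope in `a⁻¹`, with a
  -- new offset.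
  · have hd : ∀ i, (p' * i + c) / (q : ℤ) = -((-p' * i + (q - 1 - c)) / q) := by
      intro i
      apply le_antisymm
      · rw [← Int.lt_add_one_iff, Int.ediv_lt_iff_lt_mul hq']
        have := Int.emod_add_mul_ediv (-p' * i + (q - 1 - c)) q
        have := Int.emod_nonneg (-p' * i + (q - 1 - c)) hq'.ne'
        have := Int.emod_lt_of_pos (-p' * i + (q - 1 - c)) hq'
        nlinarith
      · rw [Int.le_ediv_iff_mul_le hq']
        have := Int.emod_add_mul_ediv (-p' * i + (q - 1 - c)) q
        have := Int.emod_nonneg (-p' * i + (q - 1 - c)) hq'.ne'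
        have := Int.emod_lt_of_pos (-p' * i + (q - 1 - c)) hq'
        nlinarith
    refine main (-p') (q - 1 - c) (by omega) (by omega) hcop'.neg_left a⁻¹ _ (hinv _ _ hab') h
      ?_ hw
    intro i
    rw [hh', hd, hd, inv_zpow']
    congr 3
    ring
  · have hq1 : q = 1 := by
      rw [h0, isCoprime_zero_left] at hcop'
      have := Int.isUnit_iff.1 hcop'
      omega
    subst hq1
    refine ⟨a, _, h 0, hab', Or.inl ?_⟩
    have h1 := hh' 0
    have h2 := hw 0
    simp [h0] at h1 h2
    rw [eq_mul_inv_iff_mul_eq, ← h2, h1]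
  · rcases hhi.lt_or_eq with hlt | heq
    · exact main p' c hpos hlt hcop' a _ hab' h hh' hw
    -- Slopes are reduced only modulo 2, so slope 1 survives as a terminal case. This is where the
    -- product of the pair occurs.
    · have hq1 : q = 1 := by
        rw [heq, isCoprime_self] at hcop'
        have := Int.isUnit_iff.1 hcop'
        omega
      subst hq1
      refine ⟨a, _, h 0, hab', Or.inr ?_⟩
      have h1 := hh' 0
      have h2 := hw 0
      simp [heq] at h1 h2
      rw [eq_mul_inv_iff_mul_eq, ← h2, h1]
      simp [mul_assoc]

end Nielsen

/-! ### Invariants of pairs of motions under even Nielsen moves -/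

namespace CubeIsom

/-- The product of the signs, and the parity of the translation, over the coordinates that the
motion moves. -/
def inv2 (a : CubeIsom) : ℤˣ × ℤˣ :=
  (∏ i, if a.perm i = i then 1 else a.sgn i,
    ∏ i, if a.perm i = i then 1 else (a.trans i).negOnePow)

/-- A property of pairs of motions that is stable under Nielsen moves of even type. -/
structure OddPair (a b : CubeIsom) : Prop where
  sa : Equiv.Perm.sign a.perm = -1
  sb : Equiv.Perm.sign b.perm = -1
  ne : a.perm ≠ b.perm
  da : det a = 1
  db : det b = 1
  ia : inv2 a ≠ 1
  ib : inv2 b ≠ 1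
  iab : inv2 a ≠ inv2 b
  chi : chi a * chi b = -1

lemma OddPair.swap {a b : CubeIsom} (h : OddPair a b) : OddPair b a :=
  ⟨h.sb, h.sa, h.ne.symm, h.db, h.da, h.ib, h.ia, h.iab.symm, by rw [mul_comm]; exact h.chi⟩

lemma units_mul_negOnePow (e : ℤˣ) (n : ℤ) : ((e : ℤ) * n).negOnePow = n.negOnePow := by
  rcases Int.units_eq_one_or e with h | h <;> simp [h]

lemma odd_perm (σ : Equiv.Perm (Fin 3)) (h : Equiv.Perm.sign σ = -1) :
    σ = Equiv.swap 0 1 ∨ σ = Equiv.swap 0 2 ∨ σ = Equiv.swap 1 2 := by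
  revert h; revert σ; decide

lemma odd_perm_inv {σ : Equiv.Perm (Fin 3)} (h : Equiv.Perm.sign σ = -1) :
    σ⁻¹ = σ ∧ σ ^ 2 = 1 := by
  revert h; revert σ; decide

lemma inv2_inv {a : CubeIsom} (h : Equiv.Perm.sign a.perm = -1) : inv2 a⁻¹ = inv2 a := by
  have e : ∀ i, (a.perm⁻¹ i = i) ↔ a.perm i = i := by
    intro i; rw [(odd_perm_inv h).1]
  unfold inv2
  simp only [inv_perm, inv_sgn, inv_trans, e, Int.negOnePow_neg, units_mul_negOnePow]
  rw [(odd_perm_inv h).1]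
  have hi : ∀ i, a.perm (a.perm i) = a.perm i ↔ a.perm i = i := fun i =>
    ⟨fun h => a.perm.injective h, fun h => congrArg a.perm h⟩
  ext1
  · rw [← Equiv.prod_comp a.perm (fun i => if a.perm i = i then 1 else a.sgn i)]
    simp only [hi]
  · rw [← Equiv.prod_comp a.perm (fun i => if a.perm i = i then 1 else (a.trans i).negOnePow)]
    simp only [hi]

/-- The motion `a ^ 2` permutes nothing. On each of the two coordinates moved by `a`, its sign and
translation parity are the components of `inv2 a`; on the third they are trivial. Two distinct
transpositions move exactly one common coordinate, so `inv2 a` enters the product for `b` exactly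
once. -/
lemma inv2_sq_mul {a b : CubeIsom} (ha : Equiv.Perm.sign a.perm = -1)
    (hb : Equiv.Perm.sign b.perm = -1) (hab : a.perm ≠ b.perm) :
    inv2 (a ^ 2 * b) = inv2 a * inv2 b := by
  obtain ⟨σ, ε, t⟩ := a
  obtain ⟨σ', ε', t'⟩ := b
  simp only at ha hb hab
  have sq : ∀ x y : ℤˣ, x * (x * y) = y := by decide
  rcases odd_perm σ ha with rfl | rfl | rfl <;> rcases odd_perm σ' hb with rfl | rfl | rfl <;>
    first
    | exact absurd rfl hab
    | (ext1 <;>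
        simp [inv2, pow_two, Fin.prod_univ_three, Equiv.swap_apply_def, Int.negOnePow_add,
          units_mul_negOnePow, mul_assoc, sq] <;>
        ac_rfl)

lemma OddPair.inv {a b : CubeIsom} (h : OddPair a b) : OddPair a⁻¹ b := by
  have e : a⁻¹.perm = a.perm := (odd_perm_inv h.sa).1
  refine ⟨by rw [e]; exact h.sa, h.sb, by rw [e]; exact h.ne, by rw [map_inv, h.da, inv_one], h.db,
    by rw [inv2_inv h.sa]; exact h.ia, h.ib, by rw [inv2_inv h.sa]; exact h.iab, ?_⟩
  rw [map_inv, Int.units_inv_eq_self]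
  exact h.chi

/-- In the Klein four-group `ℤˣ × ℤˣ` the product of two distinct nontrivial elements is the third
one, so the conditions on `inv2` survive. The characters `det` and `chi` do not see squares. -/
lemma OddPair.sq {a b : CubeIsom} (h : OddPair a b) : OddPair a (a ^ 2 * b) := by
  have e : (a ^ 2 * b).perm = b.perm := by
    rw [mul_perm, pow_two, mul_perm, ← pow_two, (odd_perm_inv h.sa).2, mul_one]
  have hi := inv2_sq_mul h.sa h.sb h.ne
  have hs : ∀ x y : ℤˣ × ℤˣ, x ≠ 1 → y ≠ 1 → x ≠ y → x * y ≠ 1 ∧ x ≠ x * y := by decide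
  obtain ⟨h1, h2⟩ := hs _ _ h.ia h.ib h.iab
  refine ⟨h.sa, by rw [e]; exact h.sb, by rw [e]; exact h.ne, h.da, ?_, h.ia, by rw [hi]; exact h1,
    by rw [hi]; exact h2, ?_⟩
  · rw [map_mul, map_pow, h.da, h.db]; rfl
  · rw [map_mul, map_pow, Int.units_sq, one_mul]
    exact h.chi

/-- Here `inv2 r = (-1, 1)` and `inv2 u = (-1, -1)`. -/
lemma oddPair_r_u : OddPair r u :=
  ⟨by decide, by decide, by decide, by decide, by decide, by decide, by decide, by decide,
    by decide⟩

/-- In an odd pair, a motion of finite order is a quarter-turn. -/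
lemma OddPair.quarter_turn {a b : CubeIsom} (h : OddPair a b) {n : ℕ} (hn : 0 < n)
    (hb : b ^ n = 1) : lin b ^ 4 = 1 ∧ lin b ^ 2 ≠ 1 := by
  have key : ∀ (σ : Equiv.Perm (Fin 3)) (ε : Fin 3 → ℤˣ), Equiv.Perm.sign σ = -1 →
      ((∏ i, if σ i = i then 1 else ε i) ≠ 1 →
        (⟨σ, ε, 0⟩ : CubeIsom) ^ 4 = 1 ∧ (⟨σ, ε, 0⟩ : CubeIsom) ^ 2 ≠ 1) ∧
      ((∏ i, if σ i = i then 1 else ε i) = 1 → (⟨σ, ε, 0⟩ : CubeIsom) ^ 2 = 1) := by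
    decide +kernel
  obtain ⟨k1, k2⟩ := key b.perm b.sgn h.sb
  by_cases h1 : (∏ i, if b.perm i = i then 1 else b.sgn i) = 1
  -- If the moved signs multiply to 1, the linear part squares to 1, so `b ^ 2` is a translation of
  -- finite order, hence trivial. Comparing translation parities then makes the second component of
  -- `inv2 b` trivial as well.
  · exfalso
    have h2 : (∏ i, if b.perm i = i then 1 else (b.trans i).negOnePow) ≠ 1 := fun h2 =>
      h.ib (Prod.ext h1 h2)
    have hl : lin (b ^ 2) = 1 := by rw [map_pow]; exact k2 h1
    have h3 : b ^ 2 = 1 := by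
      apply eq_one_of_pow_eq_one hl hn
      rw [← pow_mul, mul_comm, pow_mul, hb, one_pow]
    apply h2
    have h4 : ∀ i, (b.trans (b.perm i)).negOnePow * (b.trans i).negOnePow = 1 := by
      intro i
      have := congrArg (fun x : CubeIsom => (x.trans i).negOnePow) h3
      simpa [pow_two, Int.negOnePow_add, units_mul_negOnePow] using this
    have h0 := h4 0
    have h1 := h4 1
    have h2 := h4 2
    rcases odd_perm _ h.sb with e | e | e <;> rw [e] at h0 h1 h2 ⊢ <;>
      simp [Fin.prod_univ_three, Equiv.swap_apply_def] at h0 h1 h2 ⊢ <;> assumption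
  · exact k1 h1

/-- In an odd pair, the product of the two motions has infinite order. -/
lemma OddPair.mul_pow_ne_one {a b : CubeIsom} (h : OddPair a b) {n : ℕ} (hn : 0 < n) :
    (a * b) ^ n ≠ 1 := by
  intro hab
  -- The product of two distinct transpositions is a 3-cycle. With determinant one its signs
  -- multiply to 1, so the cube of the linear part is trivial.
  have key : ∀ (σ : Equiv.Perm (Fin 3)) (ε : Fin 3 → ℤˣ), σ ≠ 1 → Equiv.Perm.sign σ = 1 →
      det ⟨σ, ε, 0⟩ = 1 → (⟨σ, ε, 0⟩ : CubeIsom) ^ 3 = 1 := by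
    decide +kernel
  have hl : lin ((a * b) ^ 3) = 1 := by
    rw [map_pow]
    refine key (a * b).perm (a * b).sgn ?_ ?_ ?_
    · intro he
      apply h.ne
      rw [mul_perm, mul_eq_one_iff_inv_eq] at he
      rw [← he, (odd_perm_inv h.sb).1]
    · rw [mul_perm, map_mul, h.sa, h.sb]; rfl
    · have : det (a * b) = 1 := by rw [map_mul, h.da, h.db]; rfl
      exact this
  have h3 : (a * b) ^ 3 = 1 := by
    apply eq_one_of_pow_eq_one hl hn
    rw [← pow_mul, mul_comm, pow_mul, hab, one_pow]
  -- An odd power of an element with `chi` equal to `-1` is not the identity.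
  have := congrArg CubeIsom.chi h3
  rw [map_pow, map_mul, h.chi, map_one] at this
  exact absurd this (by decide)

/-- If the holonomy along a line of rational slope has finite order, then it is a quarter-turn
up to a translation. -/
theorem quarter_turn_of_holonomy {p c : ℤ} {q : ℕ} (hq : 0 < q) (hpq : IsCoprime p (q : ℤ))
    {h : ℤ → CubeIsom} {w : CubeIsom}
    (hh : ∀ i, h (i + 1) = h i * r ^ ((p * (i + 1) + c) / q - (p * i + c) / q) * u)
    (hw : ∀ i, h (i + q) = w * h i) {n : ℕ} (hn : 0 < n) (hwn : w ^ n = 1) :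
    lin w ^ 4 = 1 ∧ lin w ^ 2 ≠ 1 := by
  obtain ⟨a, b, g, hab, rfl | rfl⟩ := holonomy_nielsen (P := OddPair) (fun _ _ => OddPair.swap)
    (fun _ _ => OddPair.inv) (fun _ _ => OddPair.sq) w q hq p c hpq r u oddPair_r_u h hh hw
  · have hb : b ^ n = 1 := by
      rw [conj_pow] at hwn
      simpa using hwn
    obtain ⟨h4, h2⟩ := hab.quarter_turn hn hb
    rw [map_mul, map_mul, map_inv, conj_pow, conj_pow]
    refine ⟨by rw [h4]; simp, fun h => h2 ?_⟩
    simpa using h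
  · exfalso
    refine hab.mul_pow_ne_one hn ?_
    rw [conj_pow] at hwn
    simpa using hwn

end CubeIsom

end Mucube

namespace Mucube

/-! ### The Mucube in terms of cosines -/

lemma cos_pi_mul_eq (x : ℝ) (n : ℤ) :
    Real.cos (Real.pi * x) = (-1) ^ n * Real.cos (Real.pi * (x - n)) := by
  have h := Real.cos_sub_int_mul_pi (Real.pi * x) n
  have e : Real.pi * x - n * Real.pi = Real.pi * (x - n) := by ring
  rw [e] at h
  rw [h, ← mul_assoc, ← zpow_add₀ (by norm_num), Even.neg_one_zpow ⟨n, rfl⟩, one_mul]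

lemma cos_pi_mul_nonneg {x : ℝ} (h : |x| ≤ 1 / 2) : 0 ≤ Real.cos (Real.pi * x) := by
  have := abs_le.1 h
  apply Real.cos_nonneg_of_neg_pi_div_two_le_of_le <;> nlinarith [Real.pi_pos]

lemma cos_pi_mul_pos {x : ℝ} (h : |x| < 1 / 2) : 0 < Real.cos (Real.pi * x) := by
  have := abs_lt.1 h
  apply Real.cos_pos_of_mem_Ioo
  constructor <;> nlinarith [Real.pi_pos]

lemma mem_checkerboard_of_square {x y : ℝ} {m n : ℤ} (hx : |x - m| ≤ 1 / 2)
    (hy : |y - n| ≤ 1 / 2) (hmn : ¬ (Even m ↔ Even n)) : (x, y) ∈ checkerboard := by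
  have hsub : Ioo ((m : ℝ) - 1 / 2) (m + 1 / 2) ×ˢ Ioo ((n : ℝ) - 1 / 2) (n + 1 / 2) ⊆
      {w : ℝ × ℝ | ¬ (Even ⌊w.1 - 1 / 2⌋ ↔ Even ⌊w.2 - 1 / 2⌋)} := by
    rintro ⟨a, b⟩ ⟨⟨h1, h2⟩, h3, h4⟩
    have e1 : ⌊a - 1 / 2⌋ = m - 1 := by
      rw [Int.floor_eq_iff]; push_cast; constructor <;> linarith
    have e2 : ⌊b - 1 / 2⌋ = n - 1 := by
      rw [Int.floor_eq_iff]; push_cast; constructor <;> linarith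
    simp only [mem_ofPred_eq, e1, e2, Int.even_sub_one]
    tauto
  apply closure_mono hsub
  rw [closure_prod_eq, closure_Ioo (by linarith), closure_Ioo (by linarith)]
  rw [abs_le] at hx hy
  exact ⟨⟨by linarith, by linarith⟩, by linarith, by linarith⟩

lemma abs_sub_round_le (x : ℝ) : |x - round x| ≤ 1 / 2 := abs_sub_round x

/-- On the unit interval centred at the integer `n`, the cosine of `π x` has the weak sign of `(-1)
^ n`. The pattern thus consists of the points where the two cosines have weakly opposite signs, a
condition that is visibly invariant under motions. -/
lemma mem_checkerboard_iff {x y : ℝ} :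
    (x, y) ∈ checkerboard ↔ Real.cos (Real.pi * x) * Real.cos (Real.pi * y) ≤ 0 := by
  constructor
  · intro h
    have hcl : IsClosed {w : ℝ × ℝ | Real.cos (Real.pi * w.1) * Real.cos (Real.pi * w.2) ≤ 0} :=
      isClosed_le (by fun_prop) continuous_const
    refine closure_minimal ?_ hcl h
    rintro ⟨a, b⟩ hab
    simp only [mem_ofPred_eq] at hab ⊢
    have key : ∀ c : ℝ, |c - ((⌊c - 1 / 2⌋ + 1 : ℤ) : ℝ)| ≤ 1 / 2 := by
      intro c
      have h1 := Int.floor_le (c - 1 / 2)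
      have h2 := Int.lt_floor_add_one (c - 1 / 2)
      rw [abs_le]; push_cast; constructor <;> linarith
    have ha := cos_pi_mul_nonneg (key a)
    have hb := cos_pi_mul_nonneg (key b)
    rw [cos_pi_mul_eq a (⌊a - 1 / 2⌋ + 1), cos_pi_mul_eq b (⌊b - 1 / 2⌋ + 1)]
    have hp := mul_nonneg ha hb
    rcases Int.even_or_odd ⌊a - 1 / 2⌋ with h1 | h1 <;>
      rcases Int.even_or_odd ⌊b - 1 / 2⌋ with h2 | h2
    · exact absurd (iff_of_true h1 h2) hab
    · rw [h1.add_one.neg_one_zpow, h2.add_one.neg_one_zpow]; linarith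
    · rw [h1.add_one.neg_one_zpow, h2.add_one.neg_one_zpow]; linarith
    · exact absurd (iff_of_false (Int.not_even_iff_odd.2 h1) (Int.not_even_iff_odd.2 h2)) hab
  · intro h
    have hx := abs_sub_round_le x
    have hy := abs_sub_round_le y
    by_cases hmn : Even (round x) ↔ Even (round y)
    · have hprod : Real.cos (Real.pi * (x - round x)) * Real.cos (Real.pi * (y - round y)) ≤ 0 := by
        rw [cos_pi_mul_eq x (round x), cos_pi_mul_eq y (round y)] at h
        rcases Int.even_or_odd (round x) with h1 | h1
        · rw [h1.neg_one_zpow, (hmn.1 h1).neg_one_zpow] at h; linarith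
        · have h2 : Odd (round y) := by
            rw [← Int.not_even_iff_odd] at h1 ⊢; exact fun h => h1 (hmn.2 h)
          rw [h1.neg_one_zpow, h2.neg_one_zpow] at h; linarith
      -- If the nearest integers have equal parity, one cosine must vanish. That coordinate is a
      -- half-integer and is equally close to an integer of the other parity.
      have hor : |x - round x| = 1 / 2 ∨ |y - round y| = 1 / 2 := by
        by_contra hcon
        rw [not_or] at hcon
        have := mul_pos (cos_pi_mul_pos (lt_of_le_of_ne hx hcon.1))
          (cos_pi_mul_pos (lt_of_le_of_ne hy hcon.2))
        linarith
      have key : ∀ c : ℝ, |c - round c| = 1 / 2 → ∃ n : ℤ, |c - n| ≤ 1 / 2 ∧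
          ¬ (Even n ↔ Even (round c)) := by
        intro c hc
        rcases eq_or_eq_neg_of_abs_eq hc with h | h
        · refine ⟨round c + 1, ?_, by rw [Int.even_add_one]; tauto⟩
          rw [abs_le]; push_cast; constructor <;> linarith
        · refine ⟨round c - 1, ?_, by rw [Int.even_sub_one]; tauto⟩
          rw [abs_le]; push_cast; constructor <;> linarith
      rcases hor with hor | hor
      · obtain ⟨n, h1, h2⟩ := key x hor
        exact mem_checkerboard_of_square h1 hy (by tauto)
      · obtain ⟨n, h1, h2⟩ := key y hor
        exact mem_checkerboard_of_square hx h1 (by tauto)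
    · exact mem_checkerboard_of_square hx hy hmn

/-! ### The action on space and the developing maps -/

/-- The action of a rigid motion on space. -/
def act (γ : CubeIsom) (p : R3) : R3 := fun i => γ.sgn i * p (γ.perm i) + 2 * γ.trans i

lemma act_apply (γ : CubeIsom) (p : R3) (i : Fin 3) :
    act γ p i = γ.sgn i * p (γ.perm i) + 2 * γ.trans i := rfl

@[simp] lemma act_one (p : R3) : act 1 p = p := by
  funext i; simp [act]

lemma act_mul (a b : CubeIsom) (p : R3) : act (a * b) p = act a (act b p) := by
  funext i
  simp only [act, CubeIsom.mul_perm, CubeIsom.mul_sgn, CubeIsom.mul_trans, Equiv.Perm.mul_apply]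
  push_cast
  ring

lemma act_inv_act (γ : CubeIsom) (p : R3) : act γ⁻¹ (act γ p) = p := by
  rw [← act_mul, inv_mul_cancel, act_one]

lemma units_cast_cases (e : ℤˣ) : ((e : ℤ) : ℝ) = 1 ∨ ((e : ℤ) : ℝ) = -1 := by
  rcases Int.units_eq_one_or e with h | h <;> simp [h]

lemma cos_pi_act (γ : CubeIsom) (p : R3) (i : Fin 3) :
    Real.cos (Real.pi * act γ p i) = Real.cos (Real.pi * p (γ.perm i)) := by
  have e : ∀ e x : ℝ, Real.pi * (e * x + 2 * γ.trans i) =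
      Real.pi * (e * x) + γ.trans i * (2 * Real.pi) := by intro e x; ring
  rw [act_apply, e, Real.cos_add_int_mul_two_pi]
  rcases units_cast_cases (γ.sgn i) with h | h <;> rw [h]
  · rw [one_mul]
  · rw [neg_one_mul, mul_neg, Real.cos_neg]

/-- The point with coordinates `z` in the square face with frame `γ`. -/
def pos (γ : CubeIsom) (z : Plane) : R3 := act γ ![1 + z.2, 1 / 2, z.1]

lemma act_pos (δ γ : CubeIsom) (z : Plane) : act δ (pos γ z) = pos (δ * γ) z :=
  (act_mul _ _ _).symm

lemma act_r (p : R3) : act CubeIsom.r p = ![p 0, -p 2, p 1] := by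
  have h : ∀ i, CubeIsom.r.perm i = ![0, 2, 1] i := by decide
  funext i
  rw [act_apply, h]
  fin_cases i <;> simp [CubeIsom.r]

lemma act_u (p : R3) : act CubeIsom.u p = ![2 - p 1, p 0, p 2] := by
  have h : ∀ i, CubeIsom.u.perm i = ![1, 0, 2] i := by decide
  funext i
  rw [act_apply, h]
  fin_cases i <;> simp [CubeIsom.u]
  ring

lemma act_j (p : R3) : act CubeIsom.j p = ![2 - p 0, p 1, -p 2] := by
  funext i
  fin_cases i <;> simp [act, CubeIsom.j]
  ring

/-- The right edge of the face `γ` is the left edge of `γ * r`. Gluings are multiplications on the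
right, so they commute with motions acting on the left. -/
lemma pos_mul_r (γ : CubeIsom) (y : ℝ) : pos (γ * CubeIsom.r) (-1 / 2, y) = pos γ (1 / 2, y) := by
  unfold pos
  rw [act_mul, act_r]
  simp [neg_div]

lemma pos_mul_u (γ : CubeIsom) (x : ℝ) : pos (γ * CubeIsom.u) (x, -1 / 2) = pos γ (x, 1 / 2) := by
  unfold pos
  rw [act_mul, act_u]
  simp only [Matrix.cons_val]
  norm_num

lemma pos_mul_j (γ : CubeIsom) (z : Plane) : pos (γ * CubeIsom.j) z = pos γ (-z) := by
  unfold pos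
  rw [act_mul, act_j]
  simp only [Matrix.cons_val, Prod.fst_neg, Prod.snd_neg]
  congr 2
  ring

lemma mem_mucube_iff {p : R3} : p ∈ mucube ↔
    ∀ i k, i ≠ k → Real.cos (Real.pi * p i) * Real.cos (Real.pi * p k) ≤ 0 := by
  simp only [mucube, mem_ofPred_eq, mem_checkerboard_iff]
  constructor
  · rintro ⟨h1, h2, h3⟩ i k hik
    fin_cases i <;> fin_cases k <;>
      first | exact absurd rfl hik | assumption | (rw [mul_comm]; assumption)
  · intro h
    exact ⟨h 0 1 (by decide), h 0 2 (by decide), h 1 2 (by decide)⟩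

lemma act_mem_mucube {γ : CubeIsom} {p : R3} (hp : p ∈ mucube) : act γ p ∈ mucube := by
  rw [mem_mucube_iff] at hp ⊢
  intro i k hik
  rw [cos_pi_act, cos_pi_act]
  exact hp _ _ (fun h => hik (γ.perm.injective h))

lemma cos_pi_half : Real.cos (Real.pi * (1 / 2)) = 0 := by
  rw [mul_one_div]; exact Real.cos_pi_div_two

lemma cos_pi_one_add (y : ℝ) : Real.cos (Real.pi * (1 + y)) = -Real.cos (Real.pi * y) := by
  rw [mul_add, mul_one, add_comm, Real.cos_add_pi]

lemma pos_mem_mucube (γ : CubeIsom) {z : Plane} (h1 : |z.1| ≤ 1 / 2) (h2 : |z.2| ≤ 1 / 2) :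
    pos γ z ∈ mucube := by
  apply act_mem_mucube
  have c1 := cos_pi_mul_nonneg h1
  have c2 := cos_pi_mul_nonneg h2
  refine ⟨?_, ?_, ?_⟩ <;> rw [mem_checkerboard_iff]
  · change _ * Real.cos (Real.pi * (1 / 2)) ≤ 0
    rw [cos_pi_half, mul_zero]
  · change Real.cos (Real.pi * (1 + z.2)) * Real.cos (Real.pi * z.1) ≤ 0
    rw [cos_pi_one_add]
    nlinarith
  · change Real.cos (Real.pi * (1 / 2)) * _ ≤ 0
    rw [cos_pi_half, zero_mul]

/-- The unit square of the plane that contains a point. -/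
def rd (z : Plane) : ℤ × ℤ := (round z.1, round z.2)

/-- The coordinates of a point of the plane relative to the centre of its unit square. -/
def loc (z : Plane) : Plane := (z.1 - round z.1, z.2 - round z.2)

/-- A labelling of the unit squares of the plane by frames of faces. -/
abbrev Labelling : Type := ℤ × ℤ → CubeIsom

/-- The developing map of a labelling. -/
def dev (L : Labelling) (z : Plane) : R3 := pos (L (rd z)) (loc z)

/-- Since `round` rounds halves up, a square owns its left and lower edges only. For this reason
`CompatAt` tests just these two. -/
lemma loc_mem (z : Plane) : (loc z).1 ∈ Ico (-1 / 2 : ℝ) (1 / 2) ∧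
    (loc z).2 ∈ Ico (-1 / 2 : ℝ) (1 / 2) := by
  have key : ∀ x : ℝ, x - round x ∈ Ico (-1 / 2 : ℝ) (1 / 2) := by
    intro x
    have h1 := Int.floor_le (x + 1 / 2)
    have h2 := Int.lt_floor_add_one (x + 1 / 2)
    rw [round_eq]
    constructor <;> linarith
  exact ⟨key _, key _⟩

lemma dev_mem_mucube (L : Labelling) (z : Plane) : dev L z ∈ mucube := by
  apply pos_mem_mucube
  · exact abs_sub_round_le z.1
  · exact abs_sub_round_le z.2

/-- The developing map with values in the Mucube. -/
def devM (L : Labelling) (z : Plane) : M := ⟨dev L z, dev_mem_mucube L z⟩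

/-- The labelling is compatible with the gluing of the faces at this point, which is not a vertex
of a square. -/
structure CompatAt (L : Labelling) (z : Plane) : Prop where
  not_vertex : ¬ ((loc z).1 = -1 / 2 ∧ (loc z).2 = -1 / 2)
  right : (loc z).1 = -1 / 2 → L (rd z) = L (rd z - (1, 0)) * CubeIsom.r
  up : (loc z).2 = -1 / 2 → L (rd z) = L (rd z - (0, 1)) * CubeIsom.u

lemma round_eq_of_mem {x : ℝ} {m : ℤ} (h : x - m ∈ Ico (-1 / 2 : ℝ) (1 / 2)) : round x = m := by
  rw [round_eq, Int.floor_eq_iff]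
  constructor <;> linarith [h.1, h.2]

lemma eventually_round {x : ℝ} (h : x - round x ≠ -1 / 2) : ∀ᶠ x' in 𝓝 x, round x' = round x := by
  have h0 := (loc_mem (x, 0)).1
  have h1 : (round x : ℝ) - 1 / 2 < x := by
    have := lt_of_le_of_ne h0.1 (Ne.symm h)
    simp only [loc] at this
    linarith
  have h2 : x < round x + 1 / 2 := by
    have := h0.2
    simp only [loc] at this
    linarith
  filter_upwards [Ioo_mem_nhds h1 h2] with x' hx'
  apply round_eq_of_mem
  constructor <;> linarith [hx'.1, hx'.2]

lemma eventually_round_half {x : ℝ} (h : x - round x = -1 / 2) : ∀ᶠ x' in 𝓝 x,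
    (x ≤ x' ∧ round x' = round x) ∨ (x' < x ∧ round x' = round x - 1) := by
  filter_upwards [Ioo_mem_nhds (show x - 1 / 2 < x by linarith) (show x < x + 1 / 2 by linarith)]
    with x' hx'
  rcases le_or_gt x x' with hle | hlt
  · refine Or.inl ⟨hle, round_eq_of_mem ?_⟩
    constructor <;> linarith [hx'.1, hx'.2]
  · refine Or.inr ⟨hlt, round_eq_of_mem ?_⟩
    push_cast
    constructor <;> linarith [hx'.1, hx'.2]

lemma eventually_rd {z : Plane} (h : ¬ ((loc z).1 = -1 / 2 ∧ (loc z).2 = -1 / 2)) :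
    ∀ᶠ z' in 𝓝 z, rd z' = rd z ∨ ((loc z).1 = -1 / 2 ∧ rd z' = rd z - (1, 0)) ∨
      ((loc z).2 = -1 / 2 ∧ rd z' = rd z - (0, 1)) := by
  have c1 : Tendsto Prod.fst (𝓝 z) (𝓝 z.1) := continuous_fst.continuousAt
  have c2 : Tendsto Prod.snd (𝓝 z) (𝓝 z.2) := continuous_snd.continuousAt
  by_cases h1 : (loc z).1 = -1 / 2
  · have h2 : (loc z).2 ≠ -1 / 2 := fun h2 => h ⟨h1, h2⟩
    filter_upwards [c1.eventually (eventually_round_half h1), c2.eventually (eventually_round h2)]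
      with z' e1 e2
    rcases e1 with ⟨_, e1⟩ | ⟨_, e1⟩
    · exact Or.inl (Prod.ext e1 e2)
    · exact Or.inr (Or.inl ⟨h1, Prod.ext e1 (by simp [rd, e2])⟩)
  · by_cases h2 : (loc z).2 = -1 / 2
    · filter_upwards [c1.eventually (eventually_round h1),
        c2.eventually (eventually_round_half h2)] with z' e1 e2
      rcases e2 with ⟨_, e2⟩ | ⟨_, e2⟩
      · exact Or.inl (Prod.ext e1 e2)
      · exact Or.inr (Or.inr ⟨h2, Prod.ext (by simp [rd, e1]) e2⟩)
    · filter_upwards [c1.eventually (eventually_round h1), c2.eventually (eventually_round h2)]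
        with z' e1 e2
      exact Or.inl (Prod.ext e1 e2)

/-- Crossing an edge multiplies both labels on the right by the same `r` or `u`, and the quotient
`L' * L⁻¹` does not see this. -/
lemma CompatAt.eventually_label_eq {L L' : Labelling} {z : Plane} (h : CompatAt L z)
    (h' : CompatAt L' z) :
    ∀ᶠ z' in 𝓝 z, L' (rd z') * (L (rd z'))⁻¹ = L' (rd z) * (L (rd z))⁻¹ := by
  filter_upwards [eventually_rd h.not_vertex] with z' hz'
  rcases hz' with e | ⟨h1, e⟩ | ⟨h2, e⟩
  · rw [e]
  · rw [h.right h1, h'.right h1, e]; group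
  · rw [h.up h2, h'.up h2, e]; group

/-- Left multiplication of a labelling by a motion. -/
def Labelling.mul (g : CubeIsom) (L : Labelling) : Labelling := fun m => g * L m

lemma dev_mul (g : CubeIsom) (L : Labelling) (z : Plane) : dev (L.mul g) z = act g (dev L z) :=
  (act_pos _ _ _).symm

lemma CompatAt.mul {L : Labelling} {z : Plane} (h : CompatAt L z) (g : CubeIsom) :
    CompatAt (L.mul g) z :=
  ⟨h.not_vertex, fun h1 => by simp only [Labelling.mul, h.right h1, mul_assoc],
    fun h1 => by simp only [Labelling.mul, h.up h1, mul_assoc]⟩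

/-- An integral vector, as a vector of the plane. -/
def ofInt (n : ℤ × ℤ) : Plane := (n.1, n.2)

@[simp] lemma ofInt_fst (n : ℤ × ℤ) : (ofInt n).1 = n.1 := rfl
@[simp] lemma ofInt_snd (n : ℤ × ℤ) : (ofInt n).2 = n.2 := rfl
lemma ofInt_add (m n : ℤ × ℤ) : ofInt (m + n) = ofInt m + ofInt n := by
  ext <;> simp [ofInt]
lemma ofInt_sub (m n : ℤ × ℤ) : ofInt (m - n) = ofInt m - ofInt n := by
  ext <;> simp [ofInt]
lemma ofInt_neg (m : ℤ × ℤ) : ofInt (-m) = -ofInt m := by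
  ext <;> simp [ofInt]

lemma ofInt_rd_add_loc (z : Plane) : ofInt (rd z) + loc z = z := by
  ext <;> simp [ofInt, rd, loc]

lemma rd_add_ofInt (z : Plane) (n : ℤ × ℤ) : rd (z + ofInt n) = rd z + n := by
  ext <;> simp [ofInt, rd]

lemma loc_add_ofInt (z : Plane) (n : ℤ × ℤ) : loc (z + ofInt n) = loc z := by
  ext <;> simp [ofInt, loc]

/-- Translation of a labelling by an integral vector. -/
def Labelling.shift (n : ℤ × ℤ) (L : Labelling) : Labelling := fun m => L (m + n)

lemma dev_shift (n : ℤ × ℤ) (L : Labelling) (z : Plane) :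
    dev (L.shift n) z = dev L (z + ofInt n) := by
  unfold dev
  rw [rd_add_ofInt, loc_add_ofInt]
  rfl

lemma compatAt_shift {n : ℤ × ℤ} {L : Labelling} {z : Plane} :
    CompatAt (L.shift n) z ↔ CompatAt L (z + ofInt n) := by
  have e1 : ∀ e, rd z - e + n = rd (z + ofInt n) - e := fun e => by
    rw [rd_add_ofInt]; abel
  have e2 : L.shift n (rd z) = L (rd (z + ofInt n)) := by rw [rd_add_ofInt]; rfl
  constructor
  · rintro ⟨h1, h2, h3⟩
    rw [e2] at h2 h3
    simp only [Labelling.shift, e1] at h2 h3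
    rw [← loc_add_ofInt z n] at h1 h2 h3
    exact ⟨h1, h2, h3⟩
  · rintro ⟨h1, h2, h3⟩
    rw [loc_add_ofInt z n] at h1 h2 h3
    refine ⟨h1, ?_, ?_⟩ <;> rw [e2] <;> simp only [Labelling.shift, e1] <;> assumption

end Mucube

namespace Mucube

/-! ### Coincidences of points of faces -/

section Arithmetic

variable {e : ℤˣ} {t : ℤ} {x y : ℝ}

lemma int_eq_of_lt {t s : ℤ} (h1 : (s : ℝ) - 1 < t) (h2 : (t : ℝ) < s + 1) : t = s := by
  have h1 : s - 1 < t := by exact_mod_cast h1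
  have h2 : t < s + 1 := by exact_mod_cast h2
  omega

lemma unit_eq_one (h : ((e : ℤ) : ℝ) = 1) : e = 1 := by
  have : (e : ℤ) = 1 := by exact_mod_cast h
  exact Units.ext this

lemma unit_eq_neg_one (h : ((e : ℤ) : ℝ) = -1) : e = -1 := by
  have : (e : ℤ) = -1 := by exact_mod_cast h
  exact Units.ext this

/-- The coordinates of a point of the base face are of three types, `1 + y`, `1 / 2` and `x`. This
lemma and its successors decide when a sign change and an even translation take one type to another;
between different types, any free coordinate is forced onto an edge. -/
lemma half_eq_half (h : (1 / 2 : ℝ) = e * (1 / 2) + 2 * t) : e = 1 ∧ t = 0 := by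
  rcases units_cast_cases e with he | he <;> rw [he] at h
  · exact ⟨unit_eq_one he, int_eq_of_lt (by push_cast; linarith) (by push_cast; linarith)⟩
  · exfalso
    have h1 : (2 * t : ℝ) = 1 := by linarith
    have h2 : 2 * t = 1 := by exact_mod_cast h1
    omega

lemma half_eq_of_mem (hx : x ∈ Ico (-1 / 2 : ℝ) (1 / 2)) (h : (1 / 2 : ℝ) = e * x + 2 * t) :
    x = -1 / 2 ∧ e = -1 ∧ t = 0 := by
  obtain ⟨h1, h2⟩ := hx
  have ht : t = 0 := by
    rcases units_cast_cases e with he | he <;> rw [he] at h <;>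
      exact int_eq_of_lt (by push_cast; linarith) (by push_cast; linarith)
  subst ht
  rcases units_cast_cases e with he | he <;> rw [he] at h <;> push_cast at h
  · linarith
  · exact ⟨by linarith, unit_eq_neg_one he, rfl⟩

lemma mem_eq_half (hx : x ∈ Ico (-1 / 2 : ℝ) (1 / 2)) (h : x = e * (1 / 2 : ℝ) + 2 * t) :
    x = -1 / 2 ∧ e = -1 ∧ t = 0 := by
  obtain ⟨h1, h2⟩ := hx
  have ht : t = 0 := by
    rcases units_cast_cases e with he | he <;> rw [he] at h <;>
      exact int_eq_of_lt (by push_cast; linarith) (by push_cast; linarith)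
  subst ht
  rcases units_cast_cases e with he | he <;> rw [he] at h <;> push_cast at h
  · linarith
  · exact ⟨by linarith, unit_eq_neg_one he, rfl⟩

lemma one_add_eq_half (hx : x ∈ Ico (-1 / 2 : ℝ) (1 / 2))
    (h : 1 + x = e * (1 / 2 : ℝ) + 2 * t) : x = -1 / 2 ∧ e = 1 ∧ t = 0 := by
  obtain ⟨h1, h2⟩ := hx
  rcases units_cast_cases e with he | he <;> rw [he] at h
  · have ht : t = 0 := int_eq_of_lt (by push_cast; linarith) (by push_cast; linarith)
    subst ht
    push_cast at h
    exact ⟨by linarith, unit_eq_one he, rfl⟩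
  · have ht : t = 0 := int_eq_of_lt (by push_cast; linarith) (by push_cast; linarith)
    subst ht
    push_cast at h
    linarith

lemma half_eq_one_add (hx : x ∈ Ico (-1 / 2 : ℝ) (1 / 2))
    (h : (1 / 2 : ℝ) = e * (1 + x) + 2 * t) : x = -1 / 2 ∧ e = 1 ∧ t = 0 := by
  obtain ⟨h1, h2⟩ := hx
  rcases units_cast_cases e with he | he <;> rw [he] at h
  · have ht : t = 0 := int_eq_of_lt (by push_cast; linarith) (by push_cast; linarith)
    subst ht
    push_cast at h
    exact ⟨by linarith, unit_eq_one he, rfl⟩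
  · have ht : t = 1 := int_eq_of_lt (by push_cast; linarith) (by push_cast; linarith)
    subst ht
    push_cast at h
    linarith

lemma one_add_eq_mem (hx : x ∈ Ico (-1 / 2 : ℝ) (1 / 2)) (hy : y ∈ Ico (-1 / 2 : ℝ) (1 / 2))
    (h : 1 + y = e * x + 2 * t) : x = -1 / 2 := by
  obtain ⟨h1, h2⟩ := hx
  obtain ⟨h3, h4⟩ := hy
  have ht : t = 0 := by
    rcases units_cast_cases e with he | he <;> rw [he] at h <;>
      exact int_eq_of_lt (by push_cast; linarith) (by push_cast; linarith)
  subst ht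
  rcases units_cast_cases e with he | he <;> rw [he] at h <;> push_cast at h <;> linarith

lemma mem_eq_one_add (hx : x ∈ Ico (-1 / 2 : ℝ) (1 / 2)) (hy : y ∈ Ico (-1 / 2 : ℝ) (1 / 2))
    (h : x = e * (1 + y) + 2 * t) : y = -1 / 2 := by
  obtain ⟨h1, h2⟩ := hx
  obtain ⟨h3, h4⟩ := hy
  rcases units_cast_cases e with he | he <;> rw [he] at h
  · have ht : t = 0 := int_eq_of_lt (by push_cast; linarith) (by push_cast; linarith)
    subst ht
    push_cast at h
    linarith
  · have ht : t = 0 ∨ t = 1 := by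
      have h5 : (-1 : ℝ) < t := by linarith
      have h6 : (t : ℝ) < 2 := by linarith
      have h5 : -1 < t := by exact_mod_cast h5
      have h6 : t < 2 := by exact_mod_cast h6
      omega
    rcases ht with rfl | rfl <;> push_cast at h <;> linarith

lemma mem_eq_mem (hx : x ∈ Ico (-1 / 2 : ℝ) (1 / 2)) (hy : y ∈ Ico (-1 / 2 : ℝ) (1 / 2))
    (h : y = e * x + 2 * t) : t = 0 := by
  obtain ⟨h1, h2⟩ := hx
  obtain ⟨h3, h4⟩ := hy
  rcases units_cast_cases e with he | he <;> rw [he] at h <;>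
    exact int_eq_of_lt (by push_cast; linarith) (by push_cast; linarith)

lemma one_add_eq_one_add (hx : x ∈ Ico (-1 / 2 : ℝ) (1 / 2)) (hy : y ∈ Ico (-1 / 2 : ℝ) (1 / 2))
    (h : 1 + y = e * (1 + x) + 2 * t) : (e = 1 ∧ t = 0 ∧ y = x) ∨ (e = -1 ∧ t = 1 ∧ y = -x) := by
  obtain ⟨h1, h2⟩ := hx
  obtain ⟨h3, h4⟩ := hy
  rcases units_cast_cases e with he | he <;> rw [he] at h
  · have ht : t = 0 := int_eq_of_lt (by push_cast; linarith) (by push_cast; linarith)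
    subst ht
    push_cast at h
    exact Or.inl ⟨unit_eq_one he, rfl, by linarith⟩
  · have ht : t = 1 := int_eq_of_lt (by push_cast; linarith) (by push_cast; linarith)
    subst ht
    push_cast at h
    exact Or.inr ⟨unit_eq_neg_one he, rfl, by linarith⟩

end Arithmetic

lemma perm_fin_three (σ : Equiv.Perm (Fin 3)) :
    σ = 1 ∨ σ = Equiv.swap 0 1 ∨ σ = Equiv.swap 0 2 ∨ σ = Equiv.swap 1 2 ∨
      (σ 0 = 1 ∧ σ 1 = 2 ∧ σ 2 = 0) ∨ (σ 0 = 2 ∧ σ 1 = 0 ∧ σ 2 = 1) := by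
  revert σ; decide

/-- A motion that takes a point of the base face to a point of the base face. -/
lemma act_base_eq {γ : CubeIsom} (hγ : CubeIsom.det γ = 1) {z z' : Plane}
    (h1 : z.1 ∈ Ico (-1 / 2 : ℝ) (1 / 2)) (h2 : z.2 ∈ Ico (-1 / 2 : ℝ) (1 / 2))
    (h1' : z'.1 ∈ Ico (-1 / 2 : ℝ) (1 / 2)) (h2' : z'.2 ∈ Ico (-1 / 2 : ℝ) (1 / 2))
    (hv : ¬ (z.1 = -1 / 2 ∧ z.2 = -1 / 2)) (h : pos γ z = pos 1 z') :
    (γ = 1 ∧ z' = z) ∨ (γ = CubeIsom.j ∧ z' = -z) ∨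
    (γ = CubeIsom.r⁻¹ * CubeIsom.j ∧ z.1 = -1 / 2 ∧ z' = (-1 / 2, -z.2)) ∨
    (γ = CubeIsom.u⁻¹ * CubeIsom.j ∧ z.2 = -1 / 2 ∧ z' = (-z.1, -1 / 2)) := by
  obtain ⟨σ, ε, t⟩ := γ
  have e0 := congrFun h 0
  have e1 := congrFun h 1
  have e2 := congrFun h 2
  unfold pos at e0 e1 e2
  rw [act_one, act_apply] at e0 e1 e2
  simp only [Matrix.cons_val] at e0 e1 e2
  rw [CubeIsom.det_apply, Fin.prod_univ_three] at hγ
  simp only at hγ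
  have hext : ∀ γ' : CubeIsom, σ = γ'.perm → (ε 0 = γ'.sgn 0 ∧ ε 1 = γ'.sgn 1 ∧ ε 2 = γ'.sgn 2) →
      (t 0 = γ'.trans 0 ∧ t 1 = γ'.trans 1 ∧ t 2 = γ'.trans 2) → (⟨σ, ε, t⟩ : CubeIsom) = γ' := by
    rintro γ' h1 ⟨h2, h3, h4⟩ ⟨h5, h6, h7⟩
    ext i
    · rw [h1]
    · fin_cases i <;> simp [h2, h3, h4]
    · fin_cases i <;> simp [h5, h6, h7]
  -- The identity permutation leaves the base face in place and gives `1` or `j`. The swaps of `0,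
  -- 1` and of `1, 2` are possible only on the lower and on the left edge. The remaining three
  -- permutations would force `z` to be a vertex.
  rcases perm_fin_three σ with rfl | rfl | rfl | rfl | ⟨s0, s1, s2⟩ | ⟨s0, s1, s2⟩
  · simp only [Equiv.Perm.one_apply, Matrix.cons_val] at e0 e1 e2
    obtain ⟨a1, a2⟩ := half_eq_half e1.symm
    have a3 := mem_eq_mem h1 h1' e2.symm
    rw [a3, Int.cast_zero, mul_zero, add_zero] at e2
    rw [a1, map_one, one_mul, mul_one] at hγ
    rcases one_add_eq_one_add h2 h2' e0.symm with ⟨b1, b2, b3⟩ | ⟨b1, b2, b3⟩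
    · rw [b1, one_mul] at hγ
      refine Or.inl ⟨hext _ rfl ⟨b1, a1, hγ⟩ ⟨b2, a2, a3⟩, Prod.ext ?_ b3⟩
      rw [← e2, hγ]; simp
    · have hγ : ε 2 = -1 := by
        rw [b1] at hγ
        rw [← neg_eq_iff_eq_neg, ← hγ, neg_one_mul]
      refine Or.inr (Or.inl ⟨hext _ rfl ⟨b1, a1, hγ⟩ ⟨b2, a2, a3⟩, Prod.ext ?_ b3⟩)
      rw [← e2, hγ]; simp
  · simp only [Equiv.swap_apply_left, Equiv.swap_apply_right,
      show (Equiv.swap (0 : Fin 3) 1) 2 = 2 by decide, Matrix.cons_val] at e0 e1 e2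
    obtain ⟨a1, a2, a3⟩ := one_add_eq_half h2' e0.symm
    obtain ⟨b1, b2, b3⟩ := half_eq_one_add h2 e1.symm
    have c1 := mem_eq_mem h1 h1' e2.symm
    have hγ : ε 2 = -1 := by
      rw [a2, b2, Equiv.Perm.sign_swap (by decide)] at hγ
      rw [← neg_eq_iff_eq_neg, ← hγ]; simp
    refine Or.inr (Or.inr (Or.inr ⟨hext _ (by decide) ?_ ?_, b1, Prod.ext ?_ a1⟩))
    · rw [a2, b2, hγ]; decide
    · rw [a3, b3, c1]; decide
    · rw [← e2, hγ, c1]; simp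
  · exfalso
    simp only [Equiv.swap_apply_left, Equiv.swap_apply_right, Matrix.cons_val] at e0 e2
    exact hv ⟨one_add_eq_mem h1 h2' e0.symm, mem_eq_one_add h1' h2 e2.symm⟩
  · simp only [Equiv.swap_apply_left, Equiv.swap_apply_right,
      show (Equiv.swap (1 : Fin 3) 2) 0 = 0 by decide, Matrix.cons_val] at e0 e1 e2
    obtain ⟨a1, a2, a3⟩ := half_eq_of_mem h1 e1.symm
    obtain ⟨b1, b2, b3⟩ := mem_eq_half h1' e2.symm
    have hγ : ε 0 = -1 := by
      rw [a2, b2, Equiv.Perm.sign_swap (by decide)] at hγ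
      rw [← neg_eq_iff_eq_neg, ← hγ]; simp
    rcases one_add_eq_one_add h2 h2' e0.symm with ⟨c1, c2, c3⟩ | ⟨c1, c2, c3⟩
    · rw [hγ] at c1; exact absurd c1 (by decide)
    refine Or.inr (Or.inr (Or.inl ⟨hext _ (by decide) ?_ ?_, a1, Prod.ext b1 c3⟩))
    · rw [a2, b2, hγ]; decide
    · rw [a3, b3, c2]; decide
  · exfalso
    simp only [s1, s2, Matrix.cons_val] at e1 e2
    exact hv ⟨(half_eq_of_mem h1 e1.symm).1, mem_eq_one_add h1' h2 e2.symm⟩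
  · exfalso
    simp only [s0, s1, Matrix.cons_val] at e0 e1
    exact hv ⟨one_add_eq_mem h1 h2' e0.symm, (half_eq_one_add h2 e1.symm).1⟩

/-- If developed points coincide up to a motion, then so do the labels, up to an
integral translation of the plane or a half-turn. -/
lemma dev_eq_dev {L L' : Labelling} (hL : ∀ m, CubeIsom.det (L m) = 1)
    (hL' : ∀ m, CubeIsom.det (L' m) = 1) {δ : CubeIsom} (hδ : CubeIsom.det δ = 1) {z z' : Plane}
    (hz : CompatAt L z) (hz' : CompatAt L' z') (h : act δ (dev L z) = dev L' z') :
    (∃ n, z' = z + ofInt n ∧ L' (rd z') = δ * L (rd z)) ∨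
    (∃ n, z' = ofInt n - z ∧ L' (n - rd z) * CubeIsom.j = δ * L (rd z)) := by
  have key : pos ((L' (rd z'))⁻¹ * (δ * L (rd z))) (loc z) = pos 1 (loc z') := by
    rw [← act_pos, ← act_pos]
    change act _ (act δ (dev L z)) = _
    rw [h]
    unfold dev
    rw [act_pos, inv_mul_cancel]
  have hdet : CubeIsom.det ((L' (rd z'))⁻¹ * (δ * L (rd z))) = 1 := by
    simp [hL, hL', hδ]
  rcases act_base_eq hdet (loc_mem z).1 (loc_mem z).2 (loc_mem z').1 (loc_mem z').2
    hz.not_vertex key with ⟨hγ, hl⟩ | ⟨hγ, hl⟩ | ⟨hγ, h1, hl⟩ | ⟨hγ, h1, hl⟩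
  · refine Or.inl ⟨rd z' - rd z, ?_, (inv_mul_eq_one.1 hγ)⟩
    obtain ⟨l1, l2⟩ := Prod.ext_iff.1 hl
    simp only [loc] at l1 l2
    ext <;> simp [rd] <;> linarith
  · refine Or.inr ⟨rd z' + rd z, ?_, ?_⟩
    · obtain ⟨l1, l2⟩ := Prod.ext_iff.1 hl
      simp [loc] at l1 l2
      ext <;> simp [rd] <;> linarith
    · rw [add_sub_cancel_right, eq_comm, ← inv_mul_eq_iff_eq_mul, hγ]
  -- Both points lie on left edges, and the half-turn takes the square of `z` to the left neighbour
  -- of the square of `z'`; hence the shift by `(1, 0)`.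
  · refine Or.inr ⟨rd z' - (1, 0) + rd z, ?_, ?_⟩
    · obtain ⟨l1, l2⟩ := Prod.ext_iff.1 hl
      simp [loc] at h1 l1 l2
      ext <;> simp [rd] <;> linarith
    · rw [add_sub_cancel_right, eq_comm]
      rw [inv_mul_eq_iff_eq_mul, hz'.right (by rw [hl])] at hγ
      rw [hγ]; group
  · refine Or.inr ⟨rd z' - (0, 1) + rd z, ?_, ?_⟩
    · obtain ⟨l1, l2⟩ := Prod.ext_iff.1 hl
      simp [loc] at h1 l1 l2
      ext <;> simp [rd] <;> linarith
    · rw [add_sub_cancel_right, eq_comm]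
      rw [inv_mul_eq_iff_eq_mul, hz'.up (by rw [hl])] at hγ
      rw [hγ]; group

end Mucube

namespace Mucube

open CubeIsom (r u j det)

/-! ### Frames and charts -/

/-- The horizontal unit vector of the frame of a motion. -/
def hvec (γ : CubeIsom) : R3 := ((γ.sgn (γ.perm⁻¹ 2) : ℤ) : ℝ) • Pi.single (γ.perm⁻¹ 2) 1

/-- The vertical unit vector of the frame of a motion. -/
def vvec (γ : CubeIsom) : R3 := ((γ.sgn (γ.perm⁻¹ 0) : ℤ) : ℝ) • Pi.single (γ.perm⁻¹ 0) 1

lemma perm_apply_inv (σ : Equiv.Perm (Fin 3)) (k : Fin 3) : σ (σ⁻¹ k) = k := σ.apply_symm_apply k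

lemma pos_eq (γ : CubeIsom) (z : Plane) : pos γ z = pos γ 0 + z.1 • hvec γ + z.2 • vvec γ := by
  funext i
  obtain ⟨k, rfl⟩ : ∃ k, i = γ.perm⁻¹ k := ⟨γ.perm i, by simp⟩
  simp only [pos, act_apply, hvec, vvec, Pi.add_apply, Pi.smul_apply, Pi.single_apply,
    smul_eq_mul, EmbeddingLike.apply_eq_iff_eq, perm_apply_inv]
  fin_cases k <;> simp <;> ring

lemma cross_single (σ : Equiv.Perm (Fin 3)) :
    crossProduct (Pi.single (σ⁻¹ 2) (1 : ℝ)) (Pi.single (σ⁻¹ 0) (1 : ℝ)) =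
      (((Equiv.Perm.sign σ : ℤˣ) : ℤ) : ℝ) • Pi.single (σ⁻¹ 1) (1 : ℝ) := by
  have key : ∀ σ : Equiv.Perm (Fin 3),
      (σ⁻¹ 0 = 0 ∧ σ⁻¹ 1 = 1 ∧ σ⁻¹ 2 = 2 ∧ Equiv.Perm.sign σ = 1) ∨
      (σ⁻¹ 0 = 0 ∧ σ⁻¹ 1 = 2 ∧ σ⁻¹ 2 = 1 ∧ Equiv.Perm.sign σ = -1) ∨
      (σ⁻¹ 0 = 1 ∧ σ⁻¹ 1 = 0 ∧ σ⁻¹ 2 = 2 ∧ Equiv.Perm.sign σ = -1) ∨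
      (σ⁻¹ 0 = 1 ∧ σ⁻¹ 1 = 2 ∧ σ⁻¹ 2 = 0 ∧ Equiv.Perm.sign σ = 1) ∨
      (σ⁻¹ 0 = 2 ∧ σ⁻¹ 1 = 0 ∧ σ⁻¹ 2 = 1 ∧ Equiv.Perm.sign σ = 1) ∨
      (σ⁻¹ 0 = 2 ∧ σ⁻¹ 1 = 1 ∧ σ⁻¹ 2 = 0 ∧ Equiv.Perm.sign σ = -1) := by decide
  rcases key σ with ⟨h0, h1, h2, h⟩ | ⟨h0, h1, h2, h⟩ | ⟨h0, h1, h2, h⟩ | ⟨h0, h1, h2, h⟩ |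
    ⟨h0, h1, h2, h⟩ | ⟨h0, h1, h2, h⟩ <;> rw [h0, h1, h2, h, cross_apply] <;> funext i <;>
    fin_cases i <;> simp

lemma exists_unit {e : ℝ} (h : e = 1 ∨ e = -1) : ∃ e' : ℤˣ, e = ((e' : ℤ) : ℝ) := by
  rcases h with rfl | rfl
  · exact ⟨1, by simp⟩
  · exact ⟨-1, by simp⟩

/-- A frame is the image of the frame of the base face, whose centre is `(1, 1/2, 0)`, under a
motion. Given the parities of the centre, the requirement that `a × b` be the outward normal says
precisely that the motion has determinant one. -/
lemma isFaceFrame_iff {c a b : R3} : IsFaceFrame c a b ↔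
    ∃ γ, det γ = 1 ∧ c = pos γ 0 ∧ a = hvec γ ∧ b = vvec γ := by
  constructor
  · rintro ⟨i, j, k, δ, ε, ν, hij, hik, hjk, hδ, hε, hν, ⟨l, hl⟩, ⟨m, hm⟩, ⟨n, hn⟩, rfl, rfl, hc⟩
    obtain ⟨δ, rfl⟩ := exists_unit hδ
    obtain ⟨ε, rfl⟩ := exists_unit hε
    obtain ⟨ν, rfl⟩ := exists_unit hν
    have key : ∀ i j k : Fin 3, i ≠ j → i ≠ k → j ≠ k →
        ∃ σ : Equiv.Perm (Fin 3), σ⁻¹ 0 = i ∧ σ⁻¹ 2 = j ∧ σ⁻¹ 1 = k := by decide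
    obtain ⟨σ, rfl, rfl, rfl⟩ := key i j k hij hik hjk
    obtain ⟨l', hl'⟩ : ∃ l' : ℤ, c (σ⁻¹ 0) = ((δ : ℤ) : ℝ) + 2 * l' := by
      rcases units_cast_cases δ with h | h
      · exact ⟨l, by rw [hl, h]; ring⟩
      · exact ⟨l + 1, by rw [hl, h]; push_cast; ring⟩
    have hν : ν = Equiv.Perm.sign σ * ε * δ := by
      rw [map_smul, LinearMap.map_smul₂, cross_single] at hc
      have := congrFun hc (σ⁻¹ 1)
      simp only [Pi.smul_apply, Pi.single_eq_same, smul_eq_mul, mul_one] at this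
      have h2 : (δ : ℤ) * (ε * (Equiv.Perm.sign σ : ℤˣ)) = ν := by exact_mod_cast this
      apply Units.ext
      rw [← h2]; push_cast; ring
    refine ⟨⟨σ, fun x => ![δ, ν, ε] (σ x), fun x => ![l', n, m] (σ x)⟩, ?_, ?_, ?_, ?_⟩
    · rw [CubeIsom.det_apply]
      simp only
      rw [Equiv.prod_comp σ ![δ, ν, ε], Fin.prod_univ_three]
      simp only [Matrix.cons_val, hν]
      have : ∀ s δ ε : ℤˣ, s * (δ * (s * ε * δ) * ε) = 1 := by decide
      exact this _ _ _
    · funext x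
      obtain ⟨y, rfl⟩ : ∃ y, x = σ⁻¹ y := ⟨σ x, by simp⟩
      simp only [pos, act_apply, perm_apply_inv]
      fin_cases y
      · change c (σ⁻¹ 0) = (δ : ℤ) * (1 + 0) + 2 * (l' : ℝ)
        linarith
      · change c (σ⁻¹ 1) = (ν : ℤ) * (1 / 2) + 2 * (n : ℝ)
        linarith
      · change c (σ⁻¹ 2) = (ε : ℤ) * 0 + 2 * (m : ℝ)
        linarith
    · simp [hvec]
    · simp [vvec]
  · rintro ⟨γ, hγ, rfl, rfl, rfl⟩
    refine ⟨γ.perm⁻¹ 0, γ.perm⁻¹ 2, γ.perm⁻¹ 1, _, _, ((γ.sgn (γ.perm⁻¹ 1) : ℤ) : ℝ),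
      by simp, by simp, by simp, units_cast_cases (γ.sgn (γ.perm⁻¹ 0)),
      units_cast_cases (γ.sgn (γ.perm⁻¹ 2)),
      units_cast_cases _, ?_, ⟨γ.trans (γ.perm⁻¹ 2), ?_⟩, ⟨γ.trans (γ.perm⁻¹ 1), ?_⟩, rfl, rfl, ?_⟩
    · simp only [pos, act_apply, perm_apply_inv]
      rcases units_cast_cases (γ.sgn (γ.perm⁻¹ 0)) with h | h
      · exact ⟨γ.trans (γ.perm⁻¹ 0), by rw [h]; simp; ring⟩
      · exact ⟨γ.trans (γ.perm⁻¹ 0) - 1, by rw [h]; simp; ring⟩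
    · simp [pos, act_apply]
    · simp [pos, act_apply]; ring
    · unfold hvec vvec
      rw [map_smul, LinearMap.map_smul₂, cross_single, smul_smul, smul_smul]
      congr 1
      rw [CubeIsom.det_apply] at hγ
      have hp : ∏ i, γ.sgn i = γ.sgn (γ.perm⁻¹ 0) * γ.sgn (γ.perm⁻¹ 1) * γ.sgn (γ.perm⁻¹ 2) := by
        rw [← Equiv.prod_comp γ.perm⁻¹ γ.sgn, Fin.prod_univ_three]
      rw [hp] at hγ
      have : γ.sgn (γ.perm⁻¹ 1) =
          γ.sgn (γ.perm⁻¹ 0) * γ.sgn (γ.perm⁻¹ 2) * Equiv.Perm.sign γ.perm := by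
        revert hγ
        generalize γ.sgn (γ.perm⁻¹ 0) = x
        generalize γ.sgn (γ.perm⁻¹ 1) = y
        generalize γ.sgn (γ.perm⁻¹ 2) = z
        generalize Equiv.Perm.sign γ.perm = s
        revert x y z s; decide
      rw [this]; push_cast; ring

lemma hvec_mul_j (γ : CubeIsom) : hvec (γ * j) = -hvec γ := by
  have h1 := pos_mul_j γ (1, 0)
  have h2 := pos_mul_j γ 0
  rw [pos_eq, pos_eq γ (-(1, 0))] at h1
  rw [neg_zero] at h2
  rw [h2] at h1
  simpa using h1

lemma vvec_mul_j (γ : CubeIsom) : vvec (γ * j) = -vvec γ := by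
  have h1 := pos_mul_j γ (0, 1)
  have h2 := pos_mul_j γ 0
  rw [pos_eq, pos_eq γ (-(0, 1))] at h1
  rw [neg_zero] at h2
  rw [h2] at h1
  simpa using h1

lemma unit_smul_single_ne (e : ℤˣ) (i : Fin 3) :
    (((e : ℤ) : ℝ) • Pi.single i 1 : R3) ≠ -(((e : ℤ) : ℝ) • Pi.single i 1) := by
  intro h
  have := congrFun h i
  simp only [Pi.neg_apply, Pi.smul_apply, Pi.single_eq_same, smul_eq_mul, mul_one] at this
  rcases units_cast_cases e with h | h <;> rw [h] at this <;> norm_num at this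

/-- By `act_base_eq` the midpoint of the common edge leaves only the candidates `γ * r` and `γ * j`,
and the latter reverses the vertical vector. -/
lemma eq_mul_r {γ γ' : CubeIsom} (h : det γ = 1) (h' : det γ' = 1) (hv : vvec γ' = vvec γ)
    (hp : pos γ (1 / 2, 0) = pos γ' (-1 / 2, 0)) : γ' = γ * r := by
  rw [← pos_mul_r] at hp
  have key : pos ((γ * r)⁻¹ * γ') (-1 / 2, 0) = pos 1 (-1 / 2, 0) := by
    rw [← act_pos, ← hp, act_pos, inv_mul_cancel]
  rcases act_base_eq (by simp [h, h', CubeIsom.det_r]) (by norm_num) (by norm_num) (by norm_num)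
    (by norm_num) (by norm_num) key with ⟨hγ, -⟩ | ⟨-, hz⟩ | ⟨hγ, -⟩ | ⟨-, hz, -⟩
  · exact (inv_mul_eq_one.1 hγ).symm
  · have := congrArg Prod.fst hz
    norm_num at this
  · exfalso
    have : γ' = γ * j := by
      rw [inv_mul_eq_iff_eq_mul] at hγ
      rw [hγ]; group
    rw [this, vvec_mul_j] at hv
    exact unit_smul_single_ne _ _ hv.symm
  · norm_num at hz

lemma eq_mul_u {γ γ' : CubeIsom} (h : det γ = 1) (h' : det γ' = 1) (hv : hvec γ' = hvec γ)
    (hp : pos γ (0, 1 / 2) = pos γ' (0, -1 / 2)) : γ' = γ * u := by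
  rw [← pos_mul_u] at hp
  have key : pos ((γ * u)⁻¹ * γ') (0, -1 / 2) = pos 1 (0, -1 / 2) := by
    rw [← act_pos, ← hp, act_pos, inv_mul_cancel]
  rcases act_base_eq (by simp [h, h', CubeIsom.det_u]) (by norm_num) (by norm_num) (by norm_num)
    (by norm_num) (by norm_num) key with ⟨hγ, -⟩ | ⟨-, hz⟩ | ⟨-, hz, -⟩ | ⟨hγ, -⟩
  · exact (inv_mul_eq_one.1 hγ).symm
  · have := congrArg Prod.snd hz
    norm_num at this
  · norm_num at hz
  · exfalso
    have : γ' = γ * j := by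
      rw [inv_mul_eq_iff_eq_mul] at hγ
      rw [hγ]; group
    rw [this, hvec_mul_j] at hv
    exact unit_smul_single_ne _ _ hv.symm

/-- The labelling of a row of squares. -/
def rowLabel (γ : CubeIsom) : Labelling := fun m => γ * r ^ m.1

/-- The labelling of a column of squares. -/
def colLabel (γ : CubeIsom) : Labelling := fun m => γ * u ^ m.2

lemma round_eq_zero {x : ℝ} (h : x ∈ Ioo (-1 / 2 : ℝ) (1 / 2)) : round x = 0 :=
  round_eq_of_mem (by rw [Int.cast_zero, sub_zero]; exact ⟨h.1.le, h.2⟩)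

lemma dev_rowLabel {γ : CubeIsom} {z : Plane}
    (hz : z ∈ Ioo (-1 / 2 : ℝ) (3 / 2) ×ˢ Ioo (-1 / 2 : ℝ) (1 / 2)) : dev (rowLabel γ) z =
      if z.1 ≤ 1 / 2 then pos γ z else pos (γ * r) (z.1 - 1, z.2) := by
  obtain ⟨⟨h1, h2⟩, h3⟩ := hz
  have e2 := round_eq_zero h3
  unfold dev rd loc rowLabel
  rw [e2]
  rcases lt_or_ge z.1 (1 / 2) with h | h
  · rw [if_pos h.le, round_eq_zero ⟨h1, h⟩]
    simp
  · rw [round_eq_of_mem (m := 1) (by push_cast; constructor <;> linarith)]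
    rcases h.eq_or_lt with h | h
    · rw [if_pos h.symm.le]
      have := pos_mul_r γ z.2
      have e : z = (1 / 2, z.2) := Prod.ext h.symm rfl
      nth_rewrite 3 [e]
      rw [← this, ← h]
      norm_num
    · rw [if_neg h.not_ge]
      simp

lemma dev_colLabel {γ : CubeIsom} {z : Plane}
    (hz : z ∈ Ioo (-1 / 2 : ℝ) (1 / 2) ×ˢ Ioo (-1 / 2 : ℝ) (3 / 2)) : dev (colLabel γ) z =
      if z.2 ≤ 1 / 2 then pos γ z else pos (γ * u) (z.1, z.2 - 1) := by
  obtain ⟨h3, ⟨h1, h2⟩⟩ := hz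
  have e2 := round_eq_zero h3
  unfold dev rd loc colLabel
  rw [e2]
  rcases lt_or_ge z.2 (1 / 2) with h | h
  · rw [if_pos h.le, round_eq_zero ⟨h1, h⟩]
    simp
  · rw [round_eq_of_mem (m := 1) (by push_cast; constructor <;> linarith)]
    rcases h.eq_or_lt with h | h
    · rw [if_pos h.symm.le]
      have := pos_mul_u γ z.1
      have e : z = (z.1, 1 / 2) := Prod.ext rfl h.symm
      nth_rewrite 3 [e]
      rw [← this, ← h]
      norm_num
    · rw [if_neg h.not_ge]
      simp

lemma compatAt_rowLabel (γ : CubeIsom) {z : Plane} (h : z.2 ∈ Ioo (-1 / 2 : ℝ) (1 / 2)) :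
    CompatAt (rowLabel γ) z := by
  have e : (loc z).2 ≠ -1 / 2 := by
    simp only [loc, round_eq_zero h]
    have := h.1
    push_cast
    linarith
  refine ⟨fun h => e h.2, fun _ => ?_, fun h => absurd h e⟩
  simp only [rowLabel, Prod.fst_sub, mul_assoc, ← zpow_add_one, sub_add_cancel]

lemma compatAt_colLabel (γ : CubeIsom) {z : Plane} (h : z.1 ∈ Ioo (-1 / 2 : ℝ) (1 / 2)) :
    CompatAt (colLabel γ) z := by
  have e : (loc z).1 ≠ -1 / 2 := by
    simp only [loc, round_eq_zero h]
    have := h.1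
    push_cast
    linarith
  refine ⟨fun h => e h.1, fun h => absurd h e, fun _ => ?_⟩
  simp only [colLabel, Prod.snd_sub, mul_assoc, ← zpow_add_one, sub_add_cancel]

lemma det_rowLabel {γ : CubeIsom} (h : det γ = 1) (m : ℤ × ℤ) : det (rowLabel γ m) = 1 := by
  simp [rowLabel, h, CubeIsom.det_r]

lemma det_colLabel {γ : CubeIsom} (h : det γ = 1) (m : ℤ × ℤ) : det (colLabel γ m) = 1 := by
  simp [colLabel, h, CubeIsom.det_u]

/-- Every chart is given by a labelling. -/
lemma exists_labelling_of_mem_atlasM {φ : FlatChart M} (hφ : φ ∈ atlasM) :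
    ∃ L : Labelling, (∀ m, det (L m) = 1) ∧
      ∀ z ∈ φ.domain, CompatAt L z ∧ φ.map z = devM L z := by
  rcases hφ with ⟨c, a, c', a', b, hf, hf', hc, hd, hm⟩ | ⟨c, b, c', b', a, hf, hf', hc, hd, hm⟩
  · obtain ⟨γ, hγ, rfl, rfl, rfl⟩ := isFaceFrame_iff.1 hf
    obtain ⟨γ', hγ', rfl, rfl, hv⟩ := isFaceFrame_iff.1 hf'
    have e : γ' = γ * r := by
      refine eq_mul_r hγ hγ' hv.symm ?_
      rw [pos_eq, pos_eq γ']
      simp only [zero_smul, add_zero]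
      rw [hc, neg_div, neg_smul, sub_eq_add_neg]
    subst e
    refine ⟨rowLabel γ, det_rowLabel hγ, fun z hz => ?_⟩
    have hz' := hd ▸ hz
    refine ⟨compatAt_rowLabel γ hz'.2, Subtype.ext ?_⟩
    rw [hm z hz]
    change _ = dev _ _
    rw [dev_rowLabel hz', pos_eq γ z, pos_eq (γ * r) (z.1 - 1, z.2), ← hv]
  · obtain ⟨γ, hγ, rfl, rfl, rfl⟩ := isFaceFrame_iff.1 hf
    obtain ⟨γ', hγ', rfl, hv, rfl⟩ := isFaceFrame_iff.1 hf'
    have e : γ' = γ * u := by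
      refine eq_mul_u hγ hγ' hv.symm ?_
      rw [pos_eq, pos_eq γ']
      simp only [zero_smul, add_zero]
      rw [hc, neg_div, neg_smul, sub_eq_add_neg]
    subst e
    refine ⟨colLabel γ, det_colLabel hγ, fun z hz => ?_⟩
    have hz' := hd ▸ hz
    refine ⟨compatAt_colLabel γ hz'.1, Subtype.ext ?_⟩
    rw [hm z hz]
    change _ = dev _ _
    rw [dev_colLabel hz', pos_eq γ z, pos_eq (γ * u) (z.1, z.2 - 1), ← hv]

lemma rowChart_mem {γ : CubeIsom} (h : det γ = 1) :
    (⟨Ioo (-1 / 2 : ℝ) (3 / 2) ×ˢ Ioo (-1 / 2 : ℝ) (1 / 2), devM (rowLabel γ)⟩ : FlatChart M) ∈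
      atlasM := by
  have hv : vvec (γ * r) = vvec γ := by
    have h1 := pos_mul_r γ 0
    have h2 := pos_mul_r γ 1
    rw [pos_eq, pos_eq γ] at h1 h2
    simp only [zero_smul, add_zero, one_smul] at h1 h2
    rw [h1] at h2
    exact add_left_cancel h2
  refine Or.inl ⟨pos γ 0, hvec γ, pos (γ * r) 0, hvec (γ * r), vvec γ,
    isFaceFrame_iff.2 ⟨γ, h, rfl, rfl, rfl⟩,
    isFaceFrame_iff.2 ⟨γ * r, by simp [h, CubeIsom.det_r], rfl, rfl, hv.symm⟩, ?_, rfl, ?_⟩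
  · have h1 := pos_mul_r γ 0
    rw [pos_eq, pos_eq γ] at h1
    simp only [zero_smul, add_zero] at h1
    rw [← h1, neg_div, neg_smul, sub_eq_add_neg]
  · intro z hz
    change dev _ _ = _
    rw [dev_rowLabel hz, pos_eq γ z, pos_eq (γ * r) (z.1 - 1, z.2), hv]

lemma colChart_mem {γ : CubeIsom} (h : det γ = 1) :
    (⟨Ioo (-1 / 2 : ℝ) (1 / 2) ×ˢ Ioo (-1 / 2 : ℝ) (3 / 2), devM (colLabel γ)⟩ : FlatChart M) ∈
      atlasM := by
  have hv : hvec (γ * u) = hvec γ := by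
    have h1 := pos_mul_u γ 0
    have h2 := pos_mul_u γ 1
    rw [pos_eq, pos_eq γ] at h1 h2
    simp only [zero_smul, add_zero, one_smul] at h1 h2
    have h3 : ∀ a b c : R3, a + b + c = a + c + b := fun a b c => by abel
    rw [h3, h3 (pos γ 0), h1] at h2
    exact add_left_cancel h2
  refine Or.inr ⟨pos γ 0, vvec γ, pos (γ * u) 0, vvec (γ * u), hvec γ,
    isFaceFrame_iff.2 ⟨γ, h, rfl, rfl, rfl⟩,
    isFaceFrame_iff.2 ⟨γ * u, by simp [h, CubeIsom.det_u], rfl, hv.symm, rfl⟩, ?_, rfl, ?_⟩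
  · have h1 := pos_mul_u γ 0
    rw [pos_eq, pos_eq γ] at h1
    simp only [zero_smul, add_zero] at h1
    rw [← h1, neg_div, neg_smul, sub_eq_add_neg]
  · intro z hz
    change dev _ _ = _
    rw [dev_colLabel hz, pos_eq γ z, pos_eq (γ * u) (z.1, z.2 - 1), hv]

/-- Near a point of compatibility, a developing map is a chart. -/
lemma exists_chart {L : Labelling} (hL : ∀ m, det (L m) = 1) {z : Plane} (hz : CompatAt L z) :
    ∃ φ ∈ atlasM, ∃ n : ℤ × ℤ, ∀ᶠ z' in 𝓝 z,
      z' - ofInt n ∈ φ.domain ∧ devM L z' = φ.map (z' - ofInt n) := by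
  have hrd := eventually_rd hz.not_vertex
  have tr : ∀ n : ℤ × ℤ, Tendsto (fun z' : Plane => z' - ofInt n) (𝓝 z) (𝓝 (z - ofInt n)) :=
    fun n => Continuous.tendsto (by fun_prop) z
  have hopen : ∀ a b c d : ℝ, IsOpen (Ioo a b ×ˢ Ioo c d : Set Plane) :=
    fun a b c d => isOpen_Ioo.prod isOpen_Ioo
  have hdev : ∀ (L' : Labelling) (n : ℤ × ℤ) (z' : Plane), L (rd z') = L' (rd z' - n) →
      devM L z' = devM L' (z' - ofInt n) := by
    intro L' n z' h
    apply Subtype.ext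
    change dev L z' = dev L' (z' - ofInt n)
    unfold dev
    have e1 := rd_add_ofInt z' (-n)
    have e2 := loc_add_ofInt z' (-n)
    rw [ofInt_neg, ← sub_eq_add_neg] at e1 e2
    rw [e1, e2, ← sub_eq_add_neg, h]
  obtain ⟨l1, l2⟩ := loc_mem z
  have c1 : (loc z).1 = z.1 - (rd z).1 := rfl
  have c2 : (loc z).2 = z.2 - (rd z).2 := rfl
  -- A point on a vertical edge is covered by a horizontal domino starting one square to the left, a
  -- point on a horizontal edge by a vertical domino starting one square below. In the interior of a
  -- square a horizontal domino is used.
  by_cases h1 : (loc z).1 = -1 / 2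
  · have h2 : (loc z).2 ≠ -1 / 2 := fun h2 => hz.not_vertex ⟨h1, h2⟩
    have h3 := lt_of_le_of_ne l2.1 (Ne.symm h2)
    refine ⟨_, rowChart_mem (hL (rd z - (1, 0))), rd z - (1, 0), ?_⟩
    have hdom : z - ofInt (rd z - (1, 0)) ∈
        Ioo (-1 / 2 : ℝ) (3 / 2) ×ˢ Ioo (-1 / 2 : ℝ) (1 / 2) := by
      simp only [ofInt, mem_prod, mem_Ioo, Prod.fst_sub, Prod.snd_sub]
      push_cast
      refine ⟨⟨?_, ?_⟩, ?_, ?_⟩ <;> linarith [l2.2]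
    filter_upwards [hrd, (tr _).eventually ((hopen _ _ _ _).mem_nhds hdom)] with z' e hmem
    refine ⟨hmem, hdev _ _ _ ?_⟩
    rcases e with e | ⟨-, e⟩ | ⟨e, -⟩
    · rw [e, hz.right h1]; simp [rowLabel]
    · rw [e]; simp [rowLabel]
    · exact absurd e h2
  · have h1' := lt_of_le_of_ne l1.1 (Ne.symm h1)
    by_cases h2 : (loc z).2 = -1 / 2
    · refine ⟨_, colChart_mem (hL (rd z - (0, 1))), rd z - (0, 1), ?_⟩
      have hdom : z - ofInt (rd z - (0, 1)) ∈
          Ioo (-1 / 2 : ℝ) (1 / 2) ×ˢ Ioo (-1 / 2 : ℝ) (3 / 2) := by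
        simp only [ofInt, mem_prod, mem_Ioo, Prod.fst_sub, Prod.snd_sub]
        push_cast
        refine ⟨⟨?_, ?_⟩, ?_, ?_⟩ <;> linarith [l1.2]
      filter_upwards [hrd, (tr _).eventually ((hopen _ _ _ _).mem_nhds hdom)] with z' e hmem
      refine ⟨hmem, hdev _ _ _ ?_⟩
      rcases e with e | ⟨e, -⟩ | ⟨-, e⟩
      · rw [e, hz.up h2]; simp [colLabel]
      · exact absurd e h1
      · rw [e]; simp [colLabel]
    · have h2' := lt_of_le_of_ne l2.1 (Ne.symm h2)
      refine ⟨_, rowChart_mem (hL (rd z)), rd z, ?_⟩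
      have hdom : z - ofInt (rd z) ∈ Ioo (-1 / 2 : ℝ) (3 / 2) ×ˢ Ioo (-1 / 2 : ℝ) (1 / 2) := by
        simp only [ofInt, mem_prod, mem_Ioo, Prod.fst_sub, Prod.snd_sub]
        refine ⟨⟨?_, ?_⟩, ?_, ?_⟩ <;> linarith [l2.2, l1.2]
      filter_upwards [hrd, (tr _).eventually ((hopen _ _ _ _).mem_nhds hdom)] with z' e hmem
      refine ⟨hmem, hdev _ _ _ ?_⟩
      rcases e with e | ⟨e, -⟩ | ⟨e, -⟩
      · rw [e]; simp [rowLabel]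
      · exact absurd e h1
      · exact absurd e h2

end Mucube

namespace Mucube

open CubeIsom (r u j det deck)

/-! ### Deck transformations -/

lemma toX_eq_toX {p p' : M} : toX p = toX p' ↔ ∃ t : Fin 3 → ℤ, t +ᵥ p' = p :=
  Quotient.eq''.trans Iff.rfl

lemma rotX_toX (p : M) : rotX (toX p) = toX (rotM p) := rfl

lemma rotX_inv_toX (p : M) : rotX⁻¹ (toX p) = toX (rotM (rotM p)) := rfl

lemma toY_eq_toY_iff_rotX {p p' : M} : toY p = toY p' ↔ ∃ k : ℤ, (rotX ^ k) (toX p') = toX p := by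
  refine (Quotient.eq''.trans Iff.rfl).trans ?_
  constructor
  · rintro ⟨⟨_, k, rfl⟩, h⟩
    exact ⟨k, h⟩
  · rintro ⟨k, h⟩
    exact ⟨⟨_, k, rfl⟩, h⟩

/-- The rotation as a motion. -/
def rotIsom : CubeIsom := ⟨(finRotate 3)⁻¹, 1, 0⟩

/-- A translation as a motion. -/
def translIsom (t : Fin 3 → ℤ) : CubeIsom := ⟨1, 1, t⟩

lemma rotIsom_mem : rotIsom ∈ deck := by
  refine ⟨rfl, ?_⟩
  decide

lemma translIsom_mem (t : Fin 3 → ℤ) : translIsom t ∈ deck := ⟨rfl, by simp [translIsom]⟩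

lemma coe_rotM (p : M) : (rotM p).1 = act rotIsom p.1 := by
  have h : ∀ i, rotIsom.perm i = ![2, 0, 1] i := by decide
  funext i
  rw [act_apply, h]
  fin_cases i <;> simp [rotIsom, rotM]

lemma coe_vadd (t : Fin 3 → ℤ) (p : M) : (t +ᵥ p).1 = act (translIsom t) p.1 := by
  funext i
  rw [act_apply, coe_vadd_apply]
  simp [translIsom]

/-- The two successive quotients amount to one quotient by `deck`, because every deck motion is a
power of the rotation followed by a translation. -/
lemma toY_eq_toY {p p' : M} : toY p = toY p' ↔ ∃ δ ∈ deck, p'.1 = act δ p.1 := by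
  constructor
  · intro h
    obtain ⟨k, hk⟩ := toY_eq_toY_iff_rotX.1 h.symm
    have key : ∀ k : ℤ, ∃ δ ∈ deck, ∃ q : M, q.1 = act δ p.1 ∧ (rotX ^ k) (toX p) = toX q := by
      intro k
      induction k using Int.induction_on with
      | zero => exact ⟨1, deck.one_mem, p, by simp, rfl⟩
      | succ k ih =>
        obtain ⟨δ, hδ, q, h1, h2⟩ := ih
        refine ⟨rotIsom * δ, deck.mul_mem rotIsom_mem hδ, rotM q, ?_, ?_⟩
        · rw [coe_rotM, h1, act_mul]
        · rw [add_comm, zpow_add, zpow_one, Equiv.Perm.mul_apply, h2, rotX_toX]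
      | pred k ih =>
        obtain ⟨δ, hδ, q, h1, h2⟩ := ih
        refine ⟨rotIsom * (rotIsom * δ), deck.mul_mem rotIsom_mem (deck.mul_mem rotIsom_mem hδ),
          rotM (rotM q), ?_, ?_⟩
        · rw [coe_rotM, coe_rotM, h1, act_mul, act_mul]
        · rw [sub_eq_neg_add, zpow_add, zpow_neg_one, Equiv.Perm.mul_apply, h2, rotX_inv_toX]
    obtain ⟨δ, hδ, q, h1, h2⟩ := key k
    obtain ⟨t, ht⟩ := toX_eq_toX.1 (hk.symm.trans h2)
    refine ⟨translIsom t * δ, deck.mul_mem (translIsom_mem t) hδ, ?_⟩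
    rw [act_mul, ← h1, ← coe_vadd, ht]
  · rintro ⟨⟨σ, ε, t⟩, ⟨hε, hσ⟩, h⟩
    simp only at hε hσ
    subst hε
    rw [eq_comm, toY_eq_toY_iff_rotX]
    have hk : ∃ k : ℕ, ∀ i, (rotIsom ^ k).perm i = σ i := by
      have key : ∀ σ : Equiv.Perm (Fin 3), Equiv.Perm.sign σ = 1 →
          ∃ k ∈ Finset.range 3, ∀ i, (rotIsom ^ k).perm i = σ i := by decide
      obtain ⟨k, -, hk⟩ := key σ hσ
      exact ⟨k, hk⟩
    obtain ⟨k, hk⟩ := hk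
    have h2 : ∀ k : ℕ, ∃ q : M, q.1 = act (rotIsom ^ k) p.1 ∧ (rotX ^ (k : ℤ)) (toX p) = toX q := by
      intro k
      induction k with
      | zero => exact ⟨p, by simp, rfl⟩
      | succ k ih =>
        obtain ⟨q, h1, h2⟩ := ih
        refine ⟨rotM q, by rw [coe_rotM, h1, ← act_mul, pow_succ'], ?_⟩
        push_cast
        rw [add_comm, zpow_add, zpow_one, Equiv.Perm.mul_apply, h2, rotX_toX]
    obtain ⟨q, h3, h4⟩ := h2 k
    refine ⟨k, h4.trans (toX_eq_toX.2 ⟨-t, ?_⟩)⟩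
    have hs : ∀ k : ℕ, (rotIsom ^ k).sgn = 1 ∧ (rotIsom ^ k).trans = 0 := by
      intro k
      induction k with
      | zero => exact ⟨rfl, rfl⟩
      | succ k ih =>
        rw [pow_succ']
        constructor
        · funext i; rw [CubeIsom.mul_sgn, ih.1]; simp [rotIsom]
        · funext i; rw [CubeIsom.mul_trans, ih.2]; simp [rotIsom]
    apply Subtype.ext
    rw [coe_vadd, h, h3]
    funext i
    simp [act_apply, translIsom, hs, hk]

/-! ### Trajectories and cylinders are developed in the plane -/

lemma eq_of_locally_eq {E β : Type*} [TopologicalSpace E] {C : Set E} (hC : IsPreconnected C)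
    {f : E → β} (h : ∀ t ∈ C, ∀ᶠ t' in 𝓝[C] t, f t' = f t) {t t' : E} (ht : t ∈ C)
    (ht' : t' ∈ C) : f t = f t' := by
  have : PreconnectedSpace C := isPreconnected_iff_preconnectedSpace.1 hC
  have hl : IsLocallyConstant (fun x : C => f x) := by
    rw [IsLocallyConstant.iff_eventually_eq]
    intro x
    rw [nhds_subtype_eq_comap_nhdsWithin]
    exact (h x x.2).comap _
  exact hl.apply_eq_of_preconnectedSpace ⟨t, ht⟩ ⟨t', ht'⟩

section Develop

variable {E : Type*} [NormedAddCommGroup E] [NormedSpace ℝ E]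

/-- The expression varies continuously and not constantly along `e`, so it cannot stay integral.
This rules out the half-turn alternative of `dev_eq_dev` whenever two developments agree near a
point. -/
lemma not_eventually_int {ℓ : E →L[ℝ] Plane} {e : E} (he : ℓ e ≠ 0) (a : Plane) (t : E) :
    ¬ ∀ᶠ w in 𝓝 t, ∃ n, a + (2 : ℝ) • ℓ w = ofInt n := by
  intro h
  have key : ∀ f : Plane →ₗ[ℝ] ℝ, (∀ n, ∃ m : ℤ, f (ofInt n) = m) → f (ℓ e) = 0 := by
    intro f hf
    by_contra hne
    have h1 : Tendsto (fun τ : ℝ => t + τ • e) (𝓝 0) (𝓝 t) := by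
      have : Continuous (fun τ : ℝ => t + τ • e) := by fun_prop
      simpa using this.tendsto 0
    have h2 : Tendsto (fun τ : ℝ => 2 * τ * f (ℓ e)) (𝓝 0) (𝓝 0) := by
      have : Continuous (fun τ : ℝ => 2 * τ * f (ℓ e)) := by fun_prop
      simpa using this.tendsto 0
    have h3 : ∀ᶠ τ in 𝓝[≠] (0 : ℝ), (∃ n, a + (2 : ℝ) • ℓ (t + τ • e) = ofInt n) ∧
        2 * τ * f (ℓ e) ∈ Ioo (-1 : ℝ) 1 :=
      ((h1.eventually h).and (h2.eventually (Ioo_mem_nhds (by norm_num) (by norm_num)))).filter_mono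
        nhdsWithin_le_nhds
    obtain ⟨τ, ⟨⟨n, hn⟩, hlt⟩, hτ⟩ := (h3.and self_mem_nhdsWithin).exists
    obtain ⟨n', hn'⟩ := h.self_of_nhds
    obtain ⟨m, hm⟩ := hf n
    obtain ⟨m', hm'⟩ := hf n'
    have e1 := congrArg f hn
    have e2 := congrArg f hn'
    rw [hm] at e1
    rw [hm'] at e2
    simp only [map_add, map_smul, smul_eq_mul] at e1 e2
    have e3 : 2 * τ * f (ℓ e) = ((m - m' : ℤ) : ℝ) := by push_cast; linarith
    rw [e3] at hlt
    have h4 : m - m' = 0 := int_eq_of_lt (by push_cast; push_cast at hlt; linarith [hlt.1])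
      (by push_cast; push_cast at hlt; linarith [hlt.2])
    rw [h4, Int.cast_zero] at e3
    exact hτ (by simpa [hne] using e3)
  exact he (Prod.ext (key (LinearMap.fst ℝ ℝ ℝ) fun n => ⟨n.1, rfl⟩)
    (key (LinearMap.snd ℝ ℝ ℝ) fun n => ⟨n.2, rfl⟩))

variable {S : Type*} {π : M → S} {D : Subgroup CubeIsom}

/-- The data of a space below the Mucube, with its deck group. -/
structure IsDeckQuotient (π : M → S) (D : Subgroup CubeIsom) : Prop where
  eq_iff : ∀ p p' : M, π p = π p' ↔ ∃ δ ∈ D, p'.1 = act δ p.1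
  det_eq : ∀ δ ∈ D, det δ = 1

lemma isDeckQuotient_id : IsDeckQuotient (fun p : M => p) ⊥ := by
  refine ⟨fun p p' => ⟨?_, ?_⟩, ?_⟩
  · rintro rfl
    exact ⟨1, Subgroup.one_mem _, by simp⟩
  · rintro ⟨δ, hδ, h⟩
    rw [Subgroup.mem_bot.1 hδ, act_one] at h
    exact Subtype.ext h.symm
  · intro δ hδ
    rw [Subgroup.mem_bot.1 hδ, map_one]

lemma isDeckQuotient_toY : IsDeckQuotient toY deck :=
  ⟨fun _ _ => toY_eq_toY, fun _ => CubeIsom.det_of_mem_deck⟩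

lemma IsDeckQuotient.eq_of_act (hπ : IsDeckQuotient π D) {δ : CubeIsom} (hδ : δ ∈ D)
    {L L' : Labelling} {z : Plane} (h : L' (rd z) = δ * L (rd z)) :
    π (devM L' z) = π (devM L z) := by
  symm
  rw [hπ.eq_iff]
  refine ⟨δ, hδ, ?_⟩
  change dev L' z = act δ (dev L z)
  unfold dev
  rw [act_pos, h]

/-- A map from a connected set that is given by charts in affine coordinates is given by labelled
developing maps in one global affine coordinate. -/
lemma exists_global_coord (hπ : IsDeckQuotient π D) {ℓ : E →L[ℝ] Plane} {e : E} (he : ℓ e ≠ 0)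
    {C : Set E} (hC : IsPreconnected C) {c : E → S}
    (hc : ∀ t ∈ C, ∃ φ ∈ atlasM, ∃ z : Plane, ∀ᶠ w in 𝓝 t,
      z + ℓ w ∈ φ.domain ∧ c w = π (φ.map (z + ℓ w))) :
    ∃ z₀ : Plane, ∀ n, ∀ t ∈ C, ∃ L : Labelling, (∀ m, det (L m) = 1) ∧ ∀ᶠ w in 𝓝 t,
      CompatAt L (z₀ + ofInt n + ℓ w) ∧ c w = π (devM L (z₀ + ofInt n + ℓ w)) := by
  have hloc : ∀ t : E, ∃ (z : Plane) (L : Labelling), t ∈ C → (∀ m, det (L m) = 1) ∧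
      ∀ᶠ w in 𝓝 t, CompatAt L (z + ℓ w) ∧ c w = π (devM L (z + ℓ w)) := by
    intro t
    by_cases ht : t ∈ C
    · obtain ⟨φ, hφ, z, hz⟩ := hc t ht
      obtain ⟨L, hL, hφL⟩ := exists_labelling_of_mem_atlasM hφ
      refine ⟨z, L, fun _ => ⟨hL, ?_⟩⟩
      filter_upwards [hz] with w hw
      exact ⟨(hφL _ hw.1).1, by rw [hw.2, (hφL _ hw.1).2]⟩
    · exact ⟨0, fun _ => 1, fun h => absurd h ht⟩
  choose z L hL using hloc
  -- Local coordinates at nearby points differ by an integral translation, so their class modulo the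
  -- integral vectors is locally constant, hence constant on `C`.
  have hconst : ∀ t ∈ C, ∀ᶠ t' in 𝓝[C] t,
      {x | ∃ n, x = z t' + ofInt n} = {x | ∃ n, x = z t + ofInt n} := by
    intro t ht
    filter_upwards [nhdsWithin_le_nhds (hL t ht).2.eventually_nhds, self_mem_nhdsWithin]
      with t' h1 ht'
    have key : ∃ n, z t' = z t + ofInt n := by
      by_contra hcon
      apply not_eventually_int he (z t + z t') t'
      filter_upwards [h1, (hL t' ht').2] with w hw hw'
      obtain ⟨δ, hδ, hact⟩ := (hπ.eq_iff _ _).1 (hw.2.symm.trans hw'.2)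
      rcases dev_eq_dev (hL t ht).1 (hL t' ht').1 (hπ.det_eq δ hδ) hw.1 hw'.1 hact.symm with
        ⟨n, hn, -⟩ | ⟨n, hn, -⟩
      · exact absurd ⟨n, by linear_combination (exp := 1) hn⟩ hcon
      · exact ⟨n, by linear_combination (exp := 1) hn + two_smul ℝ (ℓ w)⟩
    obtain ⟨n, hn⟩ := key
    ext x
    constructor
    · rintro ⟨m, rfl⟩
      exact ⟨n + m, by rw [hn, ofInt_add]; abel⟩
    · rintro ⟨m, rfl⟩
      exact ⟨m - n, by rw [hn, ofInt_sub]; abel⟩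
  rcases C.eq_empty_or_nonempty with rfl | ⟨t₀, ht₀⟩
  · exact ⟨0, fun _ _ h => absurd h (notMem_empty _)⟩
  refine ⟨z t₀, fun n t ht => ?_⟩
  have h1 := eq_of_locally_eq hC hconst ht₀ ht
  have h2 : z t ∈ {x | ∃ n, x = z t₀ + ofInt n} := by
    rw [h1]; exact ⟨0, by simp [ofInt]⟩
  obtain ⟨m, hm⟩ := h2
  refine ⟨(L t).shift (m - n), fun k => (hL t ht).1 _, ?_⟩
  filter_upwards [(hL t ht).2] with w hw
  have e1 : z t₀ + ofInt n + ℓ w + ofInt (m - n) = z t + ℓ w := by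
    rw [hm, ofInt_sub]; abel
  refine ⟨compatAt_shift.2 (by rw [e1]; exact hw.1), ?_⟩
  rw [hw.2]
  congr 1
  apply Subtype.ext
  change dev _ _ = dev _ _
  rw [dev_shift, e1]

/-- If a labelling is compatible along the image of a map as in `exists_global_coord`, then the
map is given by this labelling up to a motion. -/
lemma exists_global_label (hπ : IsDeckQuotient π D) {ℓ : E →L[ℝ] Plane} {e : E} (he : ℓ e ≠ 0)
    {C : Set E} (hC : IsPreconnected C) {c : E → S} {z₀ : Plane}
    (hc : ∀ t ∈ C, ∃ L : Labelling, (∀ m, det (L m) = 1) ∧ ∀ᶠ w in 𝓝 t,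
      CompatAt L (z₀ + ℓ w) ∧ c w = π (devM L (z₀ + ℓ w)))
    {Λ : Labelling} (hΛ : ∀ m, det (Λ m) = 1) (hcomp : ∀ t ∈ C, CompatAt Λ (z₀ + ℓ t)) :
    ∃ g, det g = 1 ∧ ∀ t ∈ C, c t = π (devM (Λ.mul g) (z₀ + ℓ t)) := by
  have hloc : ∀ t : E, ∃ (L : Labelling) (g : CubeIsom), t ∈ C → (∀ m, det (L m) = 1) ∧
      det g = 1 ∧ ∀ᶠ w in 𝓝 t, CompatAt L (z₀ + ℓ w) ∧ c w = π (devM L (z₀ + ℓ w)) ∧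
        L (rd (z₀ + ℓ w)) = g * Λ (rd (z₀ + ℓ w)) := by
    intro t
    by_cases ht : t ∈ C
    · obtain ⟨L, hL, hev⟩ := hc t ht
      refine ⟨L, L (rd (z₀ + ℓ t)) * (Λ (rd (z₀ + ℓ t)))⁻¹, fun _ => ⟨hL, by simp [hL, hΛ], ?_⟩⟩
      have hcont : Tendsto (fun w => z₀ + ℓ w) (𝓝 t) (𝓝 (z₀ + ℓ t)) :=
        (show Continuous (fun w => z₀ + ℓ w) by fun_prop).tendsto t
      filter_upwards [hev, hcont.eventually ((hcomp t ht).eventually_label_eq hev.self_of_nhds.1)]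
        with w hw hw'
      exact ⟨hw.1, hw.2, by rw [← hw', inv_mul_cancel_right]⟩
    · exact ⟨fun _ => 1, 1, fun h => absurd h ht⟩
  choose L g hL using hloc
  -- The motion `g t` is determined only up to deck motions; its coset is locally constant.
  have hconst : ∀ t ∈ C, ∀ᶠ t' in 𝓝[C] t,
      {x | ∃ δ ∈ D, x = δ * g t'} = {x | ∃ δ ∈ D, x = δ * g t} := by
    intro t ht
    filter_upwards [nhdsWithin_le_nhds (hL t ht).2.2.eventually_nhds, self_mem_nhdsWithin]
      with t' h1 ht'
    have key : ∃ δ ∈ D, g t' = δ * g t := by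
      by_contra hcon
      apply not_eventually_int he ((2 : ℝ) • z₀) t'
      filter_upwards [h1, (hL t' ht').2.2] with w hw hw'
      obtain ⟨δ, hδ, hact⟩ := (hπ.eq_iff _ _).1 (hw.2.1.symm.trans hw'.2.1)
      rcases dev_eq_dev (hL t ht).1 (hL t' ht').1 (hπ.det_eq δ hδ) hw.1 hw'.1 hact.symm with
        ⟨n, -, hn⟩ | ⟨n, hn, -⟩
      · rw [hw.2.2, hw'.2.2, ← mul_assoc] at hn
        exact absurd ⟨δ, hδ, mul_right_cancel hn⟩ hcon
      · refine ⟨n, ?_⟩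
        rw [← smul_add, two_smul]
        exact eq_sub_iff_add_eq.1 hn
    obtain ⟨δ, hδ, hg⟩ := key
    ext x
    constructor
    · rintro ⟨ε, hε, rfl⟩
      exact ⟨ε * δ, D.mul_mem hε hδ, by rw [hg, mul_assoc]⟩
    · rintro ⟨ε, hε, rfl⟩
      exact ⟨ε * δ⁻¹, D.mul_mem hε (D.inv_mem hδ), by rw [hg]; group⟩
  rcases C.eq_empty_or_nonempty with rfl | ⟨t₀, ht₀⟩
  · exact ⟨1, map_one _, fun _ h => absurd h (notMem_empty _)⟩
  refine ⟨g t₀, (hL t₀ ht₀).2.1, fun t ht => ?_⟩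
  have h1 := eq_of_locally_eq hC hconst ht₀ ht
  have h2 : g t ∈ {x | ∃ δ ∈ D, x = δ * g t₀} := by
    rw [h1]; exact ⟨1, D.one_mem, by simp⟩
  obtain ⟨δ, hδ, hg⟩ := h2
  obtain ⟨h3, h4, h5⟩ := (hL t ht).2.2.self_of_nhds
  rw [h4]
  refine hπ.eq_of_act hδ ?_
  rw [h5, hg, Labelling.mul, mul_assoc]

/-- Two labellings that are compatible along a connected set differ by a motion. -/
lemma exists_mul_eq {C : Set Plane} (hC : IsPreconnected C) {L L' : Labelling}
    (h : ∀ z ∈ C, CompatAt L z) (h' : ∀ z ∈ C, CompatAt L' z) :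
    ∃ g, ∀ z ∈ C, L' (rd z) = g * L (rd z) := by
  rcases C.eq_empty_or_nonempty with rfl | ⟨z₀, hz₀⟩
  · exact ⟨1, fun _ h => absurd h (notMem_empty _)⟩
  refine ⟨L' (rd z₀) * (L (rd z₀))⁻¹, fun z hz => ?_⟩
  have := eq_of_locally_eq hC (f := fun z => L' (rd z) * (L (rd z))⁻¹)
    (fun t ht => nhdsWithin_le_nhds ((h t ht).eventually_label_eq (h' t ht))) hz₀ hz
  rw [this, inv_mul_cancel_right]

end Develop

end Mucube

namespace Mucube

open CubeIsom (r u j det deck lin)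

/-! ### Strips of rational slope -/

/-- A strip in the direction of `(p, q)` between consecutive lines through vertices. -/
def strip (p q : ℤ) : Set Plane :=
  {z | ((p : ℝ) - q) / 2 < p * z.2 - q * z.1 ∧ p * z.2 - q * z.1 < ((p : ℝ) - q) / 2 + 1}

lemma isPreconnected_strip (p q : ℤ) : IsPreconnected (strip p q) := by
  apply Convex.isPreconnected
  have h : strip p q = (fun z : Plane => (p : ℝ) * z.2 - q * z.1) ⁻¹'
      Ioo (((p : ℝ) - q) / 2) (((p : ℝ) - q) / 2 + 1) := rfl
  rw [h]
  apply (convex_Ioo _ _).is_linear_preimage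
  constructor
  · intro x y; simp; ring
  · intro a x; simp; ring

/-- Vertices have both coordinates in `ℤ + 1/2`, so there `p y - q x` lies in `(p - q) / 2 + ℤ`,
which misses the open interval defining the strip. -/
lemma not_vertex_of_mem_strip {p q : ℤ} {z : Plane} (hz : z ∈ strip p q) :
    ¬ ((loc z).1 = -1 / 2 ∧ (loc z).2 = -1 / 2) := by
  rintro ⟨h1, h2⟩
  simp only [loc] at h1 h2
  obtain ⟨h3, h4⟩ := hz
  have e1 : z.1 = round z.1 - 1 / 2 := by linarith
  have e2 : z.2 = round z.2 - 1 / 2 := by linarith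
  rw [e1, e2] at h3 h4
  have h5 : (0 : ℝ) < ((p * round z.2 - q * round z.1 - (p - q) : ℤ) : ℝ) := by
    push_cast; linarith
  have h6 : ((p * round z.2 - q * round z.1 - (p - q) : ℤ) : ℝ) < 1 := by
    push_cast; linarith
  have h5 := Int.cast_pos.1 h5
  have h6 : p * round z.2 - q * round z.1 - (p - q) < 1 := by exact_mod_cast h6
  omega

lemma add_zsmul_mem_strip {p q : ℤ} {z : Plane} (k : ℤ) :
    z + ofInt (k • (p, q)) ∈ strip p q ↔ z ∈ strip p q := by
  have e : (p : ℝ) * (z + ofInt (k • (p, q))).2 - q * (z + ofInt (k • (p, q))).1 =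
      p * z.2 - q * z.1 := by
    simp [ofInt]; ring
  unfold strip
  rw [mem_ofPred_eq, mem_ofPred_eq, e]

lemma exists_int_seq {G : Type*} [Group G] (g : ℤ → G) :
    ∃ h : ℤ → G, h 0 = 1 ∧ ∀ i, h (i + 1) = h i * g i := by
  let f : ℕ → G := fun n => Nat.rec 1 (fun n x => x * g n) n
  let b : ℕ → G := fun n => Nat.rec 1 (fun n x => x * (g (-((n : ℤ) + 1)))⁻¹) n
  refine ⟨fun i => match i with
    | Int.ofNat n => f n
    | Int.negSucc n => b (n + 1), rfl, fun i => ?_⟩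
  rcases i with n | n
  · rfl
  · rcases n with _ | n
    · change (1 : G) = 1 * (g (-(((0 : ℕ) : ℤ) + 1)))⁻¹ * g (Int.negSucc 0)
      simp
    · have e : (Int.negSucc (n + 1) + 1 : ℤ) = Int.negSucc n := by omega
      have e2 : (Int.negSucc (n + 1) : ℤ) = -(((n + 1 : ℕ) : ℤ) + 1) := by omega
      rw [e]
      change b (n + 1) = b (n + 1) * (g (-(((n + 1 : ℕ) : ℤ) + 1)))⁻¹ * g (Int.negSucc (n + 1))
      rw [← e2, inv_mul_cancel_right]

/-- The labelling that is read off row by row, given the columns in which the rows are entered. -/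
lemma exists_rows (K : ℤ → ℤ) : ∃ (L : Labelling) (h : ℤ → CubeIsom), h 0 = 1 ∧
    (∀ m, det (L m) = 1) ∧ (∀ m, L m = h m.2 * r ^ (m.1 - K m.2)) ∧
    (∀ i, h (i + 1) = h i * r ^ (K (i + 1) - K i) * u) ∧
    ∀ z : Plane, ¬ ((loc z).1 = -1 / 2 ∧ (loc z).2 = -1 / 2) →
      ((loc z).2 = -1 / 2 → (rd z).1 = K (rd z).2) → CompatAt L z := by
  obtain ⟨h, h0, hh⟩ := exists_int_seq (fun i => r ^ (K (i + 1) - K i) * u)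
  have hdet : ∀ i, det (h i) = 1 := by
    intro i
    induction i using Int.induction_on with
    | zero => rw [h0, map_one]
    | succ k ih => rw [hh]; simp [ih, CubeIsom.det_r, CubeIsom.det_u]
    | pred k ih =>
      have := hh (-k - 1)
      rw [sub_add_cancel] at this
      rw [this] at ih
      simpa [CubeIsom.det_r, CubeIsom.det_u] using ih
  refine ⟨fun m => h m.2 * r ^ (m.1 - K m.2), h, h0, fun m => by simp [hdet, CubeIsom.det_r],
    fun m => rfl, fun i => by rw [hh, mul_assoc], fun z hz hK => ⟨hz, fun _ => ?_, fun h2 => ?_⟩⟩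
  · simp only [Prod.fst_sub, Prod.snd_sub, sub_zero, mul_assoc, ← zpow_add_one]
    congr 2
    ring
  · have e := hh ((rd z).2 - 1)
    rw [sub_add_cancel] at e
    simp only [Prod.fst_sub, Prod.snd_sub, sub_zero, hK h2, sub_self, zpow_zero, mul_one]
    rw [e, mul_assoc]

/-- A compatible labelling of a strip and its holonomy. -/
structure StripLabelling (p q : ℤ) where
  label : Labelling
  hol : CubeIsom
  det_label : ∀ m, det (label m) = 1
  compat : ∀ z ∈ strip p q, CompatAt label z
  label_add : ∀ m, label (m + (p, q)) = hol * label m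
  quarter_turn : ∀ n : ℕ, 0 < n → hol ^ n = 1 → lin hol ^ 4 = 1 ∧ lin hol ^ 2 ≠ 1
  rows : (q = 0 ∧ hol ^ 4 = 1) ∨ (0 < q ∧ ∃ h : ℤ → CubeIsom,
    (∀ m, ∃ x : ℤ, label m = h m.2 * r ^ x) ∧ (∀ i, ∃ x : ℤ, h (i + 1) = h i * r ^ x * u) ∧
    ∀ i, h (i + q) = hol * h i)

lemma exists_stripLabelling {p q : ℤ} (hpq : IsCoprime p q) (hq : 0 < q ∨ (q = 0 ∧ p = 1)) :
    Nonempty (StripLabelling p q) := by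
  rcases hq with hq | ⟨rfl, rfl⟩
  -- `K i` is the column in which the strip crosses the lower edge of row `i`. On `y = i - 1/2` the
  -- values of `q x` fill the open interval from `p i - p + q / 2 - 1` to `p i - p + q / 2`, which
  -- stays inside one column.
  · set K : ℤ → ℤ := fun i => (p * i + (q - p - 1)) / q with hK
    obtain ⟨L, h, h0, hdet, hL, hh, hcomp⟩ := exists_rows K
    have hKper : ∀ i, K (i + q) = K i + p := by
      intro i
      have e : p * (i + q) + (q - p - 1) = p * i + (q - p - 1) + p * q := by ring
      simp only [hK, e]
      exact Int.add_mul_ediv_right _ _ hq.ne'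
    have hw : ∀ i, h (i + q) = h q * h i := by
      intro i
      induction i using Int.induction_on with
      | zero => rw [zero_add, h0, mul_one]
      | succ k ih =>
        have e : (k : ℤ) + 1 + q = k + q + 1 := by ring
        have e2 : (k : ℤ) + q + 1 = k + 1 + q := by ring
        rw [e, hh, hh, ih, e2, hKper, hKper, add_sub_add_right_eq_sub]
        simp only [mul_assoc]
      | pred k ih =>
        have e1 := hh (-k - 1)
        have e2 := hh (-k - 1 + q)
        have e : -(k : ℤ) - 1 + q + 1 = -k + q := by ring
        have e' : -(k : ℤ) + q = -k - 1 + 1 + q := by ring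
        rw [e, ih, e', hKper, hKper, add_sub_add_right_eq_sub] at e2
        rw [sub_add_cancel] at e1 e2
        rw [e1] at e2
        simp only [← mul_assoc] at e2
        exact (mul_right_cancel (mul_right_cancel e2)).symm
    obtain ⟨q', rfl⟩ := Int.eq_ofNat_of_zero_le hq.le
    refine ⟨⟨L, h q', hdet, fun z hz => hcomp z (not_vertex_of_mem_strip hz) fun h2 => ?_, ?_, ?_,
      Or.inr ⟨hq, h, fun m => ⟨_, hL m⟩, fun i => ⟨_, hh i⟩, hw⟩⟩⟩
    · simp only [loc] at h2
      have e2 : z.2 = round z.2 - 1 / 2 := by linarith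
      obtain ⟨h3, h4⟩ := hz
      obtain ⟨⟨h5, h6⟩, -⟩ := loc_mem z
      simp only [loc] at h5 h6
      rw [e2] at h3 h4
      have hq' : (0 : ℝ) < (q' : ℤ) := by exact_mod_cast hq
      have h7 : ((q' : ℤ) : ℝ) * round z.1 < p * round z.2 - p + (q' : ℤ) := by nlinarith
      have h8 : (p : ℝ) * round z.2 - p + (q' : ℤ) - 1 < (q' : ℤ) * (round z.1 + 1) := by nlinarith
      have h7 : (q' : ℤ) * round z.1 < p * round z.2 - p + q' := by exact_mod_cast h7
      have h8 : p * round z.2 - p + q' - 1 < (q' : ℤ) * (round z.1 + 1) := by exact_mod_cast h8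
      simp only [rd, hK]
      symm
      rw [Int.ediv_eq_iff_of_pos hq]
      constructor <;> nlinarith
    · intro m
      simp only [hL, Prod.fst_add, Prod.snd_add, hw, hKper, add_sub_add_right_eq_sub, mul_assoc]
    · intro n hn hwn
      exact CubeIsom.quarter_turn_of_holonomy (by exact_mod_cast hq) hpq hh hw hn hwn
  -- A horizontal strip is a single row of squares, with holonomy `r` of order four.
  · refine ⟨⟨fun m => r ^ m.1, r, fun m => by simp [CubeIsom.det_r], fun z hz =>
      ⟨not_vertex_of_mem_strip hz, fun _ => ?_, fun h2 => ?_⟩, ?_, ?_,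
      Or.inl ⟨rfl, CubeIsom.r_pow_four⟩⟩⟩
    · simp [← zpow_add_one]
    · exfalso
      obtain ⟨h3, h4⟩ := hz
      simp only [loc] at h2
      push_cast at h3 h4
      have h5 : (1 : ℝ) < round z.2 := by linarith
      have h6 : (round z.2 : ℝ) < 2 := by linarith
      have h5 : 1 < round z.2 := by exact_mod_cast h5
      have h6 : round z.2 < 2 := by exact_mod_cast h6
      omega
    · intro m
      rw [Prod.fst_add, add_comm, zpow_add, zpow_one]
    · intro n hn _
      decide

namespace StripLabelling

variable {p q : ℤ} (Λ : StripLabelling p q)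

lemma det_hol : det Λ.hol = 1 := by
  have := congrArg det (Λ.label_add 0)
  rw [map_mul, Λ.det_label, Λ.det_label, mul_one] at this
  exact this.symm

lemma label_add_zsmul (k : ℤ) (m : ℤ × ℤ) :
    Λ.label (m + k • (p, q)) = Λ.hol ^ k * Λ.label m := by
  induction k using Int.induction_on generalizing m with
  | zero => simp
  | succ k ih =>
    rw [add_smul, one_smul, ← add_assoc, Λ.label_add, ih, ← mul_assoc, ← zpow_one_add, add_comm]
  | pred k ih =>
    have := Λ.label_add (m + (-(k : ℤ) - 1) • (p, q))
    have e : m + (-(k : ℤ) - 1) • (p, q) + (p, q) = m + (-(k : ℤ)) • (p, q) := by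
      rw [sub_smul, one_smul]; abel
    rw [e, ih] at this
    rw [← inv_mul_eq_iff_eq_mul.2 this, ← mul_assoc, ← zpow_neg_one, ← zpow_add]
    congr 2
    ring

lemma dev_add_zsmul (k : ℤ) (z : Plane) :
    dev Λ.label (z + ofInt (k • (p, q))) = act (Λ.hol ^ k) (dev Λ.label z) := by
  unfold dev
  rw [rd_add_ofInt, loc_add_ofInt, Λ.label_add_zsmul, act_pos]

end StripLabelling

end Mucube

namespace Mucube

open CubeIsom (r u j det deck lin)

/-! ### Powers of quarter-turns -/

namespace CubeIsom

lemma pow_four_eq_one_of_pow {a : CubeIsom} (h4 : lin a ^ 4 = 1) {n : ℕ} (hn : 0 < n)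
    (ha : a ^ n = 1) : a ^ 4 = 1 :=
  eq_one_of_pow_eq_one (by rw [map_pow, h4]) hn (by rw [pow_right_comm, ha, one_pow])

/-- A power of a quarter-turn that is a deck transformation is a translation along one axis. -/
lemma pow_four_eq_one_of_sum_trans {a : CubeIsom} (h4 : lin a ^ 4 = 1) (h2 : lin a ^ 2 ≠ 1)
    {n : ℕ} (hn : 0 < n) (ha : a ^ n ∈ deck) (hs : ∑ i, (a ^ n).trans i = 0) : a ^ 4 = 1 := by
  have h44 : lin (a ^ 4) = 1 := by rw [map_pow, h4]
  have hd := zpow_mem_deck h4 h2 (k := n) (by exact_mod_cast ha)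
  obtain ⟨m, rfl⟩ : 4 ∣ n := by exact_mod_cast hd
  obtain ⟨i, hp, hsgn⟩ := exists_axis h4 h2
  -- Off the axis, `a ^ 2` acts as a point reflection, so its square does not translate these
  -- coordinates.
  have h0 : ∀ k, k ≠ i → (a ^ 4).trans k = 0 := by
    intro k hk
    have : a ^ 4 = a ^ 2 * a ^ 2 := by rw [← pow_add]
    rw [this, mul_trans, hp, hsgn k hk]
    simp
  rw [pow_mul] at hs
  simp only [trans_pow h44] at hs
  rw [← Finset.mul_sum, Finset.sum_eq_single i (fun k _ hk => h0 k hk) (by simp)] at hs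
  have hi : (a ^ 4).trans i = 0 := by
    rcases mul_eq_zero.1 hs with h | h
    · have : m = 0 := by exact_mod_cast h
      omega
    · exact h
  have hperm : (lin (a ^ 4)).perm = 1 := congrArg perm h44
  have hsg : (lin (a ^ 4)).sgn = 1 := congrArg sgn h44
  refine CubeIsom.ext hperm hsg (funext fun k => ?_)
  by_cases hk : k = i
  · rw [hk, hi, one_trans]
  · rw [h0 k hk, one_trans]

end CubeIsom

/-! ### Rational directions -/

lemma exists_eq_zsmul {p q : ℤ} (hpq : IsCoprime p q) {n : ℤ × ℤ} (h : p * n.2 = q * n.1) :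
    ∃ k : ℤ, n = k • (p, q) := by
  obtain ⟨a, b, hab⟩ := hpq
  refine ⟨a * n.1 + b * n.2, Prod.ext ?_ ?_⟩
  · simp only [Prod.smul_mk, smul_eq_mul]
    linear_combination (-n.1) * hab - b * h
  · simp only [Prod.smul_mk, smul_eq_mul]
    linear_combination (-n.2) * hab + a * h

/-- `v` is the multiple by `lam` of the primitive vector `(p, q)` of the upper half-plane. -/
structure IsRationalDirection (v : Plane) (p q : ℤ) (lam : ℝ) : Prop where
  coprime : IsCoprime p q
  pos : 0 < q ∨ (q = 0 ∧ p = 1)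
  ne_zero : lam ≠ 0
  eq : v = lam • ofInt (p, q)

lemma exists_isRationalDirection {v : Plane} (hv : v ≠ 0) {T : ℝ} {n : ℤ × ℤ} (hT : T ≠ 0)
    (h : T • v = ofInt n) : ∃ p q lam, IsRationalDirection v p q lam := by
  have hn : n ≠ 0 := by
    rintro rfl
    have : T • v = 0 := h.trans (by simp [ofInt])
    exact (smul_ne_zero hT hv) this
  have hn' : n.1 ≠ 0 ∨ n.2 ≠ 0 := by
    by_contra! hc
    exact hn (Prod.ext hc.1 hc.2)
  obtain ⟨p, q, hpq, hn⟩ : ∃ p q : ℤ, IsCoprime p q ∧ ∃ d : ℤ, n = d • (p, q) := by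
    have hg : 0 < Int.gcd n.1 n.2 := Int.gcd_pos_iff.2 hn'
    obtain ⟨p, q, hpq, h1, h2⟩ := Int.exists_gcd_one hg
    exact ⟨p, q, Int.isCoprime_iff_gcd_eq_one.2 hpq, Int.gcd n.1 n.2,
      Prod.ext (h1.trans (mul_comm _ _)) (h2.trans (mul_comm _ _))⟩
  obtain ⟨d, hd⟩ := hn
  have hd0 : d ≠ 0 := by
    rintro rfl
    exact ‹n ≠ 0› (by rw [hd, zero_smul])
  have hveq : v = (d / T : ℝ) • ofInt (p, q) := by
    have : v = T⁻¹ • ofInt n := by rw [← h, inv_smul_smul₀ hT]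
    rw [this, hd]
    ext <;> simp [ofInt] <;> field_simp
  have hne : (d / T : ℝ) ≠ 0 := div_ne_zero (by exact_mod_cast hd0) hT
  have hneg : v = (-(d / T) : ℝ) • ofInt (-p, -q) := by
    rw [hveq]
    ext <;> simp [ofInt]
  rcases lt_trichotomy q 0 with hq | rfl | hq
  · exact ⟨-p, -q, _, hpq.neg_neg, Or.inl (by omega), neg_ne_zero.2 hne, hneg⟩
  · rcases Int.isUnit_iff.1 (isCoprime_zero_right.1 hpq) with rfl | rfl
    · exact ⟨1, 0, _, hpq, Or.inr ⟨rfl, rfl⟩, hne, hveq⟩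
    · exact ⟨1, 0, _, isCoprime_one_left, Or.inr ⟨rfl, rfl⟩, neg_ne_zero.2 hne, by simpa using hneg⟩
  · exact ⟨p, q, _, hpq, Or.inl hq, hne, hveq⟩

lemma IsRationalDirection.exists_eq_zsmul {v : Plane} {p q : ℤ} {lam : ℝ}
    (h : IsRationalDirection v p q lam) {T : ℝ} {n : ℤ × ℤ} (hT : T • v = ofInt n) :
    ∃ k : ℤ, n = k • (p, q) ∧ T * lam = k := by
  have h1 : T * lam * p = n.1 := by
    have := congrArg Prod.fst hT
    rw [h.eq] at this
    simpa [ofInt, mul_assoc] using this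
  have h2 : T * lam * q = n.2 := by
    have := congrArg Prod.snd hT
    rw [h.eq] at this
    simpa [ofInt, mul_assoc] using this
  obtain ⟨k, hk⟩ := Mucube.exists_eq_zsmul h.coprime (n := n) (by
    have : (p : ℝ) * n.2 = q * n.1 := by rw [← h1, ← h2]; ring
    exact_mod_cast this)
  refine ⟨k, hk, ?_⟩
  rw [hk] at h1 h2
  simp only [Prod.smul_mk, smul_eq_mul, Int.cast_mul] at h1 h2
  rcases h.pos with hq | ⟨-, rfl⟩
  · exact mul_right_cancel₀ (by exact_mod_cast hq.ne') h2
  · simpa using h1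

lemma IsRationalDirection.smul_eq {v : Plane} {p q : ℤ} {lam : ℝ}
    (h : IsRationalDirection v p q lam) (k : ℤ) : ((k : ℝ) / lam) • v = ofInt (k • (p, q)) := by
  rw [h.eq, smul_smul, div_mul_cancel₀ _ h.ne_zero]
  ext <;> simp [ofInt]

/-! ### Trajectories in compatible labellings -/

lemma isTrajectory_devM {L : Labelling} (hL : ∀ m, det (L m) = 1) {z₀ v : Plane}
    (h : ∀ s : ℝ, CompatAt L (z₀ + s • v)) :
    IsTrajectory atlasM v (fun s => devM L (z₀ + s • v)) := by
  intro t
  obtain ⟨φ, hφ, n, hn⟩ := exists_chart hL (h t)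
  have hcont : Tendsto (fun s : ℝ => z₀ + s • v) (𝓝 t) (𝓝 (z₀ + t • v)) :=
    (show Continuous (fun s : ℝ => z₀ + s • v) by fun_prop).tendsto t
  refine ⟨φ, hφ, z₀ - ofInt n, ?_⟩
  filter_upwards [hcont.eventually hn] with s hs
  rwa [sub_add_eq_add_sub]

/-- A half-turn would reverse the velocity. Two lines with the same velocity that agree near one
time therefore differ by an integral translation, and their labels by a deck motion. -/
lemma exists_int_of_eventually_eq {S : Type*} {π : M → S} {D : Subgroup CubeIsom}
    (hπ : IsDeckQuotient π D) {v : Plane} (hv : v ≠ 0) {L L' : Labelling}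
    (hL : ∀ m, det (L m) = 1) (hL' : ∀ m, det (L' m) = 1) {z₀ z₁ : Plane} {t : ℝ}
    (h : ∀ᶠ s : ℝ in 𝓝 t, CompatAt L (z₀ + s • v) ∧ CompatAt L' (z₁ + s • v) ∧
      π (devM L (z₀ + s • v)) = π (devM L' (z₁ + s • v))) :
    ∃ n, z₁ = z₀ + ofInt n ∧
      ∃ s : ℝ, ∃ δ ∈ D, L' (rd (z₁ + s • v)) = δ * L (rd (z₀ + s • v)) := by
  by_contra hcon
  refine not_eventually_int (ℓ := (ContinuousLinearMap.id ℝ ℝ).smulRight v) (e := 1)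
    (by simpa using hv) (z₀ + z₁) t ?_
  filter_upwards [h] with s hs
  obtain ⟨δ, hδ, hact⟩ := (hπ.eq_iff _ _).1 hs.2.2
  rcases dev_eq_dev hL hL' (hπ.det_eq δ hδ) hs.1 hs.2.1 hact.symm with ⟨n, hn, hn'⟩ | ⟨n, hn, -⟩
  · exact absurd ⟨n, by linear_combination (exp := 1) hn, s, δ, hδ, hn'⟩ hcon
  · refine ⟨n, ?_⟩
    simp only [ContinuousLinearMap.smulRight_apply, ContinuousLinearMap.id_apply]
    linear_combination (exp := 1) hn + two_smul ℝ (s • v)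

end Mucube

namespace Mucube

open CubeIsom (r u j det deck lin)

/-! ### Periodic directions are rational with torsion holonomy -/

/-- It is enough to follow the line through the centre of one square. If it hits a vertex, its slope
is rational. Otherwise it develops to a trajectory, whose period makes a multiple of `v` integral.
-/
lemma exists_isRationalDirection_of_isPeriodicDirection {v : Plane} (hv : v ≠ 0)
    (h : IsPeriodicDirection v) : ∃ p q lam, IsRationalDirection v p q lam := by
  by_cases hv2 : v.2 = 0
  · have hv1 : v.1 ≠ 0 := fun hv1 => hv (Prod.ext hv1 hv2)
    exact exists_isRationalDirection hv (T := v.1⁻¹) (n := (1, 0)) (inv_ne_zero hv1)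
      (by ext <;> simp [ofInt, hv1, hv2])
  by_cases hvert : ∃ s : ℝ, (loc (s • v)).1 = -1 / 2 ∧ (loc (s • v)).2 = -1 / 2
  · obtain ⟨s, h1, h2⟩ := hvert
    simp only [loc] at h1 h2
    -- A vertex has half-integral coordinates, so twice the vector to it is integral.
    refine exists_isRationalDirection hv (T := 2 * s)
      (n := (2 * round (s • v).1 - 1, 2 * round (s • v).2 - 1)) ?_ ?_
    · intro hs
      have hs : s = 0 := by linarith
      simp [hs] at h1
      norm_num at h1
    · rw [mul_smul]
      ext
      · rw [Prod.smul_fst]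
        simp only [ofInt, Int.cast_sub, Int.cast_mul, Int.cast_ofNat, Int.cast_one, smul_eq_mul]
        linarith
      · rw [Prod.smul_snd]
        simp only [ofInt, Int.cast_sub, Int.cast_mul, Int.cast_ofNat, Int.cast_one, smul_eq_mul]
        linarith
  -- Rows are entered at height `i - 1/2`, which the line reaches at time `(i - 1/2) / v.2`.
  · obtain ⟨L, -, -, hdet, -, -, hcomp⟩ :=
      exists_rows (fun i => round (((i : ℝ) - 1 / 2) / v.2 * v.1))
    have hL : ∀ s : ℝ, CompatAt L (0 + s • v) := by
      intro s
      rw [zero_add]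
      refine hcomp _ (fun hc => hvert ⟨s, hc⟩) fun h2 => ?_
      have e : ((round (s • v).2 : ℝ) - 1 / 2) / v.2 = s := by
        simp only [loc] at h2
        rw [div_eq_iff hv2]
        have : (s • v).2 = s * v.2 := rfl
        linarith
      simp only [rd, e]
      rfl
    obtain ⟨T, hT, hper⟩ := h _ (isTrajectory_devM hdet hL)
    obtain ⟨n, hn, -⟩ := exists_int_of_eventually_eq isDeckQuotient_id hv hdet hdet
      (z₀ := 0) (z₁ := T • v) (t := 0) (Eventually.of_forall fun s => by
        have e : T • v + s • v = 0 + (s + T) • v := by rw [add_smul]; abel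
        rw [e]
        exact ⟨hL s, hL _, (hper s).symm⟩)
    exact exists_isRationalDirection hv hT.ne' (by rw [hn, zero_add])

namespace IsRationalDirection

variable {v : Plane} {p q : ℤ} {lam : ℝ} (h : IsRationalDirection v p q lam)
include h

lemma ne_zero' : v ≠ 0 := by
  rintro rfl
  have h1 := congrArg Prod.fst h.eq
  have h2 := congrArg Prod.snd h.eq
  have h0 := h.ne_zero
  simp only [ofInt, Prod.smul_mk, smul_eq_mul, Prod.fst_zero, Prod.snd_zero, zero_eq_mul,
    h0, false_or, Int.cast_eq_zero] at h1 h2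
  rcases h.pos with hq | ⟨-, hp⟩ <;> omega

lemma fst_eq : v.1 = lam * p := congrArg Prod.fst h.eq

lemma snd_eq : v.2 = lam * q := congrArg Prod.snd h.eq

lemma sq_pos : (0 : ℝ) < (p : ℝ) ^ 2 + (q : ℝ) ^ 2 := by
  have hp : 0 < p ^ 2 + q ^ 2 := by
    rcases h.pos with hq | ⟨rfl, rfl⟩
    · positivity
    · norm_num
  exact_mod_cast hp

lemma add_smul_mem_strip {z : Plane} (s : ℝ) : z + s • v ∈ strip p q ↔ z ∈ strip p q := by
  have e : (p : ℝ) * (z + s • v).2 - q * (z + s • v).1 = p * z.2 - q * z.1 := by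
    simp [h.fst_eq, h.snd_eq]; ring
  unfold strip
  rw [mem_ofPred_eq, mem_ofPred_eq, e]

lemma strip_nonempty : (strip p q).Nonempty := by
  have hs := h.sq_pos
  refine ⟨(((p : ℝ) - q + 1) / 2 / ((p : ℝ) ^ 2 + (q : ℝ) ^ 2)) • (-(q : ℝ), (p : ℝ)), ?_⟩
  have e : (p : ℝ) * (((p : ℝ) - q + 1) / 2 / ((p : ℝ) ^ 2 + (q : ℝ) ^ 2) * p) -
      q * (((p : ℝ) - q + 1) / 2 / ((p : ℝ) ^ 2 + (q : ℝ) ^ 2) * -q) = ((p : ℝ) - q) / 2 + 1 / 2 := by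
    field_simp
    ring
  simp only [strip, mem_ofPred_eq, Prod.smul_mk, smul_eq_mul, e]
  constructor <;> linarith

/-- The holonomy of a strip is torsion as soon as one line in it closes up on the Mucube. -/
lemma hol_pow_eq_one (Λ : StripLabelling p q) {z : Plane} (hz : z ∈ strip p q) {T : ℝ}
    (hT : T ≠ 0) (hper : Function.Periodic (fun s : ℝ => devM Λ.label (z + s • v)) T) :
    ∃ n : ℕ, 0 < n ∧ Λ.hol ^ n = 1 := by
  have hcomp : ∀ s : ℝ, CompatAt Λ.label (z + s • v) :=
    fun s => Λ.compat _ ((h.add_smul_mem_strip s).2 hz)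
  obtain ⟨n, hn, s, δ, hδ, hlab⟩ := exists_int_of_eventually_eq isDeckQuotient_id h.ne_zero'
    Λ.det_label Λ.det_label (z₀ := z) (z₁ := z + T • v) (t := 0) (Eventually.of_forall fun s => by
      have e : z + T • v + s • v = z + (s + T) • v := by rw [add_smul]; abel
      rw [e]
      exact ⟨hcomp s, hcomp _, (hper s).symm⟩)
  have hn : T • v = ofInt n := by simpa using hn
  obtain ⟨k, rfl, hk⟩ := h.exists_eq_zsmul hn
  rw [Subgroup.mem_bot.1 hδ, one_mul, hn, add_right_comm, rd_add_ofInt, Λ.label_add_zsmul,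
    mul_eq_right] at hlab
  have hk0 : k ≠ 0 := by
    rintro rfl
    exact mul_ne_zero hT h.ne_zero (by simpa using hk)
  refine ⟨k.natAbs, Int.natAbs_pos.2 hk0, ?_⟩
  exact pow_natAbs_eq_one.2 hlab

lemma hol_of_isPeriodicDirection (Λ : StripLabelling p q) (hper : IsPeriodicDirection v) :
    lin Λ.hol ^ 4 = 1 ∧ lin Λ.hol ^ 2 ≠ 1 ∧ Λ.hol ^ 4 = 1 := by
  obtain ⟨z, hz⟩ := h.strip_nonempty
  obtain ⟨T, hT, hc⟩ := hper _ (isTrajectory_devM Λ.det_label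
    (fun s => Λ.compat _ ((h.add_smul_mem_strip s).2 hz)))
  obtain ⟨n, hn, hw⟩ := h.hol_pow_eq_one Λ hz hT.ne' hc
  obtain ⟨h4, h2⟩ := Λ.quarter_turn n hn hw
  exact ⟨h4, h2, CubeIsom.pow_four_eq_one_of_pow h4 hn hw⟩

end IsRationalDirection

end Mucube

namespace Mucube

open CubeIsom (r u j det deck lin)

/-! ### Crossings of the horizontal core curve -/

/-- The sign with which the odd coordinate of a face increases along its vertical direction. -/
def CubeIsom.side (γ : CubeIsom) : ℤˣ := γ.sgn (γ.perm⁻¹ 0)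

namespace CubeIsom

/-- Deck motions change no signs; this is why the upward direction is well defined on `Y`. -/
lemma side_mul_of_mem_deck {δ : CubeIsom} (hδ : δ ∈ deck) (γ : CubeIsom) :
    side (δ * γ) = side γ := by
  simp [side, hδ.1, mul_inv_rev]

lemma side_mul_r (γ : CubeIsom) : side (γ * r) = side γ := by
  have h1 : r.perm⁻¹ 0 = 0 := by decide
  have h2 : r.sgn 0 = 1 := by decide
  rw [side, mul_perm, mul_inv_rev, Equiv.Perm.mul_apply, h1, mul_sgn, perm_apply_inv,
    h2, mul_one, side]

lemma side_mul_r_zpow (γ : CubeIsom) (k : ℤ) : side (γ * r ^ k) = side γ := by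
  induction k using Int.induction_on with
  | zero => simp
  | succ k ih => rw [zpow_add_one, ← mul_assoc, side_mul_r, ih]
  | pred k ih => rw [← side_mul_r, mul_assoc, ← zpow_add_one, sub_add_cancel, ih]

lemma side_of_perm_eq {γ : CubeIsom} {i : Fin 3} (h : γ.perm i = 0) : side γ = γ.sgn i := by
  rw [side, ← h]
  exact congrArg γ.sgn (γ.perm.symm_apply_apply i)

end CubeIsom

open CubeIsom (side)

lemma pos_apply (γ : CubeIsom) (z : Plane) (i : Fin 3) :
    pos γ z i = γ.sgn i * ![1 + z.2, 1 / 2, z.1] (γ.perm i) + 2 * γ.trans i := rfl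

lemma perm_eq_zero_of_cos_neg {γ : CubeIsom} {z : Plane} {i : Fin 3} (h1 : |z.1| ≤ 1 / 2)
    (h : Real.cos (Real.pi * pos γ z i) < 0) : γ.perm i = 0 := by
  rw [pos, cos_pi_act] at h
  have : ∀ m : Fin 3, Real.cos (Real.pi * ![1 + z.2, 1 / 2, z.1] m) < 0 → m = 0 := by
    intro m hm
    fin_cases m
    · rfl
    · change Real.cos (Real.pi * (1 / 2)) < 0 at hm
      rw [cos_pi_half] at hm
      exact absurd hm (lt_irrefl _)
    · exact absurd hm (not_lt.2 (cos_pi_mul_nonneg h1))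
  exact this _ h

lemma cos_pi_odd (k : ℤ) : Real.cos (Real.pi * (2 * k + 1)) = -1 := by
  have : Real.pi * (2 * k + 1) = Real.pi + k * (2 * Real.pi) := by ring
  rw [this, Real.cos_add_int_mul_two_pi, Real.cos_pi]

/-- A lift of a straight line crosses a plane with odd coordinate at constant speed. -/
lemma coord_eq {L : Labelling} {z₀ v : Plane} {t : ℝ} (hz : CompatAt L (z₀ + t • v)) {p : ℝ → M}
    (hp : ContinuousAt p t) (heq : ∀ᶠ s in 𝓝 t, toY (p s) = toY (devM L (z₀ + s • v)))
    {i : Fin 3} {k : ℤ} (hi : (p t).1 i = 2 * k + 1) :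
    (loc (z₀ + t • v)).2 = 0 ∧ ∀ᶠ s in 𝓝 t, (p s).1 i =
      2 * k + 1 + ((side (L (rd (z₀ + t • v))) : ℤ) : ℝ) * v.2 * (s - t) := by
  have hlift : ∀ s, toY (p s) = toY (devM L (z₀ + s • v)) → ∃ δ ∈ deck,
      (p s).1 = pos (δ * L (rd (z₀ + s • v))) (loc (z₀ + s • v)) := by
    intro s hs
    obtain ⟨δ, hδ, h⟩ := toY_eq_toY.1 hs.symm
    exact ⟨δ, hδ, by rw [h, ← act_pos]; rfl⟩
  have habs : ∀ w : Plane, |(loc w).1| ≤ 1 / 2 := fun w => abs_sub_round_le w.1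
  have hy : (loc (z₀ + t • v)).2 = 0 := by
    obtain ⟨δ, hδ, h⟩ := hlift t heq.self_of_nhds
    have hc := cos_pi_odd k
    rw [← hi, h] at hc
    have h0 := perm_eq_zero_of_cos_neg (habs _) (hc.trans_lt (by norm_num))
    rw [pos, cos_pi_act, h0] at hc
    change Real.cos (Real.pi * (1 + _)) = -1 at hc
    rw [cos_pi_one_add, neg_inj] at hc
    obtain ⟨h1, h2⟩ := (loc_mem (z₀ + t • v)).2
    have hpi := Real.pi_pos
    rw [Real.cos_eq_one_iff_of_lt_of_lt (by nlinarith) (by nlinarith)] at hc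
    exact (mul_eq_zero.1 hc).resolve_left hpi.ne'
  refine ⟨hy, ?_⟩
  have hcoord : ContinuousAt (fun s => (p s).1 i) t :=
    ((continuous_apply i).comp continuous_subtype_val).continuousAt.comp hp
  have hline : Tendsto (fun s : ℝ => z₀ + s • v) (𝓝 t) (𝓝 (z₀ + t • v)) :=
    (show Continuous (fun s : ℝ => z₀ + s • v) by fun_prop).tendsto t
  -- Nothing but continuity at `t` is known of the lift `p`. The negative cosine identifies `i` as
  -- the odd coordinate of the face, and closeness to `2 * k + 1` then pins down the even
  -- translation `τ`.
  have e1 : ∀ᶠ s in 𝓝 t, Real.cos (Real.pi * (p s).1 i) < 0 := by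
    have hc : ContinuousAt (fun s => Real.cos (Real.pi * (p s).1 i)) t :=
      Real.continuous_cos.continuousAt.comp (continuousAt_const.mul hcoord)
    refine hc.eventually_lt continuousAt_const ?_
    rw [hi, cos_pi_odd]
    norm_num
  have e2 : ∀ᶠ s in 𝓝 t, |(p s).1 i - (2 * k + 1)| < 1 / 2 := by
    have hc : ContinuousAt (fun s => |(p s).1 i - (2 * k + 1)|) t :=
      (hcoord.sub continuousAt_const).abs
    exact hc.eventually_lt continuousAt_const (by simp [hi])
  have e3 : ∀ᶠ s in 𝓝 t, |(s - t) * v.2| < 1 / 2 := by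
    have hc : Continuous (fun s : ℝ => |(s - t) * v.2|) := by fun_prop
    exact hc.continuousAt.eventually_lt continuousAt_const (by simp)
  filter_upwards [e1, e2, e3, heq, hline.eventually (eventually_rd hz.not_vertex)]
    with s h1 h2 h3 h4 h5
  obtain ⟨δ, hδ, h⟩ := hlift s h4
  have hrd : side (L (rd (z₀ + s • v))) = side (L (rd (z₀ + t • v))) ∧
      (rd (z₀ + s • v)).2 = (rd (z₀ + t • v)).2 := by
    rcases h5 with e | ⟨hl, e⟩ | ⟨hl, e⟩
    · rw [e]; exact ⟨rfl, rfl⟩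
    · rw [e, hz.right hl, CubeIsom.side_mul_r]; simp
    · rw [hy] at hl; norm_num at hl
  have hloc : (loc (z₀ + s • v)).2 = (s - t) * v.2 := by
    have e2 : (loc (z₀ + s • v)).2 = (z₀ + s • v).2 - (rd (z₀ + s • v)).2 := rfl
    have e3 : (loc (z₀ + t • v)).2 = (z₀ + t • v).2 - (rd (z₀ + t • v)).2 := rfl
    rw [hy] at e3
    rw [e2, hrd.2]
    simp only [Prod.snd_add, Prod.smul_snd, smul_eq_mul] at e3 ⊢
    linarith
  rw [h] at h1
  have h0 := perm_eq_zero_of_cos_neg (habs _) h1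
  have hside := CubeIsom.side_of_perm_eq h0
  rw [CubeIsom.side_mul_of_mem_deck hδ, hrd.1] at hside
  have hval : (p s).1 i = ((side (L (rd (z₀ + t • v))) : ℤ) : ℝ) * (1 + (s - t) * v.2) +
      2 * (δ * L (rd (z₀ + s • v))).trans i := by
    rw [h, pos_apply, h0, ← hside, ← hloc]
    rfl
  set τ := (δ * L (rd (z₀ + s • v))).trans i
  rw [hval] at h2 ⊢
  rw [abs_lt] at h2 h3
  rcases units_cast_cases (side (L (rd (z₀ + t • v)))) with e | e
  · rw [e] at h2 ⊢
    have : τ = k := int_eq_of_lt (by linarith [h2.1, h3.2]) (by linarith [h2.2, h3.1])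
    rw [this]; ring
  · rw [e] at h2 ⊢
    have : τ = k + 1 := int_eq_of_lt (by push_cast; linarith [h2.1, h3.1])
      (by push_cast; linarith [h2.2, h3.2])
    rw [this]; push_cast; ring

lemma continuous_pos (γ : CubeIsom) : Continuous (pos γ) := by
  refine continuous_pi fun i => ?_
  have h : ∀ m : Fin 3, Continuous fun z : Plane => (![1 + z.2, 1 / 2, z.1] : R3) m := by
    intro m
    fin_cases m
    · change Continuous fun z : Plane => 1 + z.2
      fun_prop
    · exact continuous_const
    · exact continuous_fst
  have := h (γ.perm i)
  simp only [pos_apply]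
  fun_prop

lemma CompatAt.continuousAt_dev {L : Labelling} {z : Plane} (hz : CompatAt L z) :
    ContinuousAt (dev L) z := by
  have key : ∀ m : ℤ × ℤ, pos (L m) (z - ofInt m) = dev L z →
      Tendsto (fun z' => pos (L m) (z' - ofInt m)) (𝓝 z) (𝓝 (dev L z)) := by
    intro m hm
    rw [← hm]
    exact ((continuous_pos (L m)).comp (continuous_id.sub continuous_const)).tendsto z
  have hloc : ∀ w, loc w = w - ofInt (rd w) := fun w => by
    rw [eq_sub_iff_add_eq, add_comm, ofInt_rd_add_loc]
  have h0 := key (rd z) (by rw [← hloc]; rfl)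
  have h1 : (loc z).1 = -1 / 2 → pos (L (rd z - (1, 0))) (z - ofInt (rd z - (1, 0))) = dev L z := by
    intro h
    have e : z - ofInt (rd z - (1, 0)) = (1 / 2, (loc z).2) := by
      rw [ofInt_sub, ← sub_add, ← hloc]
      ext
      · simp only [Prod.fst_add, h, ofInt]; norm_num
      · simp [ofInt]
    rw [e, dev, hz.right h, ← pos_mul_r, ← h]
  have h2 : (loc z).2 = -1 / 2 → pos (L (rd z - (0, 1))) (z - ofInt (rd z - (0, 1))) = dev L z := by
    intro h
    have e : z - ofInt (rd z - (0, 1)) = ((loc z).1, 1 / 2) := by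
      rw [ofInt_sub, ← sub_add, ← hloc]
      ext
      · simp [ofInt]
      · simp only [Prod.snd_add, h, ofInt]; norm_num
    rw [e, dev, hz.up h, ← pos_mul_u, ← h]
  intro U hU
  have e1 : ∀ᶠ z' in 𝓝 z, (loc z).1 = -1 / 2 →
      pos (L (rd z - (1, 0))) (z' - ofInt (rd z - (1, 0))) ∈ U := by
    by_cases h : (loc z).1 = -1 / 2
    · filter_upwards [key _ (h1 h) hU] with z' hz' _ using hz'
    · exact Eventually.of_forall fun _ h' => absurd h' h
  have e2 : ∀ᶠ z' in 𝓝 z, (loc z).2 = -1 / 2 →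
      pos (L (rd z - (0, 1))) (z' - ofInt (rd z - (0, 1))) ∈ U := by
    by_cases h : (loc z).2 = -1 / 2
    · filter_upwards [key _ (h2 h) hU] with z' hz' _ using hz'
    · exact Eventually.of_forall fun _ h' => absurd h' h
  change ∀ᶠ z' in 𝓝 z, dev L z' ∈ U
  filter_upwards [h0 hU, e1, e2, eventually_rd hz.not_vertex] with z' a0 a1 a2 hrd
  rw [dev, hloc]
  rcases hrd with e | ⟨hl, e⟩ | ⟨hl, e⟩
  · rw [e]; exact a0
  · rw [e]; exact a1 hl
  · rw [e]; exact a2 hl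

lemma CompatAt.continuousAt_devM {L : Labelling} {z : Plane} (hz : CompatAt L z) :
    ContinuousAt (devM L) z :=
  hz.continuousAt_dev.codRestrict (fun z => dev_mem_mucube L z)

/-- By `coord_eq`, in any lift the odd coordinate passes through its value with speed `side * v.2`,
so the sign of a crossing does not depend on the lift. The core curves are the centre lines of the
rows, at integral height. -/
lemma crossesAt_iff {L : Labelling} {z₀ v : Plane} (hL : ∀ s : ℝ, CompatAt L (z₀ + s • v)) (σ : ℝ)
    (t : ℝ) : CrossesAt σ (fun s => toY (devM L (z₀ + s • v))) t ↔
      (∃ m : ℤ, (z₀ + t • v).2 = m) ∧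
        0 < σ * ((side (L (rd (z₀ + t • v))) : ℤ) : ℝ) * v.2 := by
  constructor
  · rintro ⟨p, hp, i, k, hi, -, hgt⟩
    obtain ⟨hy, hev⟩ := coord_eq (hL t) hp.self_of_nhds.1 (hp.mono fun s h => h.2) hi
    refine ⟨⟨round (z₀ + t • v).2, sub_eq_zero.1 hy⟩, ?_⟩
    obtain ⟨s, ⟨h1, h2⟩, h3⟩ := ((hgt.and (hev.filter_mono nhdsWithin_le_nhds)).and
      self_mem_nhdsWithin).exists
    rw [h2] at h1
    have h3 : 0 < s - t := sub_pos.2 h3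
    by_contra hneg
    have := mul_nonpos_of_nonpos_of_nonneg (not_lt.1 hneg) h3.le
    linarith
  · rintro ⟨⟨m, hm⟩, hpos⟩
    have hcont : ∀ s : ℝ, ContinuousAt (fun s : ℝ => devM L (z₀ + s • v)) s := fun s =>
      ContinuousAt.comp (f := fun s : ℝ => z₀ + s • v) (hL s).continuousAt_devM
        (show Continuous (fun s : ℝ => z₀ + s • v) by fun_prop).continuousAt
    have hy : (loc (z₀ + t • v)).2 = 0 := by
      change (z₀ + t • v).2 - round (z₀ + t • v).2 = 0
      rw [hm, round_intCast, sub_self]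
    set γ := L (rd (z₀ + t • v)) with hγ
    obtain ⟨k, hk⟩ : ∃ k : ℤ, (devM L (z₀ + t • v)).1 (γ.perm⁻¹ 0) = 2 * k + 1 := by
      have e : (devM L (z₀ + t • v)).1 (γ.perm⁻¹ 0) = ((side γ : ℤ) : ℝ) * (1 + 0) +
          2 * γ.trans (γ.perm⁻¹ 0) := by
        change dev L (z₀ + t • v) _ = _
        rw [dev, pos_apply, ← hγ, perm_apply_inv, ← hy]
        rfl
      rcases units_cast_cases (side γ) with e' | e'
      · exact ⟨γ.trans (γ.perm⁻¹ 0), by rw [e, e']; ring⟩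
      · exact ⟨γ.trans (γ.perm⁻¹ 0) - 1, by rw [e, e']; push_cast; ring⟩
    obtain ⟨-, hev⟩ := coord_eq (hL t) (hcont t) (Eventually.of_forall fun _ => rfl) hk
    refine ⟨fun s => devM L (z₀ + s • v), Eventually.of_forall fun s => ⟨hcont s, rfl⟩, _, k, hk,
      ?_, ?_⟩
    · filter_upwards [hev.filter_mono nhdsWithin_le_nhds, self_mem_nhdsWithin] with s h1 h2
      rw [h1]
      have := mul_pos hpos (sub_pos.2 (mem_Iio.1 h2))
      linarith
    · filter_upwards [hev.filter_mono nhdsWithin_le_nhds, self_mem_nhdsWithin] with s h1 h2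
      rw [h1]
      have := mul_pos hpos (sub_pos.2 (mem_Ioi.1 h2))
      linarith

end Mucube

namespace Mucube

open CubeIsom (r u j det deck lin side)

/-! ### The intersection number as a translation length -/

namespace CubeIsom

/-- The sum of the coordinates of the translation part. -/
def transSum (γ : CubeIsom) : ℤ := ∑ i, γ.trans i

lemma transSum_mul_r (γ : CubeIsom) : transSum (γ * r) = transSum γ := by
  simp [transSum, r]

lemma transSum_mul_r_zpow (γ : CubeIsom) (k : ℤ) : transSum (γ * r ^ k) = transSum γ := by
  induction k using Int.induction_on with
  | zero => simp
  | succ k ih => rw [zpow_add_one, ← mul_assoc, transSum_mul_r, ih]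
  | pred k ih => rw [← transSum_mul_r, mul_assoc, ← zpow_add_one, sub_add_cancel, ih]

/-- The translation of `u` has a single entry, which `γ` transports with the sign `side γ`. As `r`
contributes nothing, `transSum` keeps the signed count of rows climbed. -/
lemma transSum_mul_u (γ : CubeIsom) : transSum (γ * u) = transSum γ + side γ := by
  have h : ∀ m : Fin 3, u.trans m = if m = 0 then 1 else 0 := by decide
  have hs : ∑ i, (if γ.perm i = 0 then (γ.sgn i : ℤ) else 0) = side γ := by
    rw [Finset.sum_eq_single (γ.perm⁻¹ 0), if_pos (perm_apply_inv _ _), side]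
    · intro i _ hi
      exact if_neg fun h => hi (by rw [← h]; exact (γ.perm.symm_apply_apply i).symm)
    · simp
  simp only [transSum, mul_trans, h, mul_ite, mul_one, mul_zero, Finset.sum_add_distrib]
  rw [hs, add_comm]

lemma transSum_mul_of_mem_deck {δ : CubeIsom} (hδ : δ ∈ deck) (γ : CubeIsom) :
    transSum (δ * γ) = transSum γ + transSum δ := by
  have : ∑ i, γ.trans (δ.perm i) = ∑ i, γ.trans i := Equiv.sum_comp δ.perm γ.trans
  simp [transSum, hδ.1, Finset.sum_add_distrib, this]

end CubeIsom

open CubeIsom (transSum)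

lemma sum_side_eq {h : ℤ → CubeIsom} (hh : ∀ i, ∃ x : ℤ, h (i + 1) = h i * r ^ x * u)
    (g : CubeIsom) (a : ℤ) (n : ℕ) :
    ∑ m ∈ Finset.Ico a (a + n), (side (g * h m) : ℤ) =
      transSum (g * h (a + n)) - transSum (g * h a) := by
  induction n with
  | zero => simp
  | succ n ih =>
    obtain ⟨x, hx⟩ := hh (a + n)
    have e : Finset.Ico a (a + (n + 1 : ℕ)) = insert (a + n : ℤ) (Finset.Ico a (a + n)) := by
      ext y; simp only [Finset.mem_Ico, Finset.mem_insert]; push_cast; omega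
    rw [e, Finset.sum_insert (by simp), ih, Nat.cast_succ, ← add_assoc, hx, ← mul_assoc,
      CubeIsom.transSum_mul_u, ← mul_assoc, CubeIsom.transSum_mul_r_zpow,
      CubeIsom.side_mul_r_zpow]
    ring

lemma card_filter_sub_card_filter (J : Finset ℤ) (f : ℤ → ℤˣ) :
    ((J.filter fun m => f m = 1).card : ℤ) - (J.filter fun m => f m = -1).card =
      ∑ m ∈ J, (f m : ℤ) := by
  rw [Finset.card_filter, Finset.card_filter]
  push_cast
  rw [← Finset.sum_sub_distrib]
  refine Finset.sum_congr rfl fun m _ => ?_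
  rcases Int.units_eq_one_or (f m) with h | h <;> simp [h]

/-- The integers met by a moving height during a period. -/
lemma exists_Ico_iff {y w ℓ : ℝ} {n : ℤ} (hw : w ≠ 0) (hℓ : 0 < ℓ) (h : ℓ * w = n) :
    ∃ a : ℤ, ∀ m : ℤ, (m - y) / w ∈ Ico 0 ℓ ↔ m ∈ Finset.Ico a (a + n.natAbs) := by
  rcases lt_or_gt_of_ne hw with hw | hw
  · have hn : n < 0 := by
      have : (n : ℝ) < 0 := by rw [← h]; exact mul_neg_of_pos_of_neg hℓ hw
      exact_mod_cast this
    refine ⟨⌊y⌋ + 1 + n, fun m => ?_⟩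
    rw [mem_Ico, le_div_iff_of_neg hw, div_lt_iff_of_neg hw, h, Finset.mem_Ico]
    have e1 : (m : ℝ) - y ≤ 0 * w ↔ m ≤ ⌊y⌋ := by
      rw [Int.le_floor, zero_mul, sub_nonpos]
    have e2 : (n : ℝ) < m - y ↔ ⌊y⌋ < m - n := by
      rw [Int.floor_lt]; push_cast; constructor <;> intro <;> linarith
    rw [e1, e2]
    omega
  · have hn : 0 < n := by
      have : (0 : ℝ) < n := by rw [← h]; exact mul_pos hℓ hw
      exact_mod_cast this
    refine ⟨⌈y⌉, fun m => ?_⟩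
    rw [mem_Ico, le_div_iff₀ hw, div_lt_iff₀ hw, h, Finset.mem_Ico]
    have e1 : 0 * w ≤ (m : ℝ) - y ↔ ⌈y⌉ ≤ m := by
      rw [Int.ceil_le, zero_mul, sub_nonneg]
    have e2 : (m : ℝ) - y < n ↔ m - n < ⌈y⌉ := by
      rw [Int.lt_ceil]; push_cast; constructor <;> intro <;> linarith
    rw [e1, e2]
    omega

namespace IsRationalDirection

variable {v : Plane} {p q : ℤ} {lam : ℝ} (hv : IsRationalDirection v p q lam)
include hv

lemma compatAt_mul (Λ : StripLabelling p q) (g : CubeIsom) {z₀ : Plane} (hz : z₀ ∈ strip p q)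
    (s : ℝ) : CompatAt (Λ.label.mul g) (z₀ + s • v) :=
  (Λ.compat _ ((hv.add_smul_mem_strip s).2 hz)).mul g

lemma intersectionNumber_of_horizontal (Λ : StripLabelling p q) (g : CubeIsom) {z₀ : Plane}
    (hz : z₀ ∈ strip p q) (hq : q = 0) (ℓ : ℝ) :
    intersectionNumber ℓ (fun s => toY (devM (Λ.label.mul g) (z₀ + s • v))) = 0 := by
  have h2 : v.2 = 0 := by rw [hv.snd_eq, hq]; simp
  have key : ∀ σ t, ¬ CrossesAt σ (fun s => toY (devM (Λ.label.mul g) (z₀ + s • v))) t := by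
    intro σ t
    rw [crossesAt_iff (hv.compatAt_mul Λ g hz), h2]
    simp
  simp [intersectionNumber, key]

/-- One period passes the centre lines of `|N| * q` consecutive rows, each counted with the sign of
its `side` times the sign `η` of `v.2`. By `sum_side_eq` this telescopes to the difference of
`transSum` at the two ends, which are related by the deck motion closing the curve. Rows are summed
upwards whatever the sense of travel, hence `N.natAbs`. -/
lemma intersectionNumber_eq {Λ : StripLabelling p q} (hq : 0 < q) {h : ℤ → CubeIsom}
    (hlab : ∀ m, ∃ x : ℤ, Λ.label m = h m.2 * r ^ x)
    (hh : ∀ i, ∃ x : ℤ, h (i + 1) = h i * r ^ x * u) (hw : ∀ i, h (i + q) = Λ.hol * h i)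
    {g : CubeIsom} {z₀ : Plane} (hz : z₀ ∈ strip p q) {ℓ : ℝ} (hℓ : 0 < ℓ) {N : ℤ}
    (hN : ℓ * lam = N) (hd : g * Λ.hol ^ N.natAbs * g⁻¹ ∈ deck) :
    ∃ η : ℤˣ, intersectionNumber ℓ (fun s => toY (devM (Λ.label.mul g) (z₀ + s • v))) =
      η * transSum (g * Λ.hol ^ N.natAbs * g⁻¹) := by
  have hqR : (0 : ℝ) < q := by exact_mod_cast hq
  have h2 : v.2 ≠ 0 := by rw [hv.snd_eq]; exact mul_ne_zero hv.ne_zero hqR.ne'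
  obtain ⟨η, hη⟩ : ∃ η : ℤˣ, 0 < ((η : ℤ) : ℝ) * v.2 := by
    rcases lt_or_gt_of_ne h2 with h | h
    · exact ⟨-1, by simpa using h⟩
    · exact ⟨1, by simpa using h⟩
  refine ⟨η, ?_⟩
  obtain ⟨a, ha⟩ := exists_Ico_iff (y := z₀.2) h2 hℓ (n := N * q) (by
    rw [hv.snd_eq, ← mul_assoc, hN]; push_cast; rfl)
  have hnat : (N * q).natAbs = N.natAbs * q.natAbs := Int.natAbs_mul _ _
  have hcross : ∀ (σ : ℤˣ), {t ∈ Ico 0 ℓ | CrossesAt ((σ : ℤ) : ℝ)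
      (fun s => toY (devM (Λ.label.mul g) (z₀ + s • v))) t}.ncard =
      ((Finset.Ico a (a + (N * q).natAbs)).filter fun m => η * side (g * h m) = σ).card := by
    intro σ
    rw [← ncard_coe_finset, ← ncard_image_of_injective (f := fun m : ℤ => ((m : ℝ) - z₀.2) / v.2)]
    · congr 1
      ext t
      rw [mem_ofPred_eq, crossesAt_iff (hv.compatAt_mul Λ g hz)]
      have hsgn : ∀ m : ℤ, (z₀ + t • v).2 = m →
          (0 < ((σ : ℤ) : ℝ) * ((side (Λ.label.mul g (rd (z₀ + t • v))) : ℤ) : ℝ) * v.2 ↔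
            η * side (g * h m) = σ) := by
        intro m hm
        have hrd : (rd (z₀ + t • v)).2 = m := by
          change round (z₀ + t • v).2 = m
          rw [hm, round_intCast]
        obtain ⟨x, hx⟩ := hlab (rd (z₀ + t • v))
        rw [Labelling.mul, hx, hrd, ← mul_assoc, CubeIsom.side_mul_r_zpow]
        rcases Int.units_eq_one_or η with e1 | e1 <;>
          rcases Int.units_eq_one_or (side (g * h m)) with e2 | e2 <;>
          rcases Int.units_eq_one_or σ with e3 | e3 <;>
          rw [e1] at hη <;> rw [e1, e2, e3] <;> simp at hη ⊢ <;>
          linarith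
      constructor
      · rintro ⟨ht, ⟨m, hm⟩, hpos⟩
        have htm : t = (m - z₀.2) / v.2 := by
          rw [eq_div_iff h2, ← hm]; simp
        refine ⟨m, ?_, htm.symm⟩
        rw [Finset.mem_coe, Finset.mem_filter, ← ha]
        exact ⟨htm ▸ ht, (hsgn m hm).1 hpos⟩
      · rintro ⟨m, hm, rfl⟩
        rw [Finset.mem_coe, Finset.mem_filter, ← ha] at hm
        have hm' : (z₀ + (((m : ℝ) - z₀.2) / v.2) • v).2 = m := by
          simp only [Prod.snd_add, Prod.smul_snd, smul_eq_mul]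
          field_simp
          ring
        exact ⟨hm.1, ⟨m, hm'⟩, (hsgn m hm').2 hm.2⟩
    · intro m m' hmm
      have := div_left_inj' h2 |>.1 hmm
      exact_mod_cast sub_left_inj.1 this
  have e1 := hcross 1
  have e2 := hcross (-1)
  simp only [Units.val_one, Units.val_neg, Int.cast_one, Int.cast_neg] at e1 e2
  rw [intersectionNumber, e1, e2, card_filter_sub_card_filter]
  simp only [Units.val_mul]
  rw [← Finset.mul_sum, sum_side_eq hh]
  have hpow : ∀ n : ℕ, h (a + (n * q.natAbs : ℕ)) = Λ.hol ^ n * h a := by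
    intro n
    induction n with
    | zero => simp
    | succ n ih =>
      have e : a + ((n + 1) * q.natAbs : ℕ) = a + (n * q.natAbs : ℕ) + q := by
        push_cast; rw [abs_of_pos hq]; ring
      rw [e, hw, ih, ← mul_assoc, pow_succ']
  have e3 : g * (Λ.hol ^ N.natAbs * h a) = (g * Λ.hol ^ N.natAbs * g⁻¹) * (g * h a) := by group
  rw [hnat, hpow, e3, CubeIsom.transSum_mul_of_mem_deck hd]
  ring

end IsRationalDirection

end Mucube

namespace Mucube

open CubeIsom (r u j det deck lin side transSum)

/-! ### The half-turns of a strip -/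

/-- A deck transformation does not invert a quarter-turn. -/
lemma CubeIsom.not_inverts_of_mem_deck {a δ : CubeIsom} (h4 : lin a ^ 4 = 1) (h2 : lin a ^ 2 ≠ 1)
    (hδ : δ ∈ deck) : δ * a ≠ a⁻¹ * δ := by
  -- A rotation inverting a quarter-turn has order two, whereas linear parts of deck motions have
  -- order one or three.
  have key : ∀ (σ : Equiv.Perm (Fin 3)) (ε : Fin 3 → ℤˣ),
      (⟨σ, ε, 0⟩ : CubeIsom) ^ 4 = 1 → (⟨σ, ε, 0⟩ : CubeIsom) ^ 2 ≠ 1 →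
      ∀ σ' : Equiv.Perm (Fin 3), Equiv.Perm.sign σ' = 1 →
      (⟨σ', 1, 0⟩ : CubeIsom) * ⟨σ, ε, 0⟩ ≠ ⟨σ, ε, 0⟩⁻¹ * ⟨σ', 1, 0⟩ := by
    decide +kernel
  intro h
  refine key a.perm a.sgn h4 h2 δ.perm hδ.2 ?_
  have e : (⟨δ.perm, 1, 0⟩ : CubeIsom) = lin δ := by rw [← hδ.1]; rfl
  rw [e]
  change lin δ * lin a = (lin a)⁻¹ * lin δ
  rw [← map_inv, ← map_mul, ← map_mul, h]

lemma round_int_sub {x : ℝ} {n : ℤ} (h : x - round x ≠ -1 / 2) :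
    round (n - x) = n - round x := by
  have h1 := (loc_mem (x, 0)).1
  simp only [loc] at h1
  have h2 := lt_of_le_of_ne h1.1 (Ne.symm h)
  apply round_eq_of_mem
  push_cast
  constructor <;> linarith [h1.2]

lemma round_int_sub_half {x : ℝ} {n : ℤ} (h : x - round x = -1 / 2) :
    round (n - x) = n - round x + 1 := by
  apply round_eq_of_mem
  push_cast
  constructor <;> linarith

/-- The rotation of a labelling by `π`. -/
lemma CompatAt.of_flip {L : Labelling} {n : ℤ × ℤ} {z : Plane} (h : CompatAt L (ofInt n - z)) :
    CompatAt (fun m => L (n - m) * j) z := by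
  have h1 : ∀ x : ℝ, ∀ k : ℤ, x - round x = -1 / 2 → (k - x) - round (k - x) = -1 / 2 := by
    intro x k hx
    rw [round_int_sub_half hx]
    push_cast
    linarith
  refine ⟨fun hv => h.not_vertex ⟨h1 _ _ hv.1, h1 _ _ hv.2⟩, fun hz => ?_, fun hz => ?_⟩
  · have hz2 : z.2 - round z.2 ≠ -1 / 2 := fun hz2 => h.not_vertex ⟨h1 _ _ hz, h1 _ _ hz2⟩
    have e := h.right (h1 _ _ hz)
    -- The half-turn makes the left edge a right edge, which the half-open convention gives to the
    -- next square.
    have e1 : rd (ofInt n - z) = n - (rd z - (1, 0)) := by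
      refine Prod.ext ?_ ?_
      · change round (n.1 - z.1) = n.1 - (round z.1 - 1)
        rw [round_int_sub_half hz]; ring
      · change round (n.2 - z.2) = n.2 - (round z.2 - 0)
        rw [round_int_sub hz2]; ring
    have e2 : n - (rd z - (1, 0)) - (1, 0) = n - rd z := by abel
    rw [e1, e2] at e
    simp only [e]
    rw [mul_assoc, mul_assoc, CubeIsom.j_mul_r, mul_inv_cancel_left]
  · have hz2 : z.1 - round z.1 ≠ -1 / 2 := fun hz2 => h.not_vertex ⟨h1 _ _ hz2, h1 _ _ hz⟩
    have e := h.up (h1 _ _ hz)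
    have e1 : rd (ofInt n - z) = n - (rd z - (0, 1)) := by
      refine Prod.ext ?_ ?_
      · change round (n.1 - z.1) = n.1 - (round z.1 - 0)
        rw [round_int_sub hz2]; ring
      · change round (n.2 - z.2) = n.2 - (round z.2 - 1)
        rw [round_int_sub_half hz]; ring
    have e2 : n - (rd z - (0, 1)) - (0, 1) = n - rd z := by abel
    rw [e1, e2] at e
    simp only [e]
    rw [mul_assoc, mul_assoc, CubeIsom.j_mul_u, mul_inv_cancel_left]

/-- The bounds of the strip add up to `p - q + 1`, so the hypothesis puts the centre of the
half-turn on the middle line of the strip. -/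
lemma flip_mem_strip {p q : ℤ} {n : ℤ × ℤ} (hn : p * n.2 - q * n.1 = p - q + 1) {z : Plane}
    (hz : z ∈ strip p q) : ofInt n - z ∈ strip p q := by
  have hn' : (p : ℝ) * n.2 - q * n.1 = p - q + 1 := by exact_mod_cast hn
  obtain ⟨h1, h2⟩ := hz
  have e : (p : ℝ) * (ofInt n - z).2 - q * (ofInt n - z).1 =
      p - q + 1 - (p * z.2 - q * z.1) := by
    simp only [ofInt, Prod.snd_sub, Prod.fst_sub]
    linear_combination hn'
  constructor <;> rw [e] <;> linarith

lemma flip_eq_of_mem_strip {p q : ℤ} {n : ℤ × ℤ} {z : Plane} (hz : z ∈ strip p q)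
    (hz' : ofInt n - z ∈ strip p q) : p * n.2 - q * n.1 = p - q + 1 := by
  obtain ⟨h1, h2⟩ := hz
  obtain ⟨h3, h4⟩ := hz'
  simp only [ofInt, Prod.snd_sub, Prod.fst_sub] at h3 h4
  apply int_eq_of_lt <;> push_cast <;> linarith

lemma exists_zsmul_of_mem_strip {p q : ℤ} (hpq : IsCoprime p q) {n : ℤ × ℤ} {z : Plane}
    (hz : z ∈ strip p q) (hz' : z + ofInt n ∈ strip p q) : ∃ k : ℤ, n = k • (p, q) := by
  apply exists_eq_zsmul hpq
  obtain ⟨h1, h2⟩ := hz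
  obtain ⟨h3, h4⟩ := hz'
  simp only [ofInt, Prod.snd_add, Prod.fst_add] at h3 h4
  apply int_eq_of_lt <;> push_cast <;> linarith

/-- The half-turns of a strip lift to motions that invert the holonomy. -/
lemma StripLabelling.exists_flip {p q : ℤ} (Λ : StripLabelling p q) (hpq : IsCoprime p q)
    (hne : (strip p q).Nonempty) :
    ∃ (n : ℤ × ℤ) (f : CubeIsom), p * n.2 - q * n.1 = p - q + 1 ∧ det f = 1 ∧
      f * Λ.hol = Λ.hol⁻¹ * f ∧
      ∀ z ∈ strip p q, Λ.label (n - rd z) * j = f * Λ.label (rd z) := by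
  obtain ⟨a, b, hab⟩ := hpq
  obtain ⟨n, hn⟩ : ∃ n : ℤ × ℤ, p * n.2 - q * n.1 = p - q + 1 :=
    ⟨((p - q + 1) * -b, (p - q + 1) * a), by linear_combination (p - q + 1) * hab⟩
  obtain ⟨f, hf⟩ := exists_mul_eq (isPreconnected_strip p q) Λ.compat
    (fun z hz => (Λ.compat _ (flip_mem_strip hn hz)).of_flip)
  obtain ⟨z, hz⟩ := hne
  have h1 := hf z hz
  refine ⟨n, f, hn, ?_, ?_, hf⟩
  · have := congrArg det h1
    rw [map_mul, map_mul, Λ.det_label, Λ.det_label, CubeIsom.det_j] at this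
    simpa using this.symm
  · have h2 := hf _ ((add_zsmul_mem_strip 1).2 hz)
    have e : n - (rd z + (1 : ℤ) • (p, q)) = n - rd z + (-1 : ℤ) • (p, q) := by
      rw [neg_smul]; abel
    rw [rd_add_ofInt, e, Λ.label_add_zsmul, Λ.label_add_zsmul, zpow_neg_one, zpow_one, mul_assoc,
      h1, ← mul_assoc, ← mul_assoc] at h2
    exact (mul_right_cancel h2).symm

/-- The developing map of a strip to `Y` is injective up to the holonomy. -/
lemma StripLabelling.eq_of_toY_eq {p q : ℤ} (Λ : StripLabelling p q) (hpq : IsCoprime p q)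
    (h4 : lin Λ.hol ^ 4 = 1) (h2 : lin Λ.hol ^ 2 ≠ 1) {z z' : Plane} (hz : z ∈ strip p q)
    (hz' : z' ∈ strip p q) (h : toY (devM Λ.label z) = toY (devM Λ.label z')) :
    ∃ k : ℤ, z' = z + ofInt ((4 * k) • (p, q)) := by
  obtain ⟨δ, hδ, hact⟩ := toY_eq_toY.1 h
  rcases dev_eq_dev Λ.det_label Λ.det_label (CubeIsom.det_of_mem_deck hδ) (Λ.compat z hz)
    (Λ.compat z' hz') hact.symm with ⟨n, rfl, hlab⟩ | ⟨n, rfl, hlab⟩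
  · obtain ⟨k, rfl⟩ := exists_zsmul_of_mem_strip hpq hz hz'
    rw [rd_add_ofInt, Λ.label_add_zsmul] at hlab
    obtain ⟨m, rfl⟩ := CubeIsom.zpow_mem_deck h4 h2 (mul_right_cancel hlab ▸ hδ)
    exact ⟨m, rfl⟩
  -- In the half-turn alternative `δ` would be a power of the holonomy times the flip `f`, which
  -- inverts the holonomy; no deck motion does so.
  · exfalso
    obtain ⟨n₀, f, hn₀, -, hfw, hf⟩ := Λ.exists_flip hpq ⟨z, hz⟩
    have hn := flip_eq_of_mem_strip hz hz'
    obtain ⟨k, hk⟩ := exists_eq_zsmul hpq (n := n - n₀) (by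
      rw [Prod.snd_sub, Prod.fst_sub]; linarith)
    have e : n - rd z = n₀ - rd z + k • (p, q) := by rw [← hk]; abel
    rw [e, Λ.label_add_zsmul, mul_assoc, hf z hz, ← mul_assoc] at hlab
    have hδf := mul_right_cancel hlab
    refine CubeIsom.not_inverts_of_mem_deck h4 h2 hδ ?_
    rw [← hδf, mul_assoc, hfw, ← mul_assoc, ← mul_assoc]
    congr 1
    rw [← zpow_neg_one, ← zpow_add, ← zpow_add, add_comm]

end Mucube

namespace Mucube

open CubeIsom (r u j det deck lin side transSum)

/-! ### Density of a strip -/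

lemma continuous_toY : Continuous toY :=
  continuous_quotient_mk'.comp continuous_quotient_mk'

lemma exists_toY_eq (y : Y) : ∃ p, toY p = y := by
  obtain ⟨x, rfl⟩ := Quotient.exists_rep y
  obtain ⟨p, rfl⟩ := Quotient.exists_rep x
  exact ⟨p, rfl⟩

lemma exists_even_of_cos_nonneg {x : ℝ} (h : 0 ≤ Real.cos (Real.pi * x)) :
    ∃ a : ℤ, |x - 2 * a| ≤ 1 / 2 := by
  have h1 := abs_sub_round_le x
  rcases Int.even_or_odd (round x) with ⟨a, ha⟩ | ha
  · refine ⟨a, ?_⟩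
    rw [ha] at h1
    push_cast at h1
    rwa [two_mul]
  · rw [cos_pi_mul_eq x (round x), ha.neg_one_zpow] at h
    have h2 := cos_pi_mul_nonneg h1
    have h3 : |x - round x| = 1 / 2 := by
      by_contra hne
      have := cos_pi_mul_pos (lt_of_le_of_ne h1 hne)
      linarith
    obtain ⟨a, ha⟩ := ha
    rw [ha] at h3
    push_cast at h3
    rcases eq_or_eq_neg_of_abs_eq h3 with h3 | h3
    · refine ⟨a + 1, ?_⟩
      push_cast
      rw [abs_le]; constructor <;> linarith
    · refine ⟨a, ?_⟩
      rw [abs_le]; constructor <;> linarith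

lemma exists_odd_of_cos_nonpos {x : ℝ} (h : Real.cos (Real.pi * x) ≤ 0) :
    ∃ a : ℤ, |x - (1 + 2 * a)| ≤ 1 / 2 := by
  obtain ⟨a, ha⟩ := exists_even_of_cos_nonneg (x := x - 1) (by
    have := cos_pi_one_add (x - 1)
    rw [add_sub_cancel] at this
    linarith)
  exact ⟨a, by rwa [← sub_sub]⟩

lemma exists_half_of_cos_eq_zero {x : ℝ} (h : Real.cos (Real.pi * x) = 0) :
    ∃ (e : ℤˣ) (a : ℤ), x = ((e : ℤ) : ℝ) * (1 / 2) + 2 * a := by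
  obtain ⟨a, ha⟩ := exists_even_of_cos_nonneg h.ge
  have h0 : Real.cos (Real.pi * (x - 2 * a)) = 0 := by
    have := cos_pi_mul_eq x (2 * a)
    rw [h, (even_two_mul a).neg_one_zpow, one_mul] at this
    push_cast at this
    exact this.symm
  have h3 : |x - 2 * a| = 1 / 2 := by
    by_contra hne
    exact (cos_pi_mul_pos (lt_of_le_of_ne ha hne)).ne' h0
  rcases eq_or_eq_neg_of_abs_eq h3 with h3 | h3
  · exact ⟨1, a, by push_cast; linarith⟩
  · exact ⟨-1, a, by push_cast; linarith⟩

/-- Three nonzero reals cannot have pairwise opposite signs, so one of them vanishes, and the other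
two are ordered by sign. -/
lemma exists_perm_of_pairwise_mul_nonpos {C : Fin 3 → ℝ} (h : ∀ i k, i ≠ k → C i * C k ≤ 0) :
    ∃ τ : Equiv.Perm (Fin 3), C (τ 0) ≤ 0 ∧ C (τ 1) = 0 ∧ 0 ≤ C (τ 2) := by
  have hmul : ∀ a b : ℝ, a * b ≤ 0 → (a ≤ 0 ∧ 0 ≤ b) ∨ (b ≤ 0 ∧ 0 ≤ a) := by
    intro a b hab
    rcases mul_nonpos_iff.1 hab with ⟨h1, h2⟩ | ⟨h1, h2⟩
    · exact Or.inr ⟨h2, h1⟩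
    · exact Or.inl ⟨h1, h2⟩
  have key : ∀ a b c : Fin 3, C b = 0 → a ≠ c → (∃ τ : Equiv.Perm (Fin 3), τ 0 = a ∧ τ 1 = b ∧
      τ 2 = c) → (∃ τ : Equiv.Perm (Fin 3), τ 0 = c ∧ τ 1 = b ∧ τ 2 = a) →
      ∃ τ : Equiv.Perm (Fin 3), C (τ 0) ≤ 0 ∧ C (τ 1) = 0 ∧ 0 ≤ C (τ 2) := by
    rintro a b c hb hac ⟨τ, h1, h2, h3⟩ ⟨τ', h1', h2', h3'⟩
    rcases hmul _ _ (h a c hac) with hc | hc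
    · exact ⟨τ, by rw [h1]; exact hc.1, by rw [h2, hb], by rw [h3]; exact hc.2⟩
    · exact ⟨τ', by rw [h1']; exact hc.1, by rw [h2', hb], by rw [h3']; exact hc.2⟩
  have h01 := h 0 1 (by decide)
  have h02 := h 0 2 (by decide)
  have h12 := h 1 2 (by decide)
  by_cases h0 : C 0 = 0
  · exact key 1 0 2 h0 (by decide) (by decide) (by decide)
  by_cases h1 : C 1 = 0
  · exact key 0 1 2 h1 (by decide) (by decide) (by decide)
  by_cases h2 : C 2 = 0
  · exact key 0 2 1 h2 (by decide) (by decide) (by decide)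
  exfalso
  rcases lt_or_gt_of_ne h0 with h0 | h0 <;> rcases lt_or_gt_of_ne h1 with h1 | h1 <;>
    rcases lt_or_gt_of_ne h2 with h2 | h2 <;>
    first
    | exact absurd (mul_pos_of_neg_of_neg h0 h1) (not_lt.2 h01)
    | exact absurd (mul_pos_of_neg_of_neg h0 h2) (not_lt.2 h02)
    | exact absurd (mul_pos_of_neg_of_neg h1 h2) (not_lt.2 h12)
    | exact absurd (mul_pos h0 h1) (not_lt.2 h01)
    | exact absurd (mul_pos h0 h2) (not_lt.2 h02)
    | exact absurd (mul_pos h1 h2) (not_lt.2 h12)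

/-- The Mucube is the union of its square faces. -/
lemma exists_pos_eq {p : R3} (hp : p ∈ mucube) :
    ∃ (γ : CubeIsom) (z : Plane), det γ = 1 ∧ |z.1| ≤ 1 / 2 ∧ |z.2| ≤ 1 / 2 ∧ p = pos γ z := by
  obtain ⟨τ, h0, h1, h2⟩ := exists_perm_of_pairwise_mul_nonpos (mem_mucube_iff.1 hp)
  obtain ⟨a, ha⟩ := exists_odd_of_cos_nonpos h0
  obtain ⟨e, c, hc⟩ := exists_half_of_cos_eq_zero h1
  obtain ⟨b, hb⟩ := exists_even_of_cos_nonneg h2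
  set e' : ℤˣ := Equiv.Perm.sign τ * e with he'
  have hee : ((e' : ℤ) : ℝ) * ((e' : ℤ) : ℝ) = 1 := by
    rcases units_cast_cases e' with h | h <;> rw [h] <;> norm_num
  refine ⟨⟨τ⁻¹, fun i => ![1, e, e'] (τ⁻¹ i), fun i => ![a, c, b] (τ⁻¹ i)⟩,
    (((e' : ℤ) : ℝ) * (p (τ 2) - 2 * b), p (τ 0) - (1 + 2 * a)), ?_, ?_, ha, ?_⟩
  · have hprod : ∏ i, (![1, e, e'] : Fin 3 → ℤˣ) (τ⁻¹ i) = ∏ i, (![1, e, e'] : Fin 3 → ℤˣ) i :=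
      Equiv.prod_comp τ⁻¹ _
    rw [CubeIsom.det_apply, hprod, Fin.prod_univ_three, Equiv.Perm.sign_inv]
    simp only [Matrix.cons_val, he']
    rcases Int.units_eq_one_or (Equiv.Perm.sign τ) with h | h <;>
      rcases Int.units_eq_one_or e with h' | h' <;> simp [h, h']
  · have : |((e' : ℤ) : ℝ)| = 1 := by rcases units_cast_cases e' with h | h <;> rw [h] <;> norm_num
    rw [abs_mul, this, one_mul]
    exact hb
  · have key : ∀ m, p (τ m) = pos ⟨τ⁻¹, fun i => ![1, e, e'] (τ⁻¹ i), fun i => ![a, c, b] (τ⁻¹ i)⟩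
        (((e' : ℤ) : ℝ) * (p (τ 2) - 2 * b), p (τ 0) - (1 + 2 * a)) (τ m) := by
      intro m
      have hm : τ⁻¹ (τ m) = m := τ.symm_apply_apply m
      simp only [pos_apply, hm]
      fin_cases m
      · change p (τ 0) = ((1 : ℤˣ) : ℤ) * (1 + (p (τ 0) - (1 + 2 * a))) + 2 * (a : ℝ)
        push_cast; ring
      · exact hc
      · change p (τ 2) = ((e' : ℤ) : ℝ) * (((e' : ℤ) : ℝ) * (p (τ 2) - 2 * b)) + 2 * (b : ℝ)
        rw [← mul_assoc, hee]; ring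
    funext i
    have := key (τ⁻¹ i)
    rwa [perm_apply_inv] at this

/-- A point of the closed unit square is a limit of interior points off the critical lines. -/
lemma exists_mem_of_mem_nhds {p q : ℤ} (hpq : (p : ℝ) ^ 2 + (q : ℝ) ^ 2 ≠ 0) {z : Plane}
    (h1 : |z.1| ≤ 1 / 2) (h2 : |z.2| ≤ 1 / 2) {U : Set Plane} (hU : U ∈ 𝓝 z) :
    ∃ w ∈ U, |w.1| < 1 / 2 ∧ |w.2| < 1 / 2 ∧
      ∀ c : ℤ, (p : ℝ) * w.2 - q * w.1 ≠ ((p : ℝ) - q) / 2 + c := by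
  let φ : Plane →L[ℝ] ℝ := (p : ℝ) • ContinuousLinearMap.snd ℝ ℝ ℝ -
    (q : ℝ) • ContinuousLinearMap.fst ℝ ℝ ℝ
  have hφ : ∀ w, φ w = (p : ℝ) * w.2 - q * w.1 := fun w => rfl
  have hopen : IsOpenMap φ := by
    apply φ.isOpenMap
    intro x
    refine ⟨(x / ((p : ℝ) ^ 2 + (q : ℝ) ^ 2)) • (-(q : ℝ), (p : ℝ)), ?_⟩
    rw [hφ]
    simp only [Prod.smul_mk, smul_eq_mul]
    field_simp
    ring
  have hd : Dense {w | φ w ∈ (range fun c : ℤ => ((p : ℝ) - q) / 2 + c)ᶜ} :=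
    ((countable_range _).dense_compl ℝ).preimage hopen
  have hz : z ∈ closure (Ioo (-1 / 2 : ℝ) (1 / 2) ×ˢ Ioo (-1 / 2 : ℝ) (1 / 2)) := by
    rw [closure_prod_eq, closure_Ioo (by norm_num)]
    rw [abs_le] at h1 h2
    constructor <;> constructor <;> linarith [h1.1, h1.2, h2.1, h2.2]
  have hz' := hd.open_subset_closure_inter
    ((isOpen_Ioo (a := (-1 / 2 : ℝ)) (b := 1 / 2)).prod
      (isOpen_Ioo (a := (-1 / 2 : ℝ)) (b := 1 / 2)))
  have hz'' := closure_minimal hz' isClosed_closure hz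
  obtain ⟨w, hw, ⟨hw1, hw2⟩, hw3⟩ := mem_closure_iff_nhds.1 hz'' U hU
  refine ⟨w, hw, ?_, ?_, fun c hc => hw3 ⟨c, ?_⟩⟩
  · rw [abs_lt]; constructor <;> linarith [hw1.1, hw1.2]
  · rw [abs_lt]; constructor <;> linarith [hw2.1, hw2.2]
  · exact hc.symm

/-- By Bézout the form `p y - q x` takes every integral value on integral vectors, so integral
translations permute the strips of this direction transitively. -/
lemma exists_add_mem_strip {p q : ℤ} (hpq : IsCoprime p q) {w : Plane}
    (hw : ∀ c : ℤ, (p : ℝ) * w.2 - q * w.1 ≠ ((p : ℝ) - q) / 2 + c) :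
    ∃ n, w + ofInt n ∈ strip p q := by
  obtain ⟨a, b, hab⟩ := hpq
  have hab' : (a : ℝ) * p + b * q = 1 := by exact_mod_cast hab
  set X := (p : ℝ) * w.2 - q * w.1 - ((p : ℝ) - q) / 2 with hX
  refine ⟨(⌊X⌋ * b, -⌊X⌋ * a), ?_⟩
  have e : (p : ℝ) * (w + ofInt (⌊X⌋ * b, -⌊X⌋ * a)).2 - q * (w + ofInt (⌊X⌋ * b, -⌊X⌋ * a)).1 =
      X + ((p : ℝ) - q) / 2 - ⌊X⌋ := by
    simp only [ofInt, Prod.snd_add, Prod.fst_add, Int.cast_mul, Int.cast_neg]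
    rw [hX]
    linear_combination (-(⌊X⌋ : ℝ)) * hab'
  have h1 := Int.floor_le X
  have h2 := Int.lt_floor_add_one X
  have h3 : (⌊X⌋ : ℝ) ≠ X := fun h => hw ⌊X⌋ (by rw [h, hX]; ring)
  have h4 := lt_of_le_of_ne h1 h3
  constructor <;> rw [e] <;> linarith

/-- A strip whose holonomy is a quarter-turn is dense in `Y`. -/
lemma StripLabelling.dense {p q : ℤ} (Λ : StripLabelling p q) (hpq : IsCoprime p q)
    (h4 : lin Λ.hol ^ 4 = 1) (h2 : lin Λ.hol ^ 2 ≠ 1) :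
    Dense {y | ∃ z ∈ strip p q, toY (devM Λ.label z) = y} := by
  have hs : (p : ℝ) ^ 2 + (q : ℝ) ^ 2 ≠ 0 := by
    have : p ^ 2 + q ^ 2 ≠ 0 := by
      intro h0
      have hp : p = 0 := by nlinarith [sq_nonneg p, sq_nonneg q]
      have hq : q = 0 := by nlinarith [sq_nonneg p, sq_nonneg q]
      rw [hp, hq] at hpq
      exact not_isCoprime_zero_zero hpq
    exact_mod_cast this
  rw [dense_iff_inter_open]
  rintro U hU ⟨y, hy⟩
  obtain ⟨⟨x, hx⟩, rfl⟩ := exists_toY_eq y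
  obtain ⟨W, hW, hWU⟩ := isOpen_induced_iff.1 (hU.preimage continuous_toY)
  obtain ⟨γ, z, hγ, h1, h2', rfl⟩ := exists_pos_eq hx
  have hxW : pos γ z ∈ W := by
    have : (⟨pos γ z, hx⟩ : M) ∈ Subtype.val ⁻¹' W := by rw [hWU]; exact hy
    exact this
  obtain ⟨w, hw, hw1, hw2, hwc⟩ := exists_mem_of_mem_nhds hs h1 h2'
    ((continuous_pos γ).continuousAt.preimage_mem_nhds (hW.mem_nhds hxW))
  have hwM := pos_mem_mucube γ hw1.le hw2.le
  have hwU : toY ⟨pos γ w, hwM⟩ ∈ U := by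
    have : (⟨pos γ w, hwM⟩ : M) ∈ toY ⁻¹' U := by rw [← hWU]; exact hw
    exact this
  refine ⟨_, hwU, ?_⟩
  obtain ⟨n, hn⟩ := exists_add_mem_strip hpq hwc
  rw [abs_lt] at hw1 hw2
  have hrd : rd w = 0 := by
    refine Prod.ext (round_eq_of_mem ?_) (round_eq_of_mem ?_) <;>
      simp only [Prod.fst_zero, Prod.snd_zero, Int.cast_zero, sub_zero] <;>
      constructor <;> linarith
  have hloc : loc w = w := by
    have := ofInt_rd_add_loc w
    rwa [hrd, show ofInt 0 = 0 by simp [ofInt], zero_add] at this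
  obtain ⟨n₀, f, hn₀, hfd, hfw, hf⟩ := Λ.exists_flip hpq ⟨_, hn⟩
  set γ₀ := Λ.label n with hγ₀
  have hdev : dev Λ.label (w + ofInt n) = pos γ₀ w := by
    rw [dev, rd_add_ofInt, loc_add_ofInt, hrd, hloc, zero_add]
  -- Over the square of `w` the strip carries the labels of the powers of the holonomy and, after
  -- the half-turn, those composed with `f`. Together they meet the deck coset of the given face.
  obtain ⟨k, hk | hk⟩ := CubeIsom.mem_deck_mul (c := γ * γ₀⁻¹) h4 h2 Λ.det_hol hfw hfd
    (by rw [map_mul, map_inv, hγ, Λ.det_label]; rfl)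
  · refine ⟨w + ofInt n + ofInt ((-k : ℤ) • (p, q)), (add_zsmul_mem_strip _).2 hn, ?_⟩
    rw [toY_eq_toY]
    refine ⟨_, hk, ?_⟩
    change pos γ w = act _ (dev _ _)
    rw [Λ.dev_add_zsmul, hdev, ← act_mul, act_pos]
    congr 1
    rw [zpow_neg, zpow_natCast]
    group
  · refine ⟨ofInt n₀ - (w + ofInt n) + ofInt ((-k : ℤ) • (p, q)),
      (add_zsmul_mem_strip _).2 (flip_mem_strip hn₀ hn), ?_⟩
    rw [toY_eq_toY]
    refine ⟨_, hk, ?_⟩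
    change pos γ w = act _ (dev _ _)
    have hfl := hf _ hn
    rw [rd_add_ofInt, hrd, zero_add] at hfl
    have hround : ∀ x : ℝ, -(1 / 2) < x → x < 1 / 2 → x - round x ≠ -1 / 2 := by
      intro x hx1 hx2 hx3
      have : round x = 0 := round_eq_of_mem (by
        rw [Int.cast_zero, sub_zero]; constructor <;> linarith)
      rw [this, Int.cast_zero, sub_zero] at hx3
      linarith
    have e1 : ofInt n₀ - (w + ofInt n) = -w + ofInt (n₀ - n) := by
      rw [ofInt_sub]; abel
    have hrd' : rd (-w) = 0 := by
      refine Prod.ext (round_eq_of_mem ?_) (round_eq_of_mem ?_) <;>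
        simp only [Prod.fst_zero, Prod.snd_zero, Int.cast_zero, sub_zero, Prod.fst_neg,
          Prod.snd_neg] <;>
        constructor <;> linarith
    have hloc' : loc (-w) = -w := by
      have := ofInt_rd_add_loc (-w)
      rwa [hrd', show ofInt 0 = 0 by simp [ofInt], zero_add] at this
    have hdev' : dev Λ.label (ofInt n₀ - (w + ofInt n)) = pos (f * γ₀) w := by
      rw [e1, dev, rd_add_ofInt, loc_add_ofInt, hrd', hloc', zero_add, ← hfl, pos_mul_j]
    rw [Λ.dev_add_zsmul, hdev', ← act_mul, act_pos]
    congr 1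
    rw [zpow_neg, zpow_natCast]
    group

end Mucube

namespace Mucube

open CubeIsom (r u j det deck lin side transSum)

/-! ### From periodic directions to single cylinders -/

lemma sq_add_sq_pos {v : Plane} (hv : v ≠ 0) : 0 < v.1 ^ 2 + v.2 ^ 2 := by
  by_contra hc
  have h1 : v.1 = 0 := by nlinarith [sq_nonneg v.1, sq_nonneg v.2]
  have h2 : v.2 = 0 := by nlinarith [sq_nonneg v.1, sq_nonneg v.2]
  exact hv (Prod.ext h1 h2)

lemma exists_coord {v : Plane} (hv : v ≠ 0) (z₀ z : Plane) :
    ∃ s y : ℝ, z = z₀ + s • v + y • (-v.2, v.1) := by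
  have h := (sq_add_sq_pos hv).ne'
  refine ⟨((z.1 - z₀.1) * v.1 + (z.2 - z₀.2) * v.2) / (v.1 ^ 2 + v.2 ^ 2),
    ((z.2 - z₀.2) * v.1 - (z.1 - z₀.1) * v.2) / (v.1 ^ 2 + v.2 ^ 2), ?_⟩
  ext
  · simp only [Prod.fst_add, Prod.smul_fst, smul_eq_mul]
    field_simp
    ring
  · simp only [Prod.snd_add, Prod.smul_snd, smul_eq_mul]
    field_simp
    ring

lemma eq_of_coord {v : Plane} (hv : v ≠ 0) {s y s' y' : ℝ}
    (h : s • v + y • ((-v.2, v.1) : Plane) = s' • v + y' • ((-v.2, v.1) : Plane)) :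
    s = s' ∧ y = y' := by
  have hs := (sq_add_sq_pos hv).ne'
  have h1 := congrArg Prod.fst h
  have h2 := congrArg Prod.snd h
  simp only [Prod.fst_add, Prod.snd_add, Prod.smul_fst, Prod.smul_snd, smul_eq_mul] at h1 h2
  constructor <;> apply mul_right_cancel₀ hs
  · linear_combination v.1 * h1 + v.2 * h2
  · linear_combination v.1 * h2 - v.2 * h1

lemma IsRationalDirection.exists_strip_coord {v : Plane} {p q : ℤ} {lam : ℝ}
    (h : IsRationalDirection v p q lam) : ∃ (z₀ : Plane) (w : ℝ), 0 < w ∧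
      ∀ s y : ℝ, z₀ + s • v + y • ((-v.2, v.1) : Plane) ∈ strip p q ↔ y ∈ Ioo 0 w := by
  have hS := h.sq_pos
  have hl := h.ne_zero
  set S := (p : ℝ) ^ 2 + (q : ℝ) ^ 2 with hSdef
  have key : ∀ c s y : ℝ, p * ((c / S) • ((-(q : ℝ), (p : ℝ)) : Plane) + s • v +
      y • ((-v.2, v.1) : Plane)).2 - q * ((c / S) • ((-(q : ℝ), (p : ℝ)) : Plane) + s • v +
      y • ((-v.2, v.1) : Plane)).1 = c + y * (lam * S) := by
    intro c s y
    simp only [Prod.fst_add, Prod.snd_add, Prod.smul_fst, Prod.smul_snd, smul_eq_mul, h.fst_eq,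
      h.snd_eq]
    have : c / S * S = c := div_mul_cancel₀ _ hS.ne'
    rw [hSdef] at this ⊢
    linear_combination this
  -- For negative `lam` the direction `v` rotated by `π / 2` decreases the form `p y - q x`, so the
  -- base point is put on the upper boundary line.
  rcases lt_or_gt_of_ne hl with hneg | hpos
  · refine ⟨((((p : ℝ) - q) / 2 + 1) / S) • (-(q : ℝ), (p : ℝ)), 1 / (-(lam * S)), ?_,
      fun s y => ?_⟩
    · have := mul_neg_of_neg_of_pos hneg hS
      exact one_div_pos.2 (by linarith)
    · have hlS := mul_neg_of_neg_of_pos hneg hS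
      rw [strip, mem_ofPred_eq, key, mem_Ioo, lt_div_iff₀ (by linarith)]
      constructor
      · rintro ⟨h1, h2⟩
        constructor
        · nlinarith
        · linarith
      · rintro ⟨h1, h2⟩
        constructor
        · linarith
        · nlinarith
  · refine ⟨((((p : ℝ) - q) / 2) / S) • (-(q : ℝ), (p : ℝ)), 1 / (lam * S), by positivity,
      fun s y => ?_⟩
    have hlS := mul_pos hpos hS
    rw [strip, mem_ofPred_eq, key, mem_Ioo, lt_div_iff₀ hlS]
    constructor
    · rintro ⟨h1, h2⟩
      constructor
      · by_contra hc
        nlinarith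
      · linarith
    · rintro ⟨h1, h2⟩
      constructor
      · nlinarith
      · linarith

lemma exists_chart_toY {L : Labelling} (hL : ∀ m, det (L m) = 1) {v z₀ : Plane} {s y : ℝ}
    (h : CompatAt L (z₀ + s • v + y • ((-v.2, v.1) : Plane))) :
    ∃ φ ∈ atlasY, ∃ z : Plane, ∀ᶠ w : ℝ × ℝ in 𝓝 (s, y),
      z + w.1 • v + w.2 • (-v.2, v.1) ∈ φ.domain ∧
        toY (devM L (z₀ + w.1 • v + w.2 • (-v.2, v.1))) =
          φ.map (z + w.1 • v + w.2 • (-v.2, v.1)) := by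
  obtain ⟨φ, hφ, n, hn⟩ := exists_chart hL h
  have hcont : Tendsto (fun w : ℝ × ℝ => z₀ + w.1 • v + w.2 • ((-v.2, v.1) : Plane)) (𝓝 (s, y))
      (𝓝 (z₀ + s • v + y • ((-v.2, v.1) : Plane))) :=
    (show Continuous (fun w : ℝ × ℝ => z₀ + w.1 • v + w.2 • ((-v.2, v.1) : Plane)) by
      fun_prop).tendsto (s, y)
  refine ⟨_, ⟨φ, hφ, rfl⟩, z₀ - ofInt n, ?_⟩
  filter_upwards [hcont.eventually hn] with w hw
  have e : z₀ - ofInt n + w.1 • v + w.2 • ((-v.2, v.1) : Plane) =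
      z₀ + w.1 • v + w.2 • ((-v.2, v.1) : Plane) - ofInt n := by abel
  rw [e]
  exact ⟨hw.1, congrArg toY hw.2⟩

/-- A strip whose holonomy is a torsion quarter-turn closes up to a single cylinder. -/
lemma IsRationalDirection.exists_isSingleCylinder {v : Plane} {p q : ℤ} {lam : ℝ}
    (h : IsRationalDirection v p q lam) (Λ : StripLabelling p q) (h4 : lin Λ.hol ^ 4 = 1)
    (h2 : lin Λ.hol ^ 2 ≠ 1) (hw : Λ.hol ^ 4 = 1) :
    ∃ (ℓ w : ℝ) (Φ : ℝ → ℝ → Y), IsSingleCylinder atlasY v ℓ w Φ ∧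
      intersectionNumber ℓ (fun s => Φ s (w / 2)) = 0 := by
  obtain ⟨z₀, w, hwpos, hstrip⟩ := h.exists_strip_coord
  have hv := h.ne_zero'
  -- The cylinder closes after four periods `(p, q)` of the strip; the sign of `N` makes the
  -- circumference positive.
  obtain ⟨N, hN, hNlam⟩ : ∃ N : ℤ, (N = 4 ∨ N = -4) ∧ 0 < (N : ℝ) / lam := by
    rcases lt_or_gt_of_ne h.ne_zero with hl | hl
    · exact ⟨-4, Or.inr rfl, div_pos_of_neg_of_neg (by norm_num) hl⟩
    · exact ⟨4, Or.inl rfl, div_pos (by norm_num) hl⟩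
  have hNabs : Λ.hol ^ N.natAbs = 1 := by rcases hN with rfl | rfl <;> exact hw
  have hNz : ∀ n : ℤ, Λ.hol ^ (n * N) = 1 := by
    intro n
    rw [mul_comm, zpow_mul, pow_natAbs_eq_one.1 hNabs, one_zpow]
  refine ⟨(N : ℝ) / lam, w, fun s y => toY (devM Λ.label (z₀ + s • v + y • (-v.2, v.1))),
    ⟨⟨hNlam, hwpos, fun s y hy => ?_, fun s s' y hy y' hy' => ⟨fun heq => ?_, ?_⟩⟩, ?_⟩, ?_⟩
  · exact exists_chart_toY Λ.det_label (Λ.compat _ ((hstrip s y).2 hy))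
  · obtain ⟨k, hk⟩ := Λ.eq_of_toY_eq h.coprime h4 h2 ((hstrip s y).2 hy) ((hstrip s' y').2 hy') heq
    rw [← h.smul_eq] at hk
    have e : s' • v + y' • ((-v.2, v.1) : Plane) =
        (s + ((4 * k : ℤ) : ℝ) / lam) • v + y • ((-v.2, v.1) : Plane) := by
      rw [add_smul]
      linear_combination (exp := 1) hk
    obtain ⟨e1, e2⟩ := eq_of_coord hv e
    refine ⟨e2.symm, ?_⟩
    rcases hN with rfl | rfl
    · exact ⟨k, by rw [e1]; push_cast; ring⟩
    · exact ⟨-k, by rw [e1]; push_cast; ring⟩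
  · rintro ⟨rfl, n, rfl⟩
    have e : z₀ + (s + n * ((N : ℝ) / lam)) • v + y • ((-v.2, v.1) : Plane) =
        z₀ + s • v + y • ((-v.2, v.1) : Plane) + ofInt ((n * N) • (p, q)) := by
      rw [← h.smul_eq, add_smul]
      push_cast
      rw [mul_div_assoc]
      abel
    beta_reduce
    rw [e]
    congr 1
    apply Subtype.ext
    change dev _ _ = dev _ _
    rw [Λ.dev_add_zsmul, hNz, act_one]
  · refine (Λ.dense h.coprime h4 h2).mono ?_
    rintro _ ⟨z, hz, rfl⟩
    obtain ⟨s, y, rfl⟩ := exists_coord hv z₀ z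
    exact ⟨s, y, (hstrip s y).1 hz, rfl⟩
  · have hmid : z₀ + (w / 2) • ((-v.2, v.1) : Plane) ∈ strip p q := by
      have := (hstrip 0 (w / 2)).2 ⟨by linarith, by linarith⟩
      rwa [zero_smul, add_zero] at this
    have e : (fun s : ℝ => toY (devM Λ.label (z₀ + s • v + (w / 2) • (-v.2, v.1)))) =
        fun s : ℝ => toY (devM (Λ.label.mul 1)
          (z₀ + (w / 2) • ((-v.2, v.1) : Plane) + s • v)) := by
      funext s
      have e1 : Λ.label.mul 1 = Λ.label := by
        funext m; exact one_mul _
      rw [e1, add_right_comm]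
    simp only [e]
    rcases Λ.rows with ⟨hq, -⟩ | ⟨hq, hr, hlab, hh, hhol⟩
    · exact h.intersectionNumber_of_horizontal Λ 1 hmid hq _
    · obtain ⟨η, hη⟩ := h.intersectionNumber_eq hq hlab hh hhol (g := 1) hmid hNlam
        (div_mul_cancel₀ (N : ℝ) h.ne_zero)
        (by rw [hNabs, one_mul, inv_one, mul_one]; exact deck.one_mem)
      rw [hη, hNabs]
      simp [transSum]

lemma exists_isSingleCylinder_of_isPeriodicDirection {v : Plane} (hv : v ≠ 0)
    (hper : IsPeriodicDirection v) : ∃ (ℓ w : ℝ) (Φ : ℝ → ℝ → Y),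
      IsSingleCylinder atlasY v ℓ w Φ ∧ intersectionNumber ℓ (fun s => Φ s (w / 2)) = 0 := by
  obtain ⟨p, q, lam, h⟩ := exists_isRationalDirection_of_isPeriodicDirection hv hper
  obtain ⟨Λ⟩ := exists_stripLabelling h.coprime h.pos
  obtain ⟨h4, h2, hw⟩ := h.hol_of_isPeriodicDirection Λ hper
  exact h.exists_isSingleCylinder Λ h4 h2 hw

end Mucube

namespace Mucube

open CubeIsom (r u j det deck lin side transSum)

/-! ### Counting cosets of the deck group -/

/-- If the deck group, the powers of `a` and a single element `f` exhaust the rotation group of the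
cube, then `a` is a quarter-turn. -/
lemma CubeIsom.quarter_turn_of_covers {a g f : CubeIsom} (ha : det a = 1)
    (hcov : ∀ c, det c = 1 → ∃ δ ∈ deck, ∃ k : ℤ, c = δ * g * a ^ k ∨ c = δ * g * a ^ k * f) :
    lin a ^ 4 = 1 ∧ lin a ^ 2 ≠ 1 := by
  -- With order at most 3 the products number at most 3 · 3 · 2 = 18, fewer than the 24 rotations.
  have key : ∀ n : ℤ, 0 < n → n ≤ 3 → lin a ^ n ≠ 1 := by
    intro n hn hn3 han
    let O : Finset (Equiv.Perm (Fin 3) × (Fin 3 → ℤˣ)) :=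
      Finset.univ.filter fun x => det ⟨x.1, x.2, 0⟩ = 1
    let A : Finset (Equiv.Perm (Fin 3)) := Finset.univ.filter fun σ => Equiv.Perm.sign σ = 1
    let F : Equiv.Perm (Fin 3) × ℕ × Bool → CubeIsom := fun x =>
      ⟨x.1, 1, 0⟩ * lin g * lin a ^ x.2.1 * (if x.2.2 then lin f else 1)
    have hO : O.card = 24 := by decide +kernel
    have hA : A.card = 3 := by decide +kernel
    have hsub : O.image (fun x => (⟨x.1, x.2, 0⟩ : CubeIsom)) ⊆
        (A ×ˢ Finset.range 3 ×ˢ (Finset.univ : Finset Bool)).image F := by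
      intro c hc
      obtain ⟨x, hx, rfl⟩ := Finset.mem_image.1 hc
      obtain ⟨δ, hδ, k, hk⟩ := hcov _ (Finset.mem_filter.1 hx).2
      have hδ' : lin δ = ⟨δ.perm, 1, 0⟩ := by rw [← hδ.1]; rfl
      have hpow : lin a ^ k = lin a ^ (k % n).toNat := by
        rw [← zpow_natCast, Int.toNat_of_nonneg (Int.emod_nonneg k hn.ne')]
        conv_lhs => rw [← Int.emod_add_mul_ediv k n, zpow_add, zpow_mul, han, one_zpow, mul_one]
      have hlt : (k % n).toNat ∈ Finset.range 3 := by
        have := Int.emod_lt_of_pos k hn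
        rw [Finset.mem_range]
        omega
      have hmem : δ.perm ∈ A := by simpa [A] using hδ.2
      rw [Finset.mem_image]
      rcases hk with hk | hk
      · refine ⟨(δ.perm, (k % n).toNat, false), by simp [hmem, Finset.mem_range.1 hlt], ?_⟩
        have := congrArg lin hk
        simp only [map_mul, map_zpow, hδ', hpow] at this
        simp only [F, Bool.false_eq_true, if_false, mul_one]
        exact this.symm
      · refine ⟨(δ.perm, (k % n).toNat, true), by simp [hmem, Finset.mem_range.1 hlt], ?_⟩
        have := congrArg lin hk
        simp only [map_mul, map_zpow, hδ', hpow] at this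
        simp only [F, if_true]
        exact this.symm
    have h1 := Finset.card_le_card hsub
    rw [Finset.card_image_of_injective _ (by
      rintro ⟨σ, ε⟩ ⟨σ', ε'⟩ h
      have h1 := congrArg CubeIsom.perm h
      have h2 := congrArg CubeIsom.sgn h
      exact Prod.ext h1 h2), hO] at h1
    have h2 := Finset.card_image_le (s := A ×ˢ Finset.range 3 ×ˢ (Finset.univ : Finset Bool))
      (f := F)
    rw [Finset.card_product, Finset.card_product, hA, Finset.card_range, Finset.card_univ,
      Fintype.card_bool] at h2
    omega
  rcases CubeIsom.lin_pow_cases a ha with h | h | h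
  · exact absurd (by exact_mod_cast h) (key 2 (by norm_num) (by norm_num))
  · exact absurd (by exact_mod_cast h) (key 3 (by norm_num) (by norm_num))
  · exact h

/-! ### Dense subsets of `Y` -/

lemma isOpen_of_isOpen_toY_preimage {U : Set Y} (h : IsOpen (toY ⁻¹' U)) : IsOpen U := by
  have h1 : IsOpen ((Quotient.mk _ : X → Y) ⁻¹' U) := by
    have h2 : IsOpen ((Quotient.mk _ : M → X) ⁻¹' ((Quotient.mk _ : X → Y) ⁻¹' U)) := h
    exact isQuotientMap_quotient_mk'.isOpen_preimage.1 h2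
  exact isQuotientMap_quotient_mk'.isOpen_preimage.1 h1

lemma continuous_act (γ : CubeIsom) : Continuous (act γ) := by
  refine continuous_pi fun i => ?_
  simp only [act_apply]
  fun_prop

/-- The union of the deck translates of `W` is open and saturated, so it descends to an open subset
of `Y`. A point of `D` found there is moved back into `W` by a deck motion. -/
lemma exists_toY_mem_of_dense {D : Set Y} (hD : Dense D) {W : Set R3} (hW : IsOpen W) {x : R3}
    (hx : x ∈ mucube) (hxW : x ∈ W) : ∃ p : M, p.1 ∈ W ∧ toY p ∈ D := by
  set V : Set M := {p | ∃ δ ∈ deck, act δ p.1 ∈ W} with hV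
  have hVopen : IsOpen V := by
    have e : V = ⋃ δ ∈ deck, (fun p : M => act δ p.1) ⁻¹' W := by
      ext p; simp [hV]
    rw [e]
    exact isOpen_biUnion fun δ _ => hW.preimage ((continuous_act δ).comp continuous_subtype_val)
  have hpre : toY ⁻¹' (toY '' V) = V := by
    refine Subset.antisymm ?_ (subset_preimage_image _ _)
    rintro p ⟨p', ⟨δ, hδ, hW'⟩, h⟩
    obtain ⟨δ', hδ', h'⟩ := toY_eq_toY.1 h.symm
    exact ⟨δ * δ', deck.mul_mem hδ hδ', by rw [act_mul, ← h']; exact hW'⟩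
  obtain ⟨y, ⟨p, ⟨δ, hδ, hp⟩, rfl⟩, hyD⟩ := hD.inter_open_nonempty (toY '' V)
    (isOpen_of_isOpen_toY_preimage (by rwa [hpre]))
    ⟨_, mem_image_of_mem toY (show (⟨x, hx⟩ : M) ∈ V from
      ⟨1, deck.one_mem, by simpa using hxW⟩)⟩
  refine ⟨⟨act δ p.1, act_mem_mucube p.2⟩, hp, ?_⟩
  have : toY ⟨act δ p.1, act_mem_mucube p.2⟩ = toY p :=
    (toY_eq_toY.2 ⟨δ, hδ, rfl⟩).symm
  rwa [this]

/-- Near the interior of a face the Mucube is this face. -/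
lemma exists_open_of_face (γ : CubeIsom) {B : Set Plane} (hB : IsOpen B)
    (hB' : ∀ x ∈ B, |x.1| < 1 / 2 ∧ |x.2| < 1 / 2) {x : Plane} (hx : x ∈ B) :
    ∃ W : Set R3, IsOpen W ∧ pos γ x ∈ W ∧ ∀ p ∈ mucube, p ∈ W → ∃ x ∈ B, p = pos γ x := by
  refine ⟨act γ⁻¹ ⁻¹' {p | ((p 2, p 0 - 1) : Plane) ∈ B ∧ 0 < p 1 ∧ p 1 < 1},
    IsOpen.preimage (continuous_act _) ?_, ?_, ?_⟩
  · refine IsOpen.inter (hB.preimage (by fun_prop)) (IsOpen.inter ?_ ?_)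
    · exact isOpen_lt continuous_const (continuous_apply 1)
    · exact isOpen_lt (continuous_apply 1) continuous_const
  · rw [mem_preimage, pos, act_inv_act]
    refine ⟨?_, ?_, ?_⟩
    · simpa using hx
    · simp
    · simp only [Matrix.cons_val]
      norm_num
  · rintro p hp ⟨h1, h2, h3⟩
    have hq := mem_mucube_iff.1 (act_mem_mucube (γ := γ⁻¹) hp)
    set p' := act γ⁻¹ p with hp'
    obtain ⟨b1, b2⟩ := hB' _ h1
    have c2 := cos_pi_mul_pos b1
    have c0 := cos_pi_mul_pos b2
    have c0' := cos_pi_one_add (p' 0 - 1)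
    rw [add_sub_cancel] at c0'
    simp only at c2 c0
    have d1 := hq 1 0 (by decide)
    have d2 := hq 1 2 (by decide)
    rw [c0'] at d1
    -- The other two cosines have strictly opposite signs, which forces the third to vanish.
    have hc : Real.cos (Real.pi * p' 1) = 0 := by
      apply le_antisymm
      · exact nonpos_of_mul_nonpos_left d2 c2
      · nlinarith
    have hhalf : p' 1 = 1 / 2 := by
      obtain ⟨e, a, ha⟩ := exists_half_of_cos_eq_zero hc
      rcases units_cast_cases e with he | he
      · rw [he] at ha
        have : a = 0 := int_eq_of_lt (by push_cast; linarith) (by push_cast; linarith)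
        rw [ha, this]; norm_num
      · rw [he] at ha
        rw [ha] at h2 h3
        have h2 : (0 : ℝ) < ((4 * a - 1 : ℤ) : ℝ) := by push_cast; linarith
        have h3 : ((4 * a - 1 : ℤ) : ℝ) < ((2 : ℤ) : ℝ) := by push_cast; linarith
        have h2 := Int.cast_pos.1 h2
        have h3 := Int.cast_lt.1 h3
        omega
    refine ⟨_, h1, ?_⟩
    have hpp : p = act γ p' := by rw [hp', ← act_mul, mul_inv_cancel, act_one]
    rw [hpp, pos]
    congr 1
    funext i
    fin_cases i
    · simp
    · exact hhalf
    · rfl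

lemma isOpen_strip (p q : ℤ) : IsOpen (strip p q) := by
  have h : Continuous fun z : Plane => (p : ℝ) * z.2 - q * z.1 := by fun_prop
  exact (isOpen_lt continuous_const h).inter (isOpen_lt h continuous_const)

/-- If a strip is dense in `Y`, then its holonomy is a quarter-turn. -/
lemma StripLabelling.quarter_turn_of_dense {p q : ℤ} (Λ : StripLabelling p q)
    (hpq : IsCoprime p q) (hs : (p : ℝ) ^ 2 + (q : ℝ) ^ 2 ≠ 0) {g : CubeIsom} (hg : det g = 1)
    (hD : Dense {y | ∃ z ∈ strip p q, toY (devM (Λ.label.mul g) z) = y}) :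
    lin Λ.hol ^ 4 = 1 ∧ lin Λ.hol ^ 2 ≠ 1 := by
  obtain ⟨w, -, hw1, hw2, hwc⟩ := exists_mem_of_mem_nhds hs (z := 0) (by simp) (by simp) univ_mem
  obtain ⟨n, hn⟩ := exists_add_mem_strip hpq hwc
  obtain ⟨n₀, f, hn₀, hfd, hfw, hf⟩ := Λ.exists_flip hpq ⟨_, hn⟩
  set B : Set Plane := {x | (|x.1| < 1 / 2 ∧ |x.2| < 1 / 2) ∧ x + ofInt n ∈ strip p q} with hBdef
  have hB : IsOpen B := by
    refine IsOpen.inter (IsOpen.inter ?_ ?_) ((isOpen_strip p q).preimage (by fun_prop))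
    · exact isOpen_lt (continuous_fst.abs) continuous_const
    · exact isOpen_lt (continuous_snd.abs) continuous_const
  have hint : ∀ x ∈ B, rd x = 0 ∧ loc x = x := by
    rintro x ⟨⟨h1, h2⟩, -⟩
    rw [abs_lt] at h1 h2
    have hrd : rd x = 0 := by
      refine Prod.ext (round_eq_of_mem ?_) (round_eq_of_mem ?_) <;>
        simp only [Prod.fst_zero, Prod.snd_zero, Int.cast_zero, sub_zero] <;>
        constructor <;> linarith
    refine ⟨hrd, ?_⟩
    have := ofInt_rd_add_loc x
    rwa [hrd, show ofInt 0 = 0 by simp [ofInt], zero_add] at this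
  apply CubeIsom.quarter_turn_of_covers (g := g) (f := f) Λ.det_hol
  -- Each rotation `c` moves one fixed square of the strip to some face. By density the strip passes
  -- over this face, and the label with which it does so expresses `c` by a deck motion, a power of
  -- the holonomy and possibly the flip.
  intro c hc
  set γ := c * Λ.label n with hγ
  have hγd : det γ = 1 := by rw [hγ, map_mul, hc, Λ.det_label]; rfl
  obtain ⟨W, hW, hwW, hWB⟩ := exists_open_of_face γ hB (fun x hx => hx.1)
    (show w ∈ B from ⟨⟨hw1, hw2⟩, hn⟩)
  obtain ⟨P, hPW, z, hz, hzP⟩ := exists_toY_mem_of_dense hD hW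
    (pos_mem_mucube γ hw1.le hw2.le) hwW
  obtain ⟨x, hxB, hPx⟩ := hWB P.1 P.2 hPW
  obtain ⟨δ, hδ, hact⟩ := toY_eq_toY.1 hzP
  obtain ⟨hrd, hloc⟩ := hint x hxB
  have hcomp : CompatAt (fun _ => γ) x := by
    have h1 := abs_lt.1 hxB.1.1
    have h2 := abs_lt.1 hxB.1.2
    refine ⟨fun h => ?_, fun h => ?_, fun h => ?_⟩ <;> rw [hloc] at h
    · linarith [h.1]
    · linarith
    · linarith
  have hdev : act δ (dev (Λ.label.mul g) z) = dev (fun _ => γ) x := by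
    rw [dev.eq_def (fun _ => γ), hloc, ← hPx, hact]
    rfl
  rcases dev_eq_dev (fun m => by rw [Labelling.mul, map_mul, hg, Λ.det_label]; rfl)
    (fun _ => hγd) (CubeIsom.det_of_mem_deck hδ) ((Λ.compat z hz).mul g) hcomp hdev with
    ⟨m, hm, hlab⟩ | ⟨m, hm, hlab⟩
  · have e : x + ofInt n = z + ofInt (m + n) := by rw [hm, ofInt_add, add_assoc]
    obtain ⟨k, hk⟩ := exists_zsmul_of_mem_strip hpq hz (e ▸ hxB.2)
    have hzr : rd z = n + (-k) • (p, q) := by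
      have h1 : rd (x + ofInt n) = rd z + k • (p, q) := by rw [e, rd_add_ofInt, hk]
      rw [rd_add_ofInt, hrd, zero_add] at h1
      rw [h1, neg_smul, add_neg_cancel_right]
    refine ⟨δ, hδ, -k, Or.inl ?_⟩
    rw [hγ, Labelling.mul, hzr, Λ.label_add_zsmul, ← mul_assoc, ← mul_assoc] at hlab
    exact mul_right_cancel hlab
  · have hz' : ofInt (m + n) - z ∈ strip p q := by
      have e : ofInt (m + n) - z = x + ofInt n := by rw [hm, ofInt_add]; abel
      rw [e]
      exact hxB.2
    have hmn := flip_eq_of_mem_strip hz hz'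
    obtain ⟨k, hk⟩ := exists_eq_zsmul hpq (n := m + n - n₀) (by
      rw [Prod.snd_sub, Prod.fst_sub]; linarith)
    have hfl := hf _ hxB.2
    rw [rd_add_ofInt, hrd, zero_add] at hfl
    have hzr : rd z = n₀ - n + k • (p, q) := by
      have hzx : z = -x + ofInt m := by rw [hm]; abel
      have hrx : rd (-x) = 0 := by
        have h1 := abs_lt.1 hxB.1.1
        have h2 := abs_lt.1 hxB.1.2
        refine Prod.ext (round_eq_of_mem ?_) (round_eq_of_mem ?_) <;>
          simp only [Prod.fst_zero, Prod.snd_zero, Int.cast_zero, sub_zero, Prod.fst_neg,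
            Prod.snd_neg] <;>
          constructor <;> linarith
      rw [hzx, rd_add_ofInt, hrx, zero_add, ← hk]
      abel
    refine ⟨δ, hδ, k, Or.inr ?_⟩
    have hj : j * j = 1 := by decide
    have hlab' : γ = δ * (g * (Λ.hol ^ k * Λ.label (n₀ - n))) * j := by
      have h1 : γ * j = δ * (g * (Λ.hol ^ k * Λ.label (n₀ - n))) := by
        rw [hlab, Labelling.mul, hzr, Λ.label_add_zsmul]
      rw [← h1, mul_assoc, hj, mul_one]
    rw [hγ] at hlab'
    have h2 : c * Λ.label n = δ * g * Λ.hol ^ k * f * Λ.label n := by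
      rw [hlab', mul_assoc _ f, ← hfl]
      group
    exact mul_right_cancel h2

end Mucube

namespace Mucube

open CubeIsom (r u j det deck lin side transSum)

/-! ### From single cylinders to periodic directions -/

namespace IsRationalDirection

variable {v : Plane} {p q : ℤ} {lam : ℝ} (h : IsRationalDirection v p q lam)
include h

/-- A line without vertices does not run along the boundary of a strip. -/
lemma ne_of_compatAt {z : Plane} (hz : ∀ s : ℝ, ∃ L, CompatAt L (z + s • v)) (c : ℤ) :
    (p : ℝ) * z.2 - q * z.1 ≠ ((p : ℝ) - q) / 2 + c := by
  intro hc
  obtain ⟨a, b, hab⟩ := h.coprime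
  have hS := h.sq_pos.ne'
  have hl := h.ne_zero
  -- By Bézout there is a vertex `m - (1/2, 1/2)` on the line; below, `s` is the time at which it is
  -- reached.
  obtain ⟨m, hm⟩ : ∃ m : ℤ × ℤ, p * m.2 - q * m.1 = p - q + c :=
    ⟨((p - q + c) * -b, (p - q + c) * a), by linear_combination (p - q + c) * hab⟩
  have hm' : (p : ℝ) * m.2 - q * m.1 = p - q + c := by exact_mod_cast hm
  set d1 : ℝ := m.1 - 1 / 2 - z.1 with hd1
  set d2 : ℝ := m.2 - 1 / 2 - z.2 with hd2
  have hd : (p : ℝ) * d2 - q * d1 = 0 := by rw [hd1, hd2]; linarith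
  set s : ℝ := (p * d1 + q * d2) / (lam * ((p : ℝ) ^ 2 + (q : ℝ) ^ 2)) with hs
  have hsl : s * lam * ((p : ℝ) ^ 2 + (q : ℝ) ^ 2) = p * d1 + q * d2 := by
    rw [hs]; field_simp
  obtain ⟨L, hL⟩ := hz s
  have e1 : (z + s • v).1 = m.1 - 1 / 2 := by
    have : s * (lam * p) = d1 := by
      apply mul_right_cancel₀ hS
      linear_combination (p : ℝ) * hsl + (q : ℝ) * hd
    simp only [Prod.fst_add, Prod.smul_fst, smul_eq_mul, h.fst_eq, this]
    ring
  have e2 : (z + s • v).2 = m.2 - 1 / 2 := by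
    have : s * (lam * q) = d2 := by
      apply mul_right_cancel₀ hS
      linear_combination (q : ℝ) * hsl - (p : ℝ) * hd
    simp only [Prod.snd_add, Prod.smul_snd, smul_eq_mul, h.snd_eq, this]
    ring
  have hround : ∀ n : ℤ, (n : ℝ) - 1 / 2 - round ((n : ℝ) - 1 / 2) = -1 / 2 := by
    intro n
    have : round ((n : ℝ) - 1 / 2) = n := round_eq_of_mem (by constructor <;> linarith)
    rw [this]; ring
  refine hL.not_vertex ⟨?_, ?_⟩
  · simp only [loc, e1, hround]
  · simp only [loc, e2, hround]

/-- A map that is given by charts in affine coordinates, on a connected set foliated by lines, is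
given by a labelled strip. -/
lemma exists_strip_label {E : Type*} [NormedAddCommGroup E] [NormedSpace ℝ E] {S : Type*}
    {π : M → S} {D : Subgroup CubeIsom} (hπ : IsDeckQuotient π D) {ℓ : E →L[ℝ] Plane} {e : E}
    (he : ℓ e = v) {C : Set E} (hC : IsPreconnected C) (hne : C.Nonempty)
    (hCe : ∀ t ∈ C, ∀ s : ℝ, t + s • e ∈ C) {c : E → S}
    (hc : ∀ t ∈ C, ∃ φ ∈ atlasM, ∃ z : Plane, ∀ᶠ w in 𝓝 t,
      z + ℓ w ∈ φ.domain ∧ c w = π (φ.map (z + ℓ w))) (Λ : StripLabelling p q) :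
    ∃ (z₀ : Plane) (g : CubeIsom), det g = 1 ∧ (∀ t ∈ C, z₀ + ℓ t ∈ strip p q) ∧
      ∀ t ∈ C, c t = π (devM (Λ.label.mul g) (z₀ + ℓ t)) := by
  have he0 : ℓ e ≠ 0 := he ▸ h.ne_zero'
  obtain ⟨z₀, hz₀⟩ := exists_global_coord hπ he0 hC hc
  have hcrit : ∀ n, ∀ t ∈ C, ∀ k : ℤ, (p : ℝ) * (z₀ + ofInt n + ℓ t).2 -
      q * (z₀ + ofInt n + ℓ t).1 ≠ ((p : ℝ) - q) / 2 + k := by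
    intro n t ht
    refine h.ne_of_compatAt fun s => ?_
    obtain ⟨L, -, hL⟩ := hz₀ n _ (hCe t ht s)
    refine ⟨L, ?_⟩
    have := hL.self_of_nhds.1
    rwa [map_add, map_smul, he, ← add_assoc] at this
  obtain ⟨t₀, ht₀⟩ := hne
  obtain ⟨n, hn⟩ := exists_add_mem_strip h.coprime (hcrit 0 t₀ ht₀)
  have hn : z₀ + ofInt n + ℓ t₀ ∈ strip p q := by
    rw [show ofInt 0 = 0 by simp [ofInt], add_zero] at hn
    rwa [add_right_comm]
  -- The form `p y - q x` is continuous on the connected set `C` and avoids the critical values, so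
  -- the image remains in one strip.
  have hstrip : ∀ t ∈ C, z₀ + ofInt n + ℓ t ∈ strip p q := by
    intro t ht
    have hX : Continuous fun t => (p : ℝ) * (z₀ + ofInt n + ℓ t).2 - q * (z₀ + ofInt n + ℓ t).1 :=
      by fun_prop
    have := eq_of_locally_eq hC (f := fun t => z₀ + ofInt n + ℓ t ∈ strip p q) (fun t ht => ?_)
      ht₀ ht
    · rwa [← this]
    apply nhdsWithin_le_nhds
    have h0 := hcrit n t ht 0
    have h1 := hcrit n t ht 1
    rw [Int.cast_zero, add_zero] at h0
    rw [Int.cast_one] at h1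
    rcases lt_or_gt_of_ne h0 with h0 | h0
    · filter_upwards [hX.continuousAt.eventually_lt continuousAt_const h0] with t' ht'
      exact propext (iff_of_false (fun hs => absurd ht' (not_lt.2 hs.1.le))
        (fun hs => absurd h0 (not_lt.2 hs.1.le)))
    · rcases lt_or_gt_of_ne h1 with h1 | h1
      · filter_upwards [hX.continuousAt.eventually_lt continuousAt_const h1,
          continuousAt_const.eventually_lt hX.continuousAt h0] with t' ht' ht''
        exact propext (iff_of_true ⟨ht'', ht'⟩ ⟨h0, h1⟩)
      · filter_upwards [continuousAt_const.eventually_lt hX.continuousAt h1] with t' ht'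
        exact propext (iff_of_false (fun hs => absurd ht' (not_lt.2 hs.2.le))
          (fun hs => absurd h1 (not_lt.2 hs.2.le)))
  obtain ⟨g, hg, hgc⟩ := exists_global_label hπ he0 hC (hz₀ n) Λ.det_label
    (fun t ht => Λ.compat _ (hstrip t ht))
  exact ⟨_, g, hg, hstrip, hgc⟩

/-- If the holonomy of a strip has order four, then every trajectory in its direction is closed. -/
lemma isPeriodicDirection (Λ : StripLabelling p q) (hw : Λ.hol ^ 4 = 1) :
    IsPeriodicDirection v := by
  intro c hc
  obtain ⟨z₀, g, -, -, hgc⟩ := h.exists_strip_label isDeckQuotient_id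
    (ℓ := (ContinuousLinearMap.id ℝ ℝ).smulRight v) (e := 1) (by simp) isPreconnected_univ
    univ_nonempty (fun _ _ _ => mem_univ _) (fun t _ => hc t) Λ
  obtain ⟨N, hN, hNlam⟩ : ∃ N : ℤ, (N = 4 ∨ N = -4) ∧ 0 < (N : ℝ) / lam := by
    rcases lt_or_gt_of_ne h.ne_zero with hl | hl
    · exact ⟨-4, Or.inr rfl, div_pos_of_neg_of_neg (by norm_num) hl⟩
    · exact ⟨4, Or.inl rfl, div_pos (by norm_num) hl⟩
  have hN1 : Λ.hol ^ N = 1 := by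
    rw [← pow_natAbs_eq_one]
    rcases hN with rfl | rfl <;> exact hw
  refine ⟨(N : ℝ) / lam, hNlam, fun s => ?_⟩
  rw [hgc _ (mem_univ _), hgc s (mem_univ _)]
  apply Subtype.ext
  change dev _ _ = dev _ _
  have e : z₀ + (ContinuousLinearMap.id ℝ ℝ).smulRight v (s + N / lam) =
      z₀ + (ContinuousLinearMap.id ℝ ℝ).smulRight v s + ofInt (N • (p, q)) := by
    rw [← h.smul_eq, add_assoc]
    simp [add_smul]
  rw [dev_mul, dev_mul, e, Λ.dev_add_zsmul, hN1, act_one]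

/-- A strip that closes up to a single cylinder with intersection number zero has holonomy of
order four. -/
lemma hol_pow_four_of_cylinder (Λ : StripLabelling p q) {g : CubeIsom} (hg : det g = 1)
    (hD : Dense {y | ∃ z ∈ strip p q, toY (devM (Λ.label.mul g) z) = y}) {z : Plane}
    (hz : z ∈ strip p q) {ℓ : ℝ} (hℓ : 0 < ℓ)
    (hper : Function.Periodic (fun s : ℝ => toY (devM (Λ.label.mul g) (z + s • v))) ℓ)
    (hint : intersectionNumber ℓ (fun s => toY (devM (Λ.label.mul g) (z + s • v))) = 0) :
    Λ.hol ^ 4 = 1 := by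
  rcases Λ.rows with ⟨-, hw⟩ | ⟨hq, hr, hlab, hh, hhol⟩
  · exact hw
  obtain ⟨h4, h2⟩ := Λ.quarter_turn_of_dense h.coprime h.sq_pos.ne' hg hD
  have hdet : ∀ m, det (Λ.label.mul g m) = 1 := fun m => by
    rw [Labelling.mul, map_mul, hg, Λ.det_label]; rfl
  obtain ⟨n, hn, s, δ, hδ, hlab'⟩ := exists_int_of_eventually_eq isDeckQuotient_toY h.ne_zero'
    hdet hdet (z₀ := z) (z₁ := z + ℓ • v) (t := 0) (Eventually.of_forall fun s => by
      have e : z + ℓ • v + s • v = z + (s + ℓ) • v := by rw [add_smul]; abel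
      rw [e]
      exact ⟨h.compatAt_mul Λ g hz s, h.compatAt_mul Λ g hz _, (hper s).symm⟩)
  have hn : ℓ • v = ofInt n := by simpa using hn
  obtain ⟨N, rfl, hN⟩ := h.exists_eq_zsmul hn
  have hN0 : N ≠ 0 := by
    rintro rfl
    exact mul_ne_zero hℓ.ne' h.ne_zero (by simpa using hN)
  rw [hn, add_right_comm, rd_add_ofInt] at hlab'
  simp only [Labelling.mul, Λ.label_add_zsmul] at hlab'
  have hδeq : g * Λ.hol ^ N * g⁻¹ = δ := by
    rw [← mul_assoc, ← mul_assoc] at hlab'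
    rw [mul_right_cancel hlab', mul_inv_cancel_right]
  have hd : g * Λ.hol ^ N.natAbs * g⁻¹ ∈ deck := by
    rcases Int.natAbs_eq N with e | e
    · rw [← zpow_natCast, ← e, hδeq]; exact hδ
    · have : g * Λ.hol ^ N.natAbs * g⁻¹ = δ⁻¹ := by
        rw [← hδeq]
        conv_rhs => rw [e, zpow_neg, zpow_natCast]
        group
      rw [this]; exact deck.inv_mem hδ
  obtain ⟨η, hη⟩ := h.intersectionNumber_eq hq hlab hh hhol hz hℓ hN hd
  rw [hint] at hη
  -- A power of a quarter-turn in `deck` is a translation along a single axis, so a vanishing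
  -- coordinate sum makes it trivial.
  have hsum : transSum (g * Λ.hol ^ N.natAbs * g⁻¹) = 0 :=
    (mul_eq_zero.1 hη.symm).resolve_left η.ne_zero
  rw [← conj_pow] at hd hsum
  have hlin : lin (g * Λ.hol * g⁻¹) = lin g * lin Λ.hol * (lin g)⁻¹ := by
    rw [map_mul, map_mul, map_inv]
  have := CubeIsom.pow_four_eq_one_of_sum_trans (a := g * Λ.hol * g⁻¹)
    (by rw [hlin, conj_pow, h4]; group)
    (by
      rw [hlin, conj_pow]
      intro h1
      exact h2 (conj_eq_one_iff.1 h1))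
    (Int.natAbs_pos.2 hN0) hd hsum
  rw [conj_pow] at this
  exact conj_eq_one_iff.1 this

end IsRationalDirection

/-- The cylinder develops into the plane. Its closing up makes the direction rational, so it lies
over one strip, whose image in `Y` is then dense as well; the height of the cylinder plays no role.
The holonomy of this strip has fourth power one, and all trajectories close. -/
lemma isPeriodicDirection_of_isSingleCylinder {v : Plane} (hv : v ≠ 0) {ℓ h : ℝ}
    {Φ : ℝ → ℝ → Y} (hΦ : IsSingleCylinder atlasY v ℓ h Φ)
    (hint : intersectionNumber ℓ (fun s => Φ s (h / 2)) = 0) : IsPeriodicDirection v := by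
  obtain ⟨⟨hℓ, hh, hchart, hinj⟩, hdense⟩ := hΦ
  have hmid : h / 2 ∈ Ioo 0 h := ⟨by linarith, by linarith⟩
  have hper : ∀ s, ∀ y ∈ Ioo 0 h, Φ (s + ℓ) y = Φ s y := fun s y hy =>
    ((hinj s (s + ℓ) y hy y hy).2 ⟨rfl, 1, by simp⟩).symm
  let m : ℝ × ℝ →L[ℝ] Plane := (ContinuousLinearMap.fst ℝ ℝ ℝ).smulRight v +
    (ContinuousLinearMap.snd ℝ ℝ ℝ).smulRight ((-v.2, v.1) : Plane)
  have hm : ∀ w, m w = w.1 • v + w.2 • ((-v.2, v.1) : Plane) := fun w => rfl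
  have hme : m (1, 0) = v := by rw [hm]; simp
  have hC : IsPreconnected ((univ : Set ℝ) ×ˢ Ioo 0 h) :=
    isPreconnected_univ.prod isPreconnected_Ioo
  have hc : ∀ t ∈ (univ : Set ℝ) ×ˢ Ioo 0 h, ∃ φ ∈ atlasM, ∃ z : Plane, ∀ᶠ w in 𝓝 t,
      z + m w ∈ φ.domain ∧ (fun w : ℝ × ℝ => Φ w.1 w.2) w = toY (φ.map (z + m w)) := by
    rintro ⟨s, y⟩ ⟨-, hy⟩
    obtain ⟨_, ⟨φ, hφ, rfl⟩, z, hz⟩ := hchart s y hy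
    refine ⟨φ, hφ, z, ?_⟩
    filter_upwards [hz] with w hw
    rw [hm, ← add_assoc]
    exact hw
  -- The local developments at the parameters `0` and `ℓ` of the core curve differ by an integral
  -- translation, which is `ℓ • v`.
  have hrat : ∃ p q lam, IsRationalDirection v p q lam := by
    obtain ⟨z₀, hz₀⟩ := exists_global_coord isDeckQuotient_toY (ℓ := m) (e := ((1, 0) : ℝ × ℝ))
      (by rwa [hme]) hC hc
    obtain ⟨L, hL, hLe⟩ := hz₀ 0 (0, h / 2) ⟨mem_univ _, hmid⟩
    obtain ⟨L', hL', hLe'⟩ := hz₀ 0 (ℓ, h / 2) ⟨mem_univ _, hmid⟩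
    have c1 : Tendsto (fun s : ℝ => (s, h / 2)) (𝓝 0) (𝓝 (0, h / 2)) :=
      (show Continuous fun s : ℝ => (s, h / 2) by fun_prop).tendsto 0
    have c2 : Tendsto (fun s : ℝ => (s + ℓ, h / 2)) (𝓝 0) (𝓝 (ℓ, h / 2)) := by
      have := (show Continuous fun s : ℝ => (s + ℓ, h / 2) by fun_prop).tendsto 0
      simpa using this
    obtain ⟨n, hn, -⟩ := exists_int_of_eventually_eq isDeckQuotient_toY hv hL hL'
      (z₀ := z₀ + ofInt 0 + (h / 2) • ((-v.2, v.1) : Plane))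
      (z₁ := z₀ + ofInt 0 + (h / 2) • ((-v.2, v.1) : Plane) + ℓ • v) (t := 0) (by
        filter_upwards [c1.eventually hLe, c2.eventually hLe'] with s h1 h2
        have e1 : z₀ + ofInt 0 + (h / 2) • ((-v.2, v.1) : Plane) + s • v =
            z₀ + ofInt 0 + m (s, h / 2) := by rw [hm]; abel
        have e2 : z₀ + ofInt 0 + (h / 2) • ((-v.2, v.1) : Plane) + ℓ • v + s • v =
            z₀ + ofInt 0 + m (s + ℓ, h / 2) := by rw [hm, add_smul]; abel
        rw [e1, e2]
        exact ⟨h1.1, h2.1, h1.2.symm.trans ((hper s _ hmid).symm.trans h2.2)⟩)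
    exact exists_isRationalDirection hv hℓ.ne' (add_left_cancel hn)
  obtain ⟨p, q, lam, hr⟩ := hrat
  obtain ⟨Λ⟩ := exists_stripLabelling hr.coprime hr.pos
  obtain ⟨z₀, g, hg, hstrip, hgc⟩ := hr.exists_strip_label isDeckQuotient_toY hme hC
    ⟨(0, h / 2), mem_univ _, hmid⟩ (fun t ht s => ⟨mem_univ _, by simpa using ht.2⟩) hc Λ
  apply hr.isPeriodicDirection Λ
  have hline : ∀ s : ℝ, z₀ + (h / 2) • ((-v.2, v.1) : Plane) + s • v = z₀ + m (s, h / 2) := by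
    intro s; rw [hm]; abel
  have hΦ : ∀ s, Φ s (h / 2) =
      toY (devM (Λ.label.mul g) (z₀ + (h / 2) • ((-v.2, v.1) : Plane) + s • v)) := by
    intro s
    rw [hline]
    exact hgc (s, h / 2) ⟨mem_univ _, hmid⟩
  refine hr.hol_pow_four_of_cylinder Λ hg (hdense.mono ?_)
    (z := z₀ + (h / 2) • ((-v.2, v.1) : Plane)) ?_ hℓ (fun s => ?_) ?_
  · rintro _ ⟨s, y, hy, rfl⟩
    exact ⟨_, hstrip (s, y) ⟨mem_univ _, hy⟩, (hgc (s, y) ⟨mem_univ _, hy⟩).symm⟩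
  · have := hstrip (0, h / 2) ⟨mem_univ _, hmid⟩
    rw [← hline] at this
    simpa using this
  · beta_reduce
    rw [← hΦ, ← hΦ, hper s _ hmid]
  · rw [← hint]
    congr 1
    funext s
    exact (hΦ s).symm

end Mucube

end

theorem mainTheorem6 (v : Mucube.Plane) (hv : v ≠ 0) :
    Mucube.IsPeriodicDirection v ↔
      ∃ (ℓ h : ℝ) (Φ : ℝ → ℝ → Mucube.Y),
        Mucube.IsSingleCylinder Mucube.atlasY v ℓ h Φ ∧
          Mucube.intersectionNumber ℓ (fun s => Φ s (h / 2)) = 0 := by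
  constructor
  · exact Mucube.exists_isSingleCylinder_of_isPeriodicDirection hv
  · rintro ⟨ℓ, h, Φ, hΦ, hint⟩
    exact Mucube.isPeriodicDirection_of_isSingleCylinder hv hΦ hint
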